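/- Let $m\ge 1$, $\mathcal A=\{1,\dots,m\}$, and let $\zeta$ be a substitution on $\mathcal A$, i.e. a map from $\mathcal A$ to the nonempty finite words over $\mathcal A$, extended to words by concatenation. Let $\mathsf S$ be its substitution matrix, $\mathsf S(i,j)$ = number of symbols $i$ in $\zeta(j)$, with complex eigenvalues $\theta_1,\theta_2,\dots$ ordered so that $|\theta_1|\ge|\theta_2|\ge\dots$. Let $X_\zeta\subset\mathcal A^{\mathbb Z}$ be the set of two-sided sequences $x$ such that every block $x[-n,n]$ occurs as a subword of some $\zeta^k(a)$, and let $T_\zeta$ be the left shift on $X_\zeta$. Suppose that $\zeta$ is primitive (some power of $\mathsf S$ has only positive entries) and aperiodic ($(X_\zeta,T_\zeta)$ has no periodic points), that the characteristic polynomial of $\mathsf S$ is irreducible over $\mathbb Q$, and that there is a second eigenvalue, with $|\theta_2|>1$. Let $\mu$ be the (unique) $T_\zeta$-invariant Borel probability measure on $X_\zeta$. For a strictly positive vector $\vec s=(s_1,\dots,s_m)$ let $(\mathfrak X_\zeta^{\vec s},\widetilde\mu,h_t)$ be the suspension flow over $(X_\zeta,\mu,T_\zeta)$ with roof function equal to $s_j$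 on $\{x: x_0=j\}$; thus $\mathfrak X_\zeta^{\vec s}=\{(x,r): x\in X_\zeta,\ 0\le r\le s_{x_0}\}$ with $(x,s_{x_0})$ identified with $(T_\zeta x,0)$, $h_t$ is the unit-speed vertical flow, and $\widetilde\mu$ is the normalized restriction of $\mu\times\mathrm{Leb}$. A Lip-cylindrical function on $\mathfrak X_\zeta^{\vec s}$ is a function $f(x,r)=\psi_{x_0}(r)$, $0\le r<s_{x_0}$, with Lipschitz $\psi_a:[0,s_a]\to\mathbb C$, and $\|f\|_L=\max_a\|\psi_a\|_L$, where $\|\psi\|_L$ is the sum of the supremum norm and the least Lipschitz constant. Let $\Delta^{m-1}=\{\vec s\in\mathbb R^m: s_j>0,\ \sum_j s_j=1\}$. Then there exists $\alpha>0$, depending only on $\zeta$, such that for Lebesgue-almost every $\vec s\in\Delta^{m-1}$ the following holds: for every Lip-cylindrical function $f$ on $\mathfrak X_\zeta^{\vec s}$ with $\int f\,d\widetilde\mu=0$, every ergodic measurable probability-preserving flow $(Y,H_t,\nu)$ and every $g\in L^2(Y,\nu)$ with $\int g\,d\nu=0$, $$ \left|\int_0^R\bigl\langle (f\otimes g)\circ(h_t\times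 H_t),\,f\otimes g\bigr\rangle\,dt\right|\le C\,R^{1-\alpha}\qquad\text{for all }R>0, $$ where $(f\otimes g)(x,y)=f(x)g(y)$, $\langle\cdot,\cdot\rangle$ is the inner product of $L^2(\mathfrak X_\zeta^{\vec s}\times Y,\widetilde\mu\times\nu)$, and $C>0$ depends only on $\zeta$, $\vec s$, $\|f\|_L$ and $\|g\|_2$. -/

import Mathlib

open MeasureTheory

/-- A substitution on the alphabet `Fin m`: every letter is mapped to a nonempty finite word. -/
structure Substitution (m : ℕ) where
  toFun : Fin m → List (Fin m)
  nonempty : ∀ a, toFun a ≠ []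

namespace Substitution

variable {m : ℕ}

/-- The action of a substitution on finite words, by concatenation. -/
def onWord (ζ : Substitution m) (w : List (Fin m)) : List (Fin m) :=
  w.flatMap ζ.toFun

/-- The substitution matrix: the entry `(i, j)` is the number of symbols `i` in `ζ(j)`. -/
def matrix (ζ : Substitution m) : Matrix (Fin m) (Fin m) ℤ :=
  Matrix.of fun i j => ((ζ.toFun j).count i : ℤ)

/-- The block `x_i x_{i+1} … x_{i+N-1}` of a two-sided sequence. -/
def block (x : ℤ → Fin m) (i : ℤ) (N : ℕ) : List (Fin m) :=
  (List.range N).map fun k : ℕ => x (i + (k : ℤ))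

/-- The two-sided sequences `x` all of whose central blocks `x[-n,n]` occur as subwords in some
`ζ^k(a)`. -/
def spaceSet (ζ : Substitution m) : Set (ℤ → Fin m) :=
  {x | ∀ n : ℕ, ∃ (k : ℕ) (a : Fin m), block x (-(n : ℤ)) (2 * n + 1) <:+: ζ.onWord^[k] [a]}

/-- The substitution space `X_ζ`, with the product (Borel) σ-algebra. -/
abbrev Space (ζ : Substitution m) : Type := ↥(ζ.spaceSet)

theorem block_add (x : ℤ → Fin m) (i : ℤ) (a b : ℕ) :
    block x i (a + b) = block x i a ++ block x (i + a) b := by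
  simp [block, List.range_add, add_assoc, Function.comp_def]

theorem block_infix (x : ℤ → Fin m) (i i' : ℤ) (N N' : ℕ) (h1 : i' ≤ i)
    (h2 : i + N ≤ i' + N') : block x i N <:+: block x i' N' := by
  obtain ⟨a, ha⟩ := Int.eq_ofNat_of_zero_le (sub_nonneg.2 h1)
  obtain ⟨b, hb⟩ := Int.eq_ofNat_of_zero_le (sub_nonneg.2 h2)
  have hN : N' = a + (N + b) := by omega
  have hi : i = i' + a := by omega
  subst hN hi
  rw [block_add, block_add]
  exact ⟨block x i' a, block x (i' + a + N) b, by simp⟩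

theorem shift_mem (ζ : Substitution m) (j : ℤ) {x : ℤ → Fin m} (hx : x ∈ ζ.spaceSet) :
    (fun k => x (k + j)) ∈ ζ.spaceSet := by
  intro n
  obtain ⟨k, a, h⟩ := hx (n + j.natAbs)
  refine ⟨k, a, List.IsInfix.trans ?_ h⟩
  have : block (fun k => x (k + j)) (-(n : ℤ)) (2 * n + 1) =
      block x (-(n : ℤ) + j) (2 * n + 1) := by
    simp only [block]
    refine List.map_congr_left fun k _ => ?_
    congr 1
    ring
  rw [this]
  apply block_infix <;> omega

/-- The `j`-th power of the left shift on `X_ζ`, for `j ∈ ℤ`. -/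
def shift (ζ : Substitution m) (j : ℤ) (x : ζ.Space) : ζ.Space :=
  ⟨fun k => x.1 (k + j), ζ.shift_mem j x.2⟩

/-- Primitivity: some power of the substitution matrix is entrywise positive. -/
def Primitive (ζ : Substitution m) : Prop := ζ.matrix.IsPrimitive

/-- Aperiodicity: the system `(X_ζ, T_ζ)` has no periodic points. -/
def Aperiodic (ζ : Substitution m) : Prop := Function.periodicPts (ζ.shift 1) = ∅

/-- The moduli of the complex eigenvalues of the substitution matrix, counted with algebraic
multiplicity and listed in decreasing order: `|θ₁|, |θ₂|, …`. -/
noncomputable def eigenvalueModuli (ζ : Substitution m) : List ℝ :=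
  ((ζ.matrix.map (Int.cast : ℤ → ℂ)).charpoly.roots.map fun z => ‖z‖).sort (· ≥ ·)

/-- The modulus `|θ₂|` of the second eigenvalue (with value `0` if there is none, i.e. if
`m ≤ 1`). -/
noncomputable def absTheta₂ (ζ : Substitution m) : ℝ := ζ.eigenvalueModuli.getD 1 0

/-- The signed tiling length: `s_{x_0} + … + s_{x_{n-1}}` for `n ≥ 0`, and
`-(s_{x_{-1}} + … + s_{x_n})` for `n < 0`. -/
def roofSum (s : Fin m → ℝ) (x : ℤ → Fin m) : ℤ → ℝ
  | Int.ofNat n => ∑ i ∈ Finset.range n, s (x i)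
  | Int.negSucc n => -∑ i ∈ Finset.range (n + 1), s (x (-(i : ℤ) - 1))

theorem roofSum_add_one (s : Fin m → ℝ) (x : ℤ → Fin m) (n : ℤ) :
    roofSum s x (n + 1) = roofSum s x n + s (x n) := by
  rcases n with n | n
  · exact Finset.sum_range_succ _ _
  · rcases n with _ | n
    · change roofSum s x (Int.ofNat 0) = _
      simp [roofSum, Int.negSucc_eq]
    · have h1 : Int.negSucc (n + 1) + 1 = Int.negSucc n := rfl
      have h2 : Int.negSucc (n + 1) = -((n + 1 : ℕ) : ℤ) - 1 := by
        simp [Int.negSucc_eq]; ring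
      rw [h1]
      simp only [roofSum]
      rw [Finset.sum_range_succ _ (n + 1), ← h2]
      ring

theorem exists_tile (s : Fin m → ℝ) (hs : ∀ a, 0 < s a) (x : ℤ → Fin m) (u : ℝ) :
    ∃ n : ℤ, roofSum s x n ≤ u ∧ u < roofSum s x (n + 1) := by
  have : Nonempty (Fin m) := ⟨x 0⟩
  obtain ⟨a, ha⟩ := Finite.exists_min s
  have hc : 0 < s a := hs a
  have hz : roofSum s x 0 = 0 := by
    change roofSum s x (Int.ofNat 0) = 0
    simp [roofSum]
  have hpos : ∀ n : ℕ, (n : ℝ) * s a ≤ roofSum s x n := by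
    intro n
    induction n with
    | zero => simp [hz]
    | succ n ih =>
      push_cast
      rw [roofSum_add_one]
      have := ha (x n)
      linarith
  have hneg : ∀ n : ℕ, roofSum s x (-(n : ℤ)) ≤ -((n : ℝ) * s a) := by
    intro n
    induction n with
    | zero => simp [hz]
    | succ n ih =>
      have h := roofSum_add_one s x (-((n + 1 : ℕ) : ℤ))
      have e : -((n + 1 : ℕ) : ℤ) + 1 = -(n : ℤ) := by push_cast; ring
      rw [e] at h
      have := ha (x (-((n + 1 : ℕ) : ℤ)))
      push_cast at h this ⊢
      linarith
  have hmono : StrictMono (roofSum s x) :=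
    strictMono_int_of_lt_succ fun n => by
      rw [roofSum_add_one]; linarith [hs (x n)]
  obtain ⟨N, hN⟩ := exists_nat_gt (|u| / s a)
  rw [div_lt_iff₀ hc] at hN
  have hu1 := le_abs_self u
  have hu2 := neg_abs_le u
  obtain ⟨n, hn1, hn2⟩ := Int.exists_greatest_of_bdd (P := fun n => roofSum s x n ≤ u)
    ⟨N, fun z hz' => by
      by_contra hlt
      have := hmono (not_le.1 hlt)
      have := hpos N
      linarith⟩
    ⟨-(N : ℤ), by have := hneg N; linarith⟩
  refine ⟨n, hn1, ?_⟩
  by_contra h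
  have := hn2 (n + 1) (not_lt.1 h)
  omega

/-- The space of the suspension over `(X_ζ, T_ζ)` with the piecewise constant roof function equal to
`s_j` on the cylinder `[j]`, as the fundamental domain `{(x, r) : 0 ≤ r < s_{x_0}}`
(in the suspension the point `(x, s_{x_0})` is identified with `(T x, 0)`). -/
abbrev Suspension (ζ : Substitution m) (s : Fin m → ℝ) : Type :=
  {p : ζ.Space × ℝ // 0 ≤ p.2 ∧ p.2 < s (p.1.1 0)}

/-- The number `n` of tiles crossed when the point `(x, 0)` moves by `u`; it is the unique integer
with `roofSum s x n ≤ u < roofSum s x (n + 1)`. -/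
noncomputable def tileIndex (s : Fin m → ℝ) (hs : ∀ a, 0 < s a) (x : ℤ → Fin m) (u : ℝ) : ℤ :=
  (exists_tile s hs x u).choose

/-- The suspension flow `h_t`: `(x, r)` moves to `(T^n x, r + t - roofSum s x n)`, with the unique
`n` for which this is a point of the fundamental domain. -/
noncomputable def flow (ζ : Substitution m) (s : Fin m → ℝ) (hs : ∀ a, 0 < s a) (t : ℝ)
    (p : ζ.Suspension s) : ζ.Suspension s :=
  ⟨(ζ.shift (tileIndex s hs p.1.1.1 (p.1.2 + t)) p.1.1,
    p.1.2 + t - roofSum s p.1.1.1 (tileIndex s hs p.1.1.1 (p.1.2 + t))), by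
    have h := (exists_tile s hs p.1.1.1 (p.1.2 + t)).choose_spec
    rw [roofSum_add_one] at h
    simp only [shift, zero_add, tileIndex]
    constructor <;> linarith [h.1, h.2]⟩

/-- The flow-invariant probability measure on the suspension induced by a shift-invariant measure
`μ` on `X_ζ`: the normalized restriction of `μ × Lebesgue`. -/
noncomputable def suspensionMeasure (ζ : Substitution m) (s : Fin m → ℝ) (μ : Measure ζ.Space) :
    Measure (ζ.Suspension s) :=
  let ρ : Measure (ζ.Suspension s) := (μ.prod (volume : Measure ℝ)).comap Subtype.val
  (ρ Set.univ)⁻¹ • ρ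

/-- The cylindrical function `f(x, r) = ψ_{x_0}(r)`. -/
def cylindrical (ζ : Substitution m) (s : Fin m → ℝ) (ψ : Fin m → ℝ → ℂ)
    (p : ζ.Suspension s) : ℂ :=
  ψ (p.1.1.1 0) p.1.2

end Substitution

/-- The Lipschitz norm of `φ` on `[0, ℓ]`: the supremum norm plus the best Lipschitz constant. -/
noncomputable def lipNorm (ℓ : ℝ) (φ : ℝ → ℂ) : ℝ :=
  (⨆ t : Set.Icc (0 : ℝ) ℓ, ‖φ t‖) +
    ⨆ p : Set.Icc (0 : ℝ) ℓ × Set.Icc (0 : ℝ) ℓ, ‖φ p.1 - φ p.2‖ / |(p.1 : ℝ) - p.2|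

/-- The norm `‖f‖_L = max_a ‖ψ_a‖_L` of a Lipschitz cylindrical function. -/
noncomputable def cylLipNorm {m : ℕ} (s : Fin m → ℝ) (ψ : Fin m → ℝ → ℂ) : ℝ :=
  ⨆ a, lipNorm (s a) (ψ a)

/-- The open simplex of strictly positive roof vectors of total length one. -/
def roofSimplex (m : ℕ) : Set (Fin m → ℝ) :=
  {s | (∀ a, 0 < s a) ∧ ∑ a, s a = 1}

/-- The tensor product `(f ⊗ g)(x, y) = f(x) g(y)`. -/
def tensorFun {X Y : Type*} (f : X → ℂ) (g : Y → ℂ) (p : X × Y) : ℂ := f p.1 * g p.2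

/-! By Fubini the correlation of `f ⊗ g` is the autocorrelation of `f` times that of `g`. Fix a
point of the suspension and put u(t) = f(h_t x). Pairing u on [0, R] with the autocorrelation of `g`
costs at most 2 ‖g‖² sup_ω |∫₀ᴿ e^{-2πiωt} u(t) dt| (`norm_integral_mul_autocorrelation_le`). This
holds for every measure-preserving flow, by transference to a circle of length 2R and Parseval. It
remains to bound the twisted ergodic integrals of `f` by R^{1-α}, uniformly in the point and in ω
(`exists_norm_twisted_integral_le_rpow`).

Up to boundary terms such an integral is an exponential sum over a word of the language, weighted by
the Fourier transforms of the profiles on the tiles. Words are cut into blocks ζ^n(b). By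
primitivity some word d v d occurs in every ζ^q(b), so every ζ^{n+q}(b) contains two copies of
ζ^n(d) whose sums differ by the phase of ω|ζ^n(dv)|. This gains a factor exp(-c ‖ω|ζ^n(dv)|‖²), with
‖·‖ the distance to ℤ (`BlockBound.gain`), and the gains accumulate over the levels
(`BlockBound.exists_of_sum`).

Frequencies e^{-εn} ≤ |ω| ≤ e^{εn} are treated by an Erdős–Kahane argument
(`exists_ae_line_sum_distInt_sq_ge`, `ae_roofSimplex_ekGood`). The lengths L_k = |ζ^k(dv)| satisfy
the recurrence of the characteristic polynomial. If ωL_k is near an integer for most k < n, the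
nearest integers satisfy the recurrence with few exceptions, so there are few such integer
sequences. Each sequence fixes the two expanding coordinates of the orbit up to O(ρ^{-n}), with ρ >
1 below the moduli of two roots. One coordinate is spent on the unknown ω; the other locates the
roof vector on a line. The bad parameters thus have summable measure, and Borel–Cantelli and Fubini
along lines give almost every roof vector.

For larger ω the weights are O(1/|ω|), as the profiles are Lipschitz. For smaller ω the sum is close
to the untwisted one, which decays because `f` has mean zero and block averages contract
(`BlockBound.contract`). `exists_blockBound_exp` joins the three ranges; taking n proportional to
log R gives the power of R. -/

namespace Substitution

variable {m : ℕ}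

/-! ### Iterates of a substitution on words -/

/-- A bound for the lengths of the words `ζ(a)`. -/
def maxLength (ζ : Substitution m) : ℕ := ∑ a, (ζ.toFun a).length + 2

/-- The added 2 keeps `Real.log ζ.maxLength` positive; the later choices of scale divide by it. -/
theorem two_le_maxLength (ζ : Substitution m) : 2 ≤ ζ.maxLength := by
  simp [maxLength]

theorem length_toFun_le (ζ : Substitution m) (a : Fin m) :
    (ζ.toFun a).length ≤ ζ.maxLength := by
  have := Finset.single_le_sum (f := fun a => (ζ.toFun a).length) (fun _ _ => Nat.zero_le _)
    (Finset.mem_univ a)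
  simp only [maxLength]
  omega

theorem onWord_nil (ζ : Substitution m) : ζ.onWord [] = [] := rfl

theorem onWord_append (ζ : Substitution m) (w w' : List (Fin m)) :
    ζ.onWord (w ++ w') = ζ.onWord w ++ ζ.onWord w' := by
  simp [onWord]

theorem iterate_nil (ζ : Substitution m) (n : ℕ) : ζ.onWord^[n] [] = [] :=
  Function.iterate_fixed ζ.onWord_nil n

theorem iterate_append (ζ : Substitution m) (n : ℕ) (w w' : List (Fin m)) :
    ζ.onWord^[n] (w ++ w') = ζ.onWord^[n] w ++ ζ.onWord^[n] w' := by
  induction n generalizing w w' with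
  | zero => rfl
  | succ n ih => simp only [Function.iterate_succ_apply, onWord_append, ih]

theorem iterate_cons (ζ : Substitution m) (n : ℕ) (a : Fin m) (w : List (Fin m)) :
    ζ.onWord^[n] (a :: w) = ζ.onWord^[n] [a] ++ ζ.onWord^[n] w := by
  rw [← iterate_append]; rfl

theorem iterate_eq_flatMap (ζ : Substitution m) (n : ℕ) (w : List (Fin m)) :
    ζ.onWord^[n] w = w.flatMap fun a => ζ.onWord^[n] [a] := by
  induction w with
  | nil => simp [iterate_nil]
  | cons a w ih => rw [iterate_cons, ih, List.flatMap_cons]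

theorem iterate_infix (ζ : Substitution m) (n : ℕ) {w w' : List (Fin m)} (h : w <:+: w') :
    ζ.onWord^[n] w <:+: ζ.onWord^[n] w' := by
  obtain ⟨p, r, rfl⟩ := h
  exact ⟨ζ.onWord^[n] p, ζ.onWord^[n] r, by simp only [iterate_append]⟩

theorem length_onWord_le (ζ : Substitution m) (w : List (Fin m)) :
    (ζ.onWord w).length ≤ ζ.maxLength * w.length := by
  induction w with
  | nil => simp [onWord]
  | cons a w ih =>
    have h : ζ.onWord (a :: w) = ζ.toFun a ++ ζ.onWord w := by simp [onWord]
    rw [h, List.length_append, List.length_cons, mul_add, mul_one]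
    have := ζ.length_toFun_le a
    omega

theorem length_iterate_le (ζ : Substitution m) (n : ℕ) (w : List (Fin m)) :
    (ζ.onWord^[n] w).length ≤ ζ.maxLength ^ n * w.length := by
  induction n with
  | zero => simp
  | succ n ih =>
    rw [Function.iterate_succ_apply', pow_succ']
    refine (ζ.length_onWord_le _).trans ?_
    rw [mul_assoc]
    exact Nat.mul_le_mul_left _ ih

theorem length_iterate_singleton_le (ζ : Substitution m) (n : ℕ) (a : Fin m) :
    (ζ.onWord^[n] [a]).length ≤ ζ.maxLength ^ n := by
  simpa using ζ.length_iterate_le n [a]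

theorem length_le_length_onWord (ζ : Substitution m) (w : List (Fin m)) :
    w.length ≤ (ζ.onWord w).length := by
  induction w with
  | nil => simp
  | cons a w ih =>
    have h : ζ.onWord (a :: w) = ζ.toFun a ++ ζ.onWord w := by simp [onWord]
    have := List.length_pos_iff.2 (ζ.nonempty a)
    rw [h, List.length_append, List.length_cons]
    omega

theorem length_le_length_iterate (ζ : Substitution m) (n : ℕ) (w : List (Fin m)) :
    w.length ≤ (ζ.onWord^[n] w).length := by
  induction n with
  | zero => simp
  | succ n ih =>
    rw [Function.iterate_succ_apply']
    exact ih.trans (ζ.length_le_length_onWord _)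

theorem length_iterate_singleton_pos (ζ : Substitution m) (n : ℕ) (a : Fin m) :
    0 < (ζ.onWord^[n] [a]).length :=
  lt_of_lt_of_le (by simp) (ζ.length_le_length_iterate n [a])

/-- The abelianization of a word. -/
def population (w : List (Fin m)) : Fin m → ℤ := fun i => (w.count i : ℤ)

theorem population_append (w w' : List (Fin m)) :
    population (w ++ w') = population w + population w' := by
  ext i; simp [population]

theorem population_onWord (ζ : Substitution m) (w : List (Fin m)) :
    population (ζ.onWord w) = ζ.matrix.mulVec (population w) := by
  induction w with
  | nil =>
    have : population ([] : List (Fin m)) = 0 := by ext i; simp [population]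
    rw [onWord_nil, this, Matrix.mulVec_zero]
  | cons a w ih =>
    have h : ζ.onWord (a :: w) = ζ.toFun a ++ ζ.onWord w := by simp [onWord]
    have h' : a :: w = [a] ++ w := rfl
    rw [h, population_append, ih, h', population_append, Matrix.mulVec_add]
    congr 1
    have : population [a] = Pi.single a 1 := by
      ext i
      by_cases hi : i = a
      · subst hi; simp [population]
      · have : a ≠ i := fun h => hi h.symm
        simp [population, hi, this]
    rw [this, Matrix.mulVec_single_one]
    ext i
    simp [population, matrix]

theorem population_iterate (ζ : Substitution m) (n : ℕ) (w : List (Fin m)) :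
    population (ζ.onWord^[n] w) = (ζ.matrix ^ n).mulVec (population w) := by
  induction n with
  | zero => simp
  | succ n ih =>
    rw [Function.iterate_succ_apply', population_onWord, ih, pow_succ', Matrix.mulVec_mulVec]

theorem count_iterate_singleton (ζ : Substitution m) (n : ℕ) (i a : Fin m) :
    ((ζ.onWord^[n] [a]).count i : ℤ) = (ζ.matrix ^ n) i a := by
  have h := congrFun (ζ.population_iterate n [a]) i
  have : population [a] = Pi.single a 1 := by
    ext i
    by_cases hi : i = a
    · subst hi; simp [population]
    · have : a ≠ i := fun h => hi h.symm
      simp [population, hi, this]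
  rw [this, Matrix.mulVec_single_one] at h
  exact h

theorem Primitive.exists_mem {ζ : Substitution m} (h : ζ.Primitive) :
    ∃ p : ℕ, 0 < p ∧ ∀ a b, a ∈ ζ.onWord^[p] [b] := by
  obtain ⟨p, hp, hpos⟩ := h.exists_pos_pow
  refine ⟨p, hp, fun a b => ?_⟩
  have h1 := hpos a b
  rw [← count_iterate_singleton] at h1
  exact List.count_pos_iff.1 (by exact_mod_cast h1)

theorem singleton_infix {a : Fin m} {w : List (Fin m)} (h : a ∈ w) : [a] <:+: w := by
  obtain ⟨p, r, rfl⟩ := List.append_of_mem h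
  exact ⟨p, r, by simp⟩

/-- As a occurs in ζ^p(b), the block ζ^n(a) lies in ζ^{n+p}(b) = ζ^p(ζ^n(b)). Blocks of one level
are therefore comparable in length, with a constant independent of the level. -/
theorem length_iterate_le_of_mem {ζ : Substitution m} {p : ℕ}
    (hp : ∀ a b, a ∈ ζ.onWord^[p] [b]) (n : ℕ) (a b : Fin m) :
    (ζ.onWord^[n] [a]).length ≤ ζ.maxLength ^ p * (ζ.onWord^[n] [b]).length := by
  have h1 := (ζ.iterate_infix n (singleton_infix (hp a b))).length_le
  rw [← Function.iterate_add_apply, add_comm, Function.iterate_add_apply] at h1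
  exact h1.trans (ζ.length_iterate_le p _)

/-- Used to see that one copy of ζ^n(d) fills a fixed proportion of ζ^{n+q}(b), so that a saving on
it is a relative saving. -/
theorem length_iterate_add_le_of_mem {ζ : Substitution m} {p : ℕ}
    (hp : ∀ a b, a ∈ ζ.onWord^[p] [b]) (n q : ℕ) (b d : Fin m) :
    (ζ.onWord^[n + q] [b]).length ≤ ζ.maxLength ^ (p + q) * (ζ.onWord^[n] [d]).length := by
  rw [Function.iterate_add_apply]
  have key : ∀ w : List (Fin m), (ζ.onWord^[n] w).length ≤
      w.length * (ζ.maxLength ^ p * (ζ.onWord^[n] [d]).length) := by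
    intro w
    induction w with
    | nil => simp [iterate_nil]
    | cons a w ih =>
      rw [iterate_cons, List.length_append, List.length_cons, add_mul, one_mul]
      have := length_iterate_le_of_mem hp n a d
      omega
  refine (key _).trans ?_
  rw [pow_add, mul_comm (ζ.maxLength ^ p) (ζ.maxLength ^ q), mul_assoc]
  exact Nat.mul_le_mul_right _ (ζ.length_iterate_singleton_le q b)

/-- A letter `c` and a word `c :: v` such that `c v c` occurs in `ζ^q(b)` for every letter `b`. -/
theorem Primitive.exists_return_word {ζ : Substitution m} (h : ζ.Primitive) (hm : 2 ≤ m) :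
    ∃ (q : ℕ) (c : Fin m) (v : List (Fin m)), 0 < q ∧
      ∀ b, ∃ p r, ζ.onWord^[q] [b] = p ++ (c :: v) ++ (c :: r) := by
  obtain ⟨p, hp, hmem⟩ := h.exists_mem
  let c : Fin m := ⟨0, by omega⟩
  let d : Fin m := ⟨1, by omega⟩
  have hcd : c ≠ d := by simp [c, d, Fin.ext_iff]
  -- The letters c ≠ d occupy different positions of ζ^p(c), and the image of each under ζ^p
  -- contains c; so c occurs twice in ζ^{2p}(c).
  have hocc : ∃ u v w, ζ.onWord^[p + p] [c] = u ++ (c :: v) ++ (c :: w) := by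
    have key : ∀ x y : Fin m, x ≠ y → ∀ U V W : List (Fin m),
        ζ.onWord^[p] [c] = U ++ (x :: V) ++ (y :: W) →
        ∃ u v w, ζ.onWord^[p + p] [c] = u ++ (c :: v) ++ (c :: w) := by
      intro x y _ U V W hUVW
      obtain ⟨u1, v1, e1⟩ := List.append_of_mem (hmem c x)
      obtain ⟨u2, v2, e2⟩ := List.append_of_mem (hmem c y)
      rw [Function.iterate_add_apply, hUVW, iterate_append, iterate_append, iterate_cons _ _ x,
        iterate_cons _ _ y, e1, e2]
      exact ⟨ζ.onWord^[p] U ++ u1, v1 ++ ζ.onWord^[p] V ++ u2, v2 ++ ζ.onWord^[p] W, by simp⟩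
    obtain ⟨u, v, e⟩ := List.append_of_mem (hmem c c)
    have hd := hmem d c
    rw [e, List.mem_append, List.mem_cons] at hd
    rcases hd with hd | hd | hd
    · obtain ⟨u', v', e'⟩ := List.append_of_mem hd
      exact key d c hcd.symm u' v' v (by rw [e, e'])
    · exact absurd hd.symm hcd
    · obtain ⟨u', v', e'⟩ := List.append_of_mem hd
      exact key c d hcd u u' v' (by rw [e, e']; simp)
  obtain ⟨u, v, w, e⟩ := hocc
  refine ⟨p + p + p, c, v, by omega, fun b => ?_⟩
  obtain ⟨p', r', e'⟩ := List.append_of_mem (hmem c b)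
  rw [Function.iterate_add_apply, e', iterate_append, iterate_cons, e]
  exact ⟨ζ.onWord^[p + p] p' ++ u, w ++ ζ.onWord^[p + p] r', by simp⟩

end Substitution

/-! ### Decomposition of words into blocks -/

theorem List.prefix_or_of_prefix_append {β : Type*} {w a b : List β} (h : w <+: a ++ b) :
    w <+: a ∨ ∃ t, w = a ++ t ∧ t <+: b := by
  obtain ⟨r, hr⟩ := h
  rcases List.append_eq_append_iff.1 hr with ⟨c, rfl, _⟩ | ⟨c, rfl, rfl⟩
  · exact Or.inl ⟨c, rfl⟩
  · exact Or.inr ⟨c, rfl, r, rfl⟩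

theorem List.suffix_or_of_suffix_append {β : Type*} {w a b : List β} (h : w <:+ a ++ b) :
    w <:+ b ∨ ∃ t, w = t ++ b ∧ t <:+ a := by
  obtain ⟨r, hr⟩ := h
  rcases List.append_eq_append_iff.1 hr with ⟨c, rfl, rfl⟩ | ⟨c, rfl, rfl⟩
  · exact Or.inr ⟨c, rfl, r, rfl⟩
  · exact Or.inl ⟨c, rfl⟩

theorem List.exists_of_prefix_flatMap {α β : Type*} (f : α → List β) {L : ℕ}
    (hL : ∀ a, (f a).length ≤ L) (U : List α) (w : List β) (h : w <+: U.flatMap f) :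
    ∃ (W : List α) (q : List β), w = W.flatMap f ++ q ∧ q.length ≤ L := by
  induction U generalizing w with
  | nil =>
    refine ⟨[], [], ?_, by simp⟩
    simpa using h
  | cons a U ih =>
    rw [List.flatMap_cons] at h
    rcases List.prefix_or_of_prefix_append h with h | ⟨t, rfl, ht⟩
    · exact ⟨[], w, by simp, h.length_le.trans (hL a)⟩
    · obtain ⟨W, q, rfl, hq⟩ := ih t ht
      exact ⟨a :: W, q, by simp, hq⟩

theorem List.exists_of_suffix_flatMap {α β : Type*} (f : α → List β) {L : ℕ}
    (hL : ∀ a, (f a).length ≤ L) (U : List α) (w : List β) (h : w <:+ U.flatMap f) :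
    ∃ (p : List β) (W : List α), w = p ++ W.flatMap f ∧ p.length ≤ L := by
  induction U generalizing w with
  | nil =>
    refine ⟨[], [], ?_, by simp⟩
    simpa using h
  | cons a U ih =>
    rw [List.flatMap_cons] at h
    rcases List.suffix_or_of_suffix_append h with h | ⟨t, rfl, ht⟩
    · exact ih w h
    · exact ⟨t, U, rfl, ht.length_le.trans (hL a)⟩

/-- Cutting at the first and last block boundaries inside the word leaves two incomplete blocks, one
at each end. -/
theorem List.exists_of_infix_flatMap {α β : Type*} (f : α → List β) {L : ℕ}
    (hL : ∀ a, (f a).length ≤ L) (U : List α) (w : List β) (h : w <:+: U.flatMap f) :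
    ∃ (p : List β) (W : List α) (q : List β), w = p ++ W.flatMap f ++ q ∧
      p.length ≤ L ∧ q.length ≤ L := by
  obtain ⟨t, ht, hs⟩ := List.infix_iff_prefix_suffix.1 h
  obtain ⟨p, V, rfl, hp⟩ := List.exists_of_suffix_flatMap f hL U t hs
  rcases List.prefix_or_of_prefix_append ht with h | ⟨t, rfl, ht'⟩
  · exact ⟨w, [], [], by simp, h.length_le.trans hp, by simp⟩
  · obtain ⟨W, q, rfl, hq⟩ := List.exists_of_prefix_flatMap f hL V t ht'
    exact ⟨p, W, q, by simp, hp, hq⟩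

/-! ### Characters and the distance to the integers. -/

/-- The distance of a real number to the nearest integer. -/
noncomputable def distInt (y : ℝ) : ℝ := |y - round y|

/-- The character `x ↦ exp(-2πix)`. -/
noncomputable def twist (x : ℝ) : ℂ := Complex.exp (((-(2 * Real.pi * x) : ℝ) : ℂ) * Complex.I)

theorem norm_twist (x : ℝ) : ‖twist x‖ = 1 := Complex.norm_exp_ofReal_mul_I _

theorem twist_add (x y : ℝ) : twist (x + y) = twist x * twist y := by
  rw [twist, twist, twist, ← Complex.exp_add]
  congr 1
  push_cast
  ring

theorem twist_zero : twist 0 = 1 := by simp [twist]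

theorem continuous_twist : Continuous twist := by
  unfold twist
  fun_prop

theorem norm_twist_sub_one_le (x : ℝ) : ‖twist x - 1‖ ≤ 2 * Real.pi * |x| := by
  rw [twist, mul_comm]
  refine (Real.norm_exp_I_mul_ofReal_sub_one_le (x := -(2 * Real.pi * x))).trans ?_
  rw [norm_neg, Real.norm_eq_abs, abs_mul, abs_of_pos Real.two_pi_pos]

/-- With δ the distance of y to ℤ, the norm is 2 cos πδ. Its square is 4(1 - sin² πδ), and sin πδ ≥
2δ on [0, 1/2] bounds it by 4 - 16δ² ≤ (2 - 4δ²)². -/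
theorem norm_one_add_twist_le (y : ℝ) : ‖1 + twist y‖ ≤ 2 - 4 * distInt y ^ 2 := by
  have hd0 : 0 ≤ distInt y := abs_nonneg _
  have hd : distInt y ≤ 1 / 2 := abs_sub_round y
  have hcos : Real.cos (2 * Real.pi * y) = Real.cos (2 * Real.pi * distInt y) := by
    have h1 : Real.cos (2 * Real.pi * distInt y) = Real.cos (2 * Real.pi * (y - round y)) := by
      rw [← Real.cos_abs (2 * Real.pi * (y - round y)), abs_mul, abs_of_pos Real.two_pi_pos]
      rfl
    rw [h1, show 2 * Real.pi * (y - round y) = 2 * Real.pi * y - (round y : ℤ) * (2 * Real.pi) by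
      ring, Real.cos_sub_int_mul_two_pi]
  have hsin : 2 * distInt y ≤ Real.sin (Real.pi * distInt y) := by
    have h := Real.mul_le_sin (x := Real.pi * distInt y) (by positivity)
      (by nlinarith [Real.pi_pos])
    have hpi := Real.pi_pos
    calc 2 * distInt y = 2 / Real.pi * (Real.pi * distInt y) := by field_simp
      _ ≤ _ := h
  have hsq : ‖1 + twist y‖ ^ 2 = 4 * (1 - Real.sin (Real.pi * distInt y) ^ 2) := by
    rw [← Complex.normSq_eq_norm_sq, twist, Complex.exp_mul_I, Complex.normSq_apply]
    rw [← Complex.ofReal_cos, ← Complex.ofReal_sin, Real.cos_neg]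
    simp only [Complex.add_re, Complex.one_re, Complex.ofReal_re, Complex.mul_re, Complex.I_re,
      Complex.ofReal_im, Complex.I_im, Complex.add_im, Complex.one_im, Complex.mul_im]
    have h1 := Real.sin_sq_add_cos_sq (2 * Real.pi * y)
    have h2 : Real.cos (2 * Real.pi * y) = 1 - 2 * Real.sin (Real.pi * distInt y) ^ 2 := by
      rw [hcos, show 2 * Real.pi * distInt y = 2 * (Real.pi * distInt y) by ring,
        Real.cos_two_mul, Real.cos_sq']
      ring
    have h3 : Real.sin (-(2 * Real.pi * y)) = -Real.sin (2 * Real.pi * y) := Real.sin_neg _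
    rw [h3]
    nlinarith
  refine abs_le_of_sq_le_sq' ?_ (by nlinarith) |>.2
  rw [hsq]
  nlinarith [sq_nonneg (distInt y), mul_self_le_mul_self (by positivity) hsin]

namespace Substitution

variable {m : ℕ}

/-! ### Twisted sums over words -/

/-- The length of a word whose letter `a` is a tile of length `s a`. -/
def wordLength (s : Fin m → ℝ) (w : List (Fin m)) : ℝ := (w.map s).sum

theorem wordLength_append (s : Fin m → ℝ) (w w' : List (Fin m)) :
    wordLength s (w ++ w') = wordLength s w + wordLength s w' := by
  simp [wordLength]

theorem wordLength_eq_sum (s : Fin m → ℝ) (w : List (Fin m)) :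
    wordLength s w = ∑ i, s i * population w i := by
  simp only [wordLength, population]
  rw [Finset.sum_list_map_count]
  rw [Finset.sum_subset (Finset.subset_univ w.toFinset)]
  · refine Finset.sum_congr rfl fun i _ => ?_
    simp [mul_comm]
  · intro i _ hi
    have : w.count i = 0 := List.count_eq_zero.2 (by simpa using hi)
    simp [this]

/-- The exponential sum `∑_j exp(-2πiω |w_0 … w_{j-1}|) c(w_j)` over a word `w`. -/
noncomputable def twistedSum (s : Fin m → ℝ) (ω : ℝ) (c : Fin m → ℂ) : List (Fin m) → ℂ
  | [] => 0
  | a :: w => c a + twist (ω * s a) * twistedSum s ω c w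

theorem twistedSum_append (s : Fin m → ℝ) (ω : ℝ) (c : Fin m → ℂ) (w w' : List (Fin m)) :
    twistedSum s ω c (w ++ w') =
      twistedSum s ω c w + twist (ω * wordLength s w) * twistedSum s ω c w' := by
  induction w with
  | nil => simp [twistedSum, wordLength, twist_zero]
  | cons a w ih =>
    have : wordLength s (a :: w) = s a + wordLength s w := by simp [wordLength]
    rw [List.cons_append, twistedSum, ih, twistedSum, this, mul_add ω, twist_add]
    ring

theorem norm_twistedSum_append_le (s : Fin m → ℝ) (ω : ℝ) (c : Fin m → ℂ)
    (w w' : List (Fin m)) :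
    ‖twistedSum s ω c (w ++ w')‖ ≤ ‖twistedSum s ω c w‖ + ‖twistedSum s ω c w'‖ := by
  rw [twistedSum_append]
  refine (norm_add_le _ _).trans ?_
  rw [norm_mul, norm_twist, one_mul]

theorem norm_twistedSum_le (s : Fin m → ℝ) (ω : ℝ) {c : Fin m → ℂ} {B : ℝ}
    (hB : ∀ a, ‖c a‖ ≤ B) (w : List (Fin m)) : ‖twistedSum s ω c w‖ ≤ B * w.length := by
  induction w with
  | nil => simp [twistedSum]
  | cons a w ih =>
    rw [twistedSum]
    refine (norm_add_le _ _).trans ?_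
    rw [norm_mul, norm_twist, one_mul]
    have := hB a
    push_cast [List.length_cons]
    linarith

/-- The twisted sums over the blocks `ζ^n(b)` are bounded by `ρ` times the length of the block. -/
def BlockBound (ζ : Substitution m) (s : Fin m → ℝ) (ω : ℝ) (c : Fin m → ℂ) (n : ℕ) (ρ : ℝ) :
    Prop :=
  ∀ b, ‖twistedSum s ω c (ζ.onWord^[n] [b])‖ ≤ ρ * (ζ.onWord^[n] [b]).length

variable {ζ : Substitution m} {s : Fin m → ℝ} {ω : ℝ} {c : Fin m → ℂ} {n : ℕ} {ρ : ℝ}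

/-- Normalising by length makes the bound additive under concatenation, so it passes to all words
made of blocks and to all higher levels. -/
theorem BlockBound.norm_le (h : ζ.BlockBound s ω c n ρ) (w : List (Fin m)) :
    ‖twistedSum s ω c (ζ.onWord^[n] w)‖ ≤ ρ * (ζ.onWord^[n] w).length := by
  induction w with
  | nil => simp [iterate_nil, twistedSum]
  | cons a w ih =>
    rw [iterate_cons, List.length_append]
    refine (norm_twistedSum_append_le ..).trans ?_
    have := h a
    push_cast
    linarith

theorem BlockBound.add (h : ζ.BlockBound s ω c n ρ) (k : ℕ) : ζ.BlockBound s ω c (n + k) ρ := by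
  intro b
  rw [Function.iterate_add_apply]
  exact h.norm_le _

theorem BlockBound.mono (h : ζ.BlockBound s ω c n ρ) {ρ' : ℝ} (hρ : ρ ≤ ρ') :
    ζ.BlockBound s ω c n ρ' := fun b => (h b).trans (by gcongr)

/-- Twisted sums over a subword of some `ζ^K(a)` are controlled by those over the blocks of a given
level. -/
theorem BlockBound.norm_le_of_infix (h : ζ.BlockBound s ω c n ρ) (hρ : 0 ≤ ρ) {B : ℝ}
    (hB0 : 0 ≤ B) (hB : ∀ a, ‖c a‖ ≤ B) {w : List (Fin m)} {K : ℕ} {a : Fin m}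
    (hw : w <:+: ζ.onWord^[K] [a]) :
    ‖twistedSum s ω c w‖ ≤ ρ * w.length + 2 * B * ζ.maxLength ^ n := by
  have hA : (1 : ℝ) ≤ ζ.maxLength := by
    have := ζ.two_le_maxLength
    exact_mod_cast (by omega : 1 ≤ ζ.maxLength)
  have hword : ∀ p : List (Fin m), p.length ≤ ζ.maxLength ^ n →
      ‖twistedSum s ω c p‖ ≤ B * ζ.maxLength ^ n := fun p hp =>
    (norm_twistedSum_le s ω hB p).trans (by gcongr; exact_mod_cast hp)
  rcases le_total n K with hK | hK
  · obtain ⟨k, rfl⟩ := Nat.exists_eq_add_of_le hK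
    rw [Function.iterate_add_apply, iterate_eq_flatMap] at hw
    obtain ⟨p, W, q, rfl, hp, hq⟩ := List.exists_of_infix_flatMap _
      (fun a => ζ.length_iterate_singleton_le n a) _ _ hw
    rw [← iterate_eq_flatMap]
    have h1 := norm_twistedSum_append_le s ω c (p ++ ζ.onWord^[n] W) q
    have h2 := norm_twistedSum_append_le s ω c p (ζ.onWord^[n] W)
    have h3 := h.norm_le W
    have h4 := hword p hp
    have h5 := hword q hq
    rw [List.length_append, List.length_append]
    push_cast
    have : 0 ≤ ρ * p.length := by positivity
    have : 0 ≤ ρ * q.length := by positivity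
    linarith
  -- For K ≤ n the whole word is no longer than the error term allows, and the trivial bound
  -- suffices.
  · have h1 : w.length ≤ ζ.maxLength ^ n :=
      hw.length_le.trans ((ζ.length_iterate_singleton_le K a).trans
        (Nat.pow_le_pow_right (by have := ζ.two_le_maxLength; omega) hK))
    have h2 := hword w h1
    have : 0 ≤ ρ * w.length := by positivity
    have : 0 ≤ B * ζ.maxLength ^ n := by positivity
    linarith

/-- The gain from two occurrences of the block `ζ^n(d)` in `ζ^{n+q}(b)`. -/
theorem BlockBound.gain (h : ζ.BlockBound s ω c n ρ) (hρ : 0 ≤ ρ) {p q : ℕ}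
    (hp : ∀ a b, a ∈ ζ.onWord^[p] [b]) {d : Fin m} {v : List (Fin m)}
    (hv : ∀ b, ∃ p r, ζ.onWord^[q] [b] = p ++ (d :: v) ++ (d :: r)) :
    ζ.BlockBound s ω c (n + q) (ρ * Real.exp (-(4 / (ζ.maxLength : ℝ) ^ (p + q)) *
      distInt (ω * wordLength s (ζ.onWord^[n] (d :: v))) ^ 2)) := by
  intro b
  obtain ⟨P, r, e⟩ := hv b
  set ε := distInt (ω * wordLength s (ζ.onWord^[n] (d :: v))) ^ 2 with hε
  have hA : (0 : ℝ) < ζ.maxLength := by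
    have := ζ.two_le_maxLength
    exact_mod_cast (by omega : 0 < ζ.maxLength)
  have hlen := length_iterate_add_le_of_mem hp n q b d
  -- This turns the saving on ζ^n(d) into one proportional to the whole block.
  have hlen' : ((ζ.onWord^[n + q] [b]).length : ℝ) / (ζ.maxLength : ℝ) ^ (p + q) ≤
      (ζ.onWord^[n] [d]).length := by
    rw [div_le_iff₀ (by positivity), mul_comm]
    exact_mod_cast hlen
  have hsplit : ζ.onWord^[n + q] [b] = ζ.onWord^[n] P ++ (ζ.onWord^[n] [d] ++
      (ζ.onWord^[n] v ++ (ζ.onWord^[n] [d] ++ ζ.onWord^[n] r))) := by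
    rw [Function.iterate_add_apply, e, iterate_append, iterate_append, iterate_cons _ _ d v,
      iterate_cons _ _ d r]
    simp
  -- The two copies of ζ^n(d) contribute one number D with relative phase `twist (ω |ζ^n(dv)|)`,
  -- hence at most (2 - 4ε)‖D‖ together. The remaining pieces get the triangle inequality.
  have hT : ‖twistedSum s ω c (ζ.onWord^[n + q] [b])‖ ≤
      ‖twistedSum s ω c (ζ.onWord^[n] P)‖ + (2 - 4 * ε) * ‖twistedSum s ω c (ζ.onWord^[n] [d])‖ +
      ‖twistedSum s ω c (ζ.onWord^[n] v)‖ + ‖twistedSum s ω c (ζ.onWord^[n] r)‖ := by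
    rw [hsplit]
    refine (norm_twistedSum_append_le ..).trans ?_
    rw [add_assoc, add_assoc]
    refine add_le_add_right ?_ _
    rw [twistedSum_append _ _ _ (ζ.onWord^[n] [d]), twistedSum_append _ _ _ (ζ.onWord^[n] v),
      twistedSum_append _ _ _ (ζ.onWord^[n] [d])]
    have hy : twist (ω * wordLength s (ζ.onWord^[n] (d :: v))) =
        twist (ω * wordLength s (ζ.onWord^[n] [d])) *
          twist (ω * wordLength s (ζ.onWord^[n] v)) := by
      rw [iterate_cons, wordLength_append, mul_add, twist_add]
    have hn := norm_one_add_twist_le (ω * wordLength s (ζ.onWord^[n] (d :: v)))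
    rw [← hε, hy] at hn
    generalize twistedSum s ω c (ζ.onWord^[n] [d]) = D at *
    generalize twistedSum s ω c (ζ.onWord^[n] v) = V at *
    generalize twistedSum s ω c (ζ.onWord^[n] r) = Q at *
    have n1 := norm_twist (ω * wordLength s (ζ.onWord^[n] [d]))
    have n2 := norm_twist (ω * wordLength s (ζ.onWord^[n] v))
    generalize twist (ω * wordLength s (ζ.onWord^[n] [d])) = e1 at *
    generalize twist (ω * wordLength s (ζ.onWord^[n] v)) = e2 at *
    have : D + e1 * (V + e2 * (D + e1 * Q)) =
        (1 + e1 * e2) * D + (e1 * V + e1 * e2 * e1 * Q) := by ring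
    rw [this]
    refine (norm_add_le _ _).trans (add_le_add ?_ ((norm_add_le _ _).trans ?_))
    · rw [norm_mul]; gcongr
    · simp [n1, n2]
  have h1 := h.norm_le P
  have h2 := h d
  have h3 := h.norm_le v
  have h4 := h.norm_le r
  have hε0 : 0 ≤ ε := by positivity
  have hε1 : 0 ≤ 2 - 4 * ε := (norm_nonneg _).trans (norm_one_add_twist_le _)
  have hL : ((ζ.onWord^[n + q] [b]).length : ℝ) = (ζ.onWord^[n] P).length +
      2 * (ζ.onWord^[n] [d]).length + (ζ.onWord^[n] v).length + (ζ.onWord^[n] r).length := by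
    rw [hsplit]; simp only [List.length_append]; push_cast; ring
  have hbound : ‖twistedSum s ω c (ζ.onWord^[n + q] [b])‖ ≤
      ρ * ((ζ.onWord^[n + q] [b]).length - 4 * ε * (ζ.onWord^[n] [d]).length) := by
    have := mul_le_mul_of_nonneg_left h2 hε1
    rw [hL]
    linarith
  refine hbound.trans ?_
  rw [mul_assoc ρ]
  refine mul_le_mul_of_nonneg_left ?_ hρ
  -- Replacing 1 - x by e^{-x} lets successive gains multiply into the exponential of a sum.
  have hexp := Real.add_one_le_exp (-(4 / (ζ.maxLength : ℝ) ^ (p + q)) * ε)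
  have h5 : 4 * ε * (((ζ.onWord^[n + q] [b]).length : ℝ) / (ζ.maxLength : ℝ) ^ (p + q)) ≤
      4 * ε * (ζ.onWord^[n] [d]).length := by gcongr
  have h6 : (-(4 / (ζ.maxLength : ℝ) ^ (p + q)) * ε + 1) * ((ζ.onWord^[n + q] [b]).length : ℝ) ≤
      Real.exp (-(4 / (ζ.maxLength : ℝ) ^ (p + q)) * ε) * (ζ.onWord^[n + q] [b]).length := by
    gcongr
  refine le_trans ?_ h6
  have h7 : 4 * ε * (((ζ.onWord^[n + q] [b]).length : ℝ) / (ζ.maxLength : ℝ) ^ (p + q)) =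
      4 / (ζ.maxLength : ℝ) ^ (p + q) * ε * (ζ.onWord^[n + q] [b]).length := by
    field_simp
  linarith

/-- The accumulated gain: after `n + q` steps the bound has improved by the product of the gains
at all levels below `n`, up to the power `1 / q`. -/
theorem BlockBound.exists_of_sum {ρ₀ : ℝ} (hρ₀ : 0 ≤ ρ₀) (h0 : ζ.BlockBound s ω c 0 ρ₀)
    {q : ℕ} (hq : 0 < q) (g : ℕ → ℝ) (hg : ∀ n ρ, 0 ≤ ρ → ζ.BlockBound s ω c n ρ →
      ζ.BlockBound s ω c (n + q) (ρ * Real.exp (-g n))) (n : ℕ) :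
    ζ.BlockBound s ω c (n + q)
      (ρ₀ * Real.exp (-(∑ k ∈ Finset.range n, g k) / q)) := by
  -- A gain jumps q levels, so the levels form q chains, one for each residue mod q. `G i` is the
  -- gain collected by the chain through level n + i; moving the window by one level adds `g n` to
  -- the chain that leaves level n and re-enters at n + q.
  have key : ∀ n, ∃ G : ℕ → ℝ, (∀ i < q, ζ.BlockBound s ω c (n + i) (ρ₀ * Real.exp (-G i))) ∧
      ∑ k ∈ Finset.range n, g k = ∑ i ∈ Finset.range q, G i := by
    intro n
    induction n with
    | zero =>
      refine ⟨0, fun i _ => ?_, by simp⟩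
      simpa using h0.add i
    | succ n ih =>
      obtain ⟨G, hG, hsum⟩ := ih
      obtain ⟨q', rfl⟩ : ∃ q', q = q' + 1 := ⟨q - 1, by omega⟩
      refine ⟨fun i => if i = q' then G 0 + g n else G (i + 1), fun i hi => ?_, ?_⟩
      · by_cases hi' : i = q'
        · subst hi'
          have := hg _ _ (by positivity) (hG 0 (by omega))
          simp only [if_true]
          rw [neg_add, Real.exp_add, ← mul_assoc]
          have e : n + 1 + i = n + 0 + (i + 1) := by ring
          rw [e]
          simpa using this
        · simp only [hi', if_false]
          have := hG (i + 1) (by omega)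
          rwa [show n + 1 + i = n + (i + 1) by ring]
      · rw [Finset.sum_range_succ, hsum, Finset.sum_range_succ', Finset.sum_range_succ]
        rw [if_pos rfl, add_assoc]
        congr 1
        refine Finset.sum_congr rfl fun i hi => ?_
        have : i ≠ q' := by have := Finset.mem_range.1 hi; omega
        simp [this]
  obtain ⟨G, hG, hsum⟩ := key n
  have hq' : (0 : ℝ) < q := by exact_mod_cast hq
  -- Some chain has collected at least the average.
  obtain ⟨i, hi, hle⟩ : ∃ i ∈ Finset.range q, (∑ k ∈ Finset.range n, g k) / q ≤ G i := by
    refine Finset.exists_le_of_sum_le (Finset.nonempty_range_iff.2 hq.ne') ?_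
    rw [← hsum]
    simp only [Finset.sum_const, Finset.card_range, nsmul_eq_mul]
    rw [mul_div_cancel₀ _ hq'.ne']
  have hi := Finset.mem_range.1 hi
  have h1 := (hG i hi).add (q - i)
  rw [show n + i + (q - i) = n + q by omega] at h1
  refine h1.mono ?_
  gcongr
  rw [neg_div]
  linarith

end Substitution

/-! ### The Erdős–Kahane argument on a line -/

/-- Integer sequences with few nonzero terms are few. -/
theorem card_filter_few_nonzero_le (N H J : ℕ) {x : ℝ} (hx0 : 0 < x) (hx1 : x ≤ 1) :
    (((Fintype.piFinset fun _ : Fin N => Finset.Icc (-(H : ℤ)) H).filter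
      fun d => (Finset.univ.filter fun k => d k ≠ 0).card ≤ J).card : ℝ) * x ^ J ≤
      (1 + 2 * H * x) ^ N := by
  classical
  set F := Fintype.piFinset fun _ : Fin N => Finset.Icc (-(H : ℤ)) H
  -- Generating function: give each nonzero entry the weight x. The total weight factorises over the
  -- coordinates, and each counted sequence weighs at least x^J.
  have h1 : (1 + 2 * H * x) ^ N =
      ∑ d ∈ F, ∏ k, (if d k ≠ 0 then x else 1) := by
    rw [← Finset.prod_univ_sum (fun _ : Fin N => Finset.Icc (-(H : ℤ)) H)
      (fun _ j => if j ≠ 0 then x else (1 : ℝ))]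
    rw [Finset.prod_const, Finset.card_univ, Fintype.card_fin]
    congr 1
    have h0 : (0 : ℤ) ∈ Finset.Icc (-(H : ℤ)) H := by simp
    rw [← Finset.add_sum_erase _ _ h0]
    have : ∀ j ∈ (Finset.Icc (-(H : ℤ)) H).erase 0, (if j ≠ 0 then x else (1 : ℝ)) = x :=
      fun j hj => if_pos (Finset.ne_of_mem_erase hj)
    rw [Finset.sum_congr rfl this, Finset.sum_const, Finset.card_erase_of_mem h0, Int.card_Icc,
      nsmul_eq_mul]
    have e : ((H : ℤ) + 1 - -(H : ℤ)).toNat - 1 = 2 * H := by omega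
    rw [e]
    simp
  rw [h1]
  have hnn : ∀ d ∈ F, 0 ≤ ∏ k, (if d k ≠ 0 then x else (1 : ℝ)) := fun d _ =>
    Finset.prod_nonneg fun k _ => by split_ifs <;> positivity
  refine le_trans ?_ (Finset.sum_le_sum_of_subset_of_nonneg (Finset.filter_subset
    (fun d => (Finset.univ.filter fun k => d k ≠ 0).card ≤ J) F) fun d hd _ => hnn d hd)
  rw [← nsmul_eq_mul]
  refine Finset.card_nsmul_le_sum _ _ _ fun d hd => ?_
  have hd := (Finset.mem_filter.1 hd).2
  rw [Finset.prod_ite, Finset.prod_const, Finset.prod_const_one, mul_one]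
  exact pow_le_pow_of_le_one hx0.le hx1 hd

/-- The fibres of `code` cover S, and a subset of ℝ has outer measure at most its diameter. Neither
S nor `code` has to be measurable, so `code` may rest on arbitrary choices. -/
theorem volume_le_card_mul {ι : Type*} (S : Set ℝ) (code : ℝ → ι) (F : Finset ι)
    (hF : ∀ t ∈ S, code t ∈ F) {r : ℝ}
    (hr : ∀ t ∈ S, ∀ t' ∈ S, code t = code t' → |t - t'| ≤ r) :
    volume S ≤ ENNReal.ofReal (F.card * r) := by
  have hsub : S ⊆ ⋃ i ∈ F, {t ∈ S | code t = i} := fun t ht => by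
    simp only [Set.mem_iUnion]
    exact ⟨code t, hF t ht, ht, rfl⟩
  refine (measure_mono hsub).trans ((measure_biUnion_finset_le _ _).trans ?_)
  rw [ENNReal.ofReal_mul (by positivity), ENNReal.ofReal_natCast, ← nsmul_eq_mul]
  refine Finset.sum_le_card_nsmul _ _ _ fun i _ => ?_
  refine (Real.volume_le_diam _).trans (Metric.ediam_le fun t ht t' ht' => ?_)
  rw [edist_dist, Real.dist_eq]
  exact ENNReal.ofReal_le_ofReal (hr t ht.1 t' ht'.1 (ht.2.trans ht'.2.symm))

/-- A sequence satisfies the linear recurrence with characteristic polynomial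
`X^m + ∑_{i<m} p_i X^i`. -/
def SatisfiesRec {R : Type*} [Ring R] (m : ℕ) (p : ℕ → ℤ) (y : ℕ → R) : Prop :=
  ∀ k, y (k + m) + ∑ i ∈ Finset.range m, (p i : R) * y (k + i) = 0

/-- The recurrence is monic, so the first m terms and the defects determine every later term. An
integer sequence may therefore be coded by these data. -/
theorem eq_of_rec_defect_eq {m : ℕ} {p : ℕ → ℤ} {K K' : ℕ → ℤ} {N : ℕ}
    (h0 : ∀ i < m, K i = K' i)
    (hd : ∀ k < N, K (k + m) + ∑ i ∈ Finset.range m, p i * K (k + i) =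
      K' (k + m) + ∑ i ∈ Finset.range m, p i * K' (k + i)) :
    ∀ k < N + m, K k = K' k := by
  intro k
  induction k using Nat.strong_induction_on with
  | _ k ih =>
    intro hk
    rcases lt_or_ge k m with hkm | hkm
    · exact h0 k hkm
    · obtain ⟨j, rfl⟩ := Nat.exists_eq_add_of_le' hkm
      have h1 := hd j (by omega)
      have h2 : ∑ i ∈ Finset.range m, p i * K (j + i) = ∑ i ∈ Finset.range m, p i * K' (j + i) :=
        Finset.sum_congr rfl fun i hi => by
          have := Finset.mem_range.1 hi
          rw [ih (j + i) (by omega) (by omega)]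
      omega

section Defect

variable {m : ℕ} {p : ℕ → ℤ} {y : ℕ → ℝ}

/-- Since y satisfies the recurrence exactly, the defect of the rounded sequence is minus the
recurrence applied to the rounding errors. -/
theorem rec_defect_le (hy : SatisfiesRec m p y) (k : ℕ) :
    |((round (y (k + m)) + ∑ i ∈ Finset.range m, p i * round (y (k + i)) : ℤ) : ℝ)| ≤
      (1 + ∑ i ∈ Finset.range m, |(p i : ℝ)|) * ∑ i ∈ Finset.range (m + 1), distInt (y (k + i)) := by
  have e : ((round (y (k + m)) + ∑ i ∈ Finset.range m, p i * round (y (k + i)) : ℤ) : ℝ) =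
      -((y (k + m) - round (y (k + m))) +
        ∑ i ∈ Finset.range m, (p i : ℝ) * (y (k + i) - round (y (k + i)))) := by
    have h := hy k
    push_cast
    simp only [mul_sub, Finset.sum_sub_distrib]
    linarith
  have hP : ∀ i ∈ Finset.range m, |(p i : ℝ)| ≤ ∑ i ∈ Finset.range m, |(p i : ℝ)| :=
    fun i hi => Finset.single_le_sum (f := fun i => |(p i : ℝ)|) (fun _ _ => abs_nonneg _) hi
  have hP0 : 0 ≤ ∑ i ∈ Finset.range m, |(p i : ℝ)| := Finset.sum_nonneg fun _ _ => abs_nonneg _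
  rw [e, abs_neg, Finset.sum_range_succ, mul_add, add_comm, Finset.mul_sum]
  refine (abs_add_le _ _).trans (add_le_add ((Finset.abs_sum_le_sum_abs _ _).trans ?_) ?_)
  · refine Finset.sum_le_sum fun i hi => ?_
    rw [abs_mul]
    have := hP i hi
    exact mul_le_mul_of_nonneg_right (by linarith) (abs_nonneg _)
  · have : 0 ≤ distInt (y (k + m)) := abs_nonneg _
    change distInt (y (k + m)) ≤ _
    nlinarith

theorem rec_defect_le_natCast (hy : SatisfiesRec m p y) (k : ℕ) {H : ℕ}
    (hH : (1 + ∑ i ∈ Finset.range m, |(p i : ℝ)|) * (m + 1) ≤ H) :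
    |round (y (k + m)) + ∑ i ∈ Finset.range m, p i * round (y (k + i))| ≤ (H : ℤ) := by
  have h := rec_defect_le hy k
  have hP0 : 0 ≤ ∑ i ∈ Finset.range m, |(p i : ℝ)| := Finset.sum_nonneg fun _ _ => abs_nonneg _
  have h1 : ∑ i ∈ Finset.range (m + 1), distInt (y (k + i)) ≤ (m + 1 : ℝ) := by
    refine (Finset.sum_le_card_nsmul _ _ 1 fun i _ => (abs_sub_round _).trans (by norm_num)).trans ?_
    simp
  have h2 := h.trans ((mul_le_mul_of_nonneg_left h1 (by linarith)).trans hH)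
  exact_mod_cast h2

/-- A nonzero defect is an integer, so its modulus is at least 1 and the squared distances in its
window have a sum bounded below. One factor m + 1 comes from Cauchy–Schwarz, the other from the
overlap of windows. -/
theorem card_rec_defect_ne_zero_le (hy : SatisfiesRec m p y) (N : ℕ) :
    (((Finset.univ : Finset (Fin N)).filter fun k : Fin N =>
      round (y (k + m)) + ∑ i ∈ Finset.range m, p i * round (y (k + i)) ≠ 0).card : ℝ) ≤
    ((1 + ∑ i ∈ Finset.range m, |(p i : ℝ)|) ^ 2 * (m + 1) ^ 2) *
      ∑ k ∈ Finset.range (N + m), distInt (y k) ^ 2 := by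
  set P := 1 + ∑ i ∈ Finset.range m, |(p i : ℝ)|
  have hterm : ∀ k : Fin N, round (y (k + m)) + ∑ i ∈ Finset.range m, p i * round (y (k + i)) ≠ 0 →
      1 ≤ P ^ 2 * (m + 1) * ∑ i ∈ Finset.range (m + 1), distInt (y (k + i)) ^ 2 := by
    intro k hk
    have h1 : (1 : ℝ) ≤
        |((round (y (k + m)) + ∑ i ∈ Finset.range m, p i * round (y (k + i)) : ℤ) : ℝ)| := by
      exact_mod_cast Int.one_le_abs hk
    have h2 := h1.trans (rec_defect_le hy k)
    have h3 := sq_sum_le_card_mul_sum_sq (s := Finset.range (m + 1))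
      (f := fun i => distInt (y (k + i)))
    rw [Finset.card_range] at h3
    push_cast at h3
    have h4 : (1 : ℝ) ≤ (P * ∑ i ∈ Finset.range (m + 1), distInt (y (k + i))) ^ 2 := by
      nlinarith
    rw [mul_pow] at h4
    have h5 := mul_le_mul_of_nonneg_left h3 (sq_nonneg P)
    linarith
  have hsum : ∀ i ∈ Finset.range (m + 1), ∑ k : Fin N, distInt (y (k + i)) ^ 2 ≤
      ∑ k ∈ Finset.range (N + m), distInt (y k) ^ 2 := by
    intro i hi
    have hi := Finset.mem_range.1 hi
    rw [Fin.sum_univ_eq_sum_range (fun k => distInt (y (k + i)) ^ 2) N]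
    refine (Finset.sum_map (Finset.range N) (addRightEmbedding i)
      (fun k => distInt (y k) ^ 2)).symm.le.trans ?_
    refine Finset.sum_le_sum_of_subset_of_nonneg (fun k hk => ?_) fun _ _ _ => sq_nonneg _
    simp only [Finset.mem_map, Finset.mem_range, addRightEmbedding_apply] at hk ⊢
    obtain ⟨j, hj, rfl⟩ := hk
    omega
  have hnn : ∀ k : Fin N,
      0 ≤ P ^ 2 * (m + 1) * ∑ i ∈ Finset.range (m + 1), distInt (y (k + i)) ^ 2 :=
    fun k => mul_nonneg (by positivity) (Finset.sum_nonneg fun _ _ => sq_nonneg _)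
  calc _ = ∑ k ∈ (Finset.univ : Finset (Fin N)).filter fun k : Fin N =>
      round (y (k + m)) + ∑ i ∈ Finset.range m, p i * round (y (k + i)) ≠ 0, (1 : ℝ) := by simp
    _ ≤ ∑ k ∈ (Finset.univ : Finset (Fin N)).filter fun k : Fin N =>
      round (y (k + m)) + ∑ i ∈ Finset.range m, p i * round (y (k + i)) ≠ 0,
        P ^ 2 * (m + 1) * ∑ i ∈ Finset.range (m + 1), distInt (y (k + i)) ^ 2 :=
        Finset.sum_le_sum fun k hk => hterm k (Finset.mem_filter.1 hk).2
    _ ≤ ∑ k : Fin N, P ^ 2 * (m + 1) * ∑ i ∈ Finset.range (m + 1), distInt (y (k + i)) ^ 2 :=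
        Finset.sum_le_sum_of_subset_of_nonneg (Finset.filter_subset _ _) fun k _ _ => hnn k
    _ = P ^ 2 * (m + 1) * ∑ i ∈ Finset.range (m + 1), ∑ k : Fin N, distInt (y (k + i)) ^ 2 := by
        rw [← Finset.mul_sum, Finset.sum_comm]
    _ ≤ P ^ 2 * (m + 1) * ∑ i ∈ Finset.range (m + 1),
          ∑ k ∈ Finset.range (N + m), distInt (y k) ^ 2 := by
        gcongr with i hi
        exact hsum i hi
    _ = _ := by
        rw [Finset.sum_const, Finset.card_range, nsmul_eq_mul]
        push_cast
        ring

end Defect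

/-- Two points of a line with the same rounded orbits are close to each other. -/
theorem abs_sub_le_of_round_eq {m N : ℕ} {A B : ℕ → ℝ} {θ α β : Fin 2 → ℂ} {g : Fin 2 → ℕ → ℂ}
    {ρ : ℝ} (hρ : 1 < ρ) (hθ : ∀ j, ρ ≤ ‖θ j‖)
    (hA : ∀ j, ∑ i ∈ Finset.range m, g j i * A (N + i) = θ j ^ N * α j)
    (hB : ∀ j, ∑ i ∈ Finset.range m, g j i * B (N + i) = θ j ^ N * β j)
    {Γ E τ : ℝ} (hΓ : ∀ j, ∑ i ∈ Finset.range m, ‖g j i‖ ≤ Γ) (hE : ∀ j, ‖α j‖ + τ * ‖β j‖ ≤ E)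
    {t t' ω ω' : ℝ} (ht : |t| ≤ τ) (hω0 : ω ≠ 0)
    (hK : ∀ k, N ≤ k → k < N + m → round (ω * (A k + t * B k)) = round (ω' * (A k + t' * B k))) :
    |t - t'| * (|ω'| * ‖α 0 * β 1 - α 1 * β 0‖) ≤ 2 * E * Γ * ρ⁻¹ ^ N := by
  have hρ0 : 0 < ρ := by linarith
  -- These are the coordinates of the two orbits along the roots θ j. Equal rounding near time N
  -- bounds θ_j^N (a_j - a'_j), so dividing by θ_j^N leaves an error of order ρ^{-N}.
  set a : Fin 2 → ℂ := fun j => ω * (α j + t * β j) with ha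
  set a' : Fin 2 → ℂ := fun j => ω' * (α j + t' * β j) with ha'
  have hdiff : ∀ j, ‖a j - a' j‖ ≤ Γ * ρ⁻¹ ^ N := by
    intro j
    have e : θ j ^ N * (a j - a' j) = ∑ i ∈ Finset.range m,
        g j i * ((ω * (A (N + i) + t * B (N + i)) - ω' * (A (N + i) + t' * B (N + i)) : ℝ) : ℂ) := by
      have : θ j ^ N * (a j - a' j) = ω * (θ j ^ N * α j + t * (θ j ^ N * β j)) -
          ω' * (θ j ^ N * α j + t' * (θ j ^ N * β j)) := by simp only [ha, ha']; ring
      rw [this, ← hA, ← hB]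
      simp only [Finset.mul_sum, ← Finset.sum_add_distrib, ← Finset.sum_sub_distrib]
      refine Finset.sum_congr rfl fun i _ => ?_
      push_cast
      ring
    have h1 : ‖θ j ^ N * (a j - a' j)‖ ≤ Γ := by
      rw [e]
      refine (norm_sum_le _ _).trans ((Finset.sum_le_sum fun i hi => ?_).trans (hΓ j))
      have hi := Finset.mem_range.1 hi
      have hr := hK (N + i) (by omega) (by omega)
      rw [norm_mul, Complex.norm_real, Real.norm_eq_abs]
      have h1 := abs_sub_round (ω * (A (N + i) + t * B (N + i)))
      have h2 := abs_sub_round (ω' * (A (N + i) + t' * B (N + i)))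
      rw [← hr] at h2
      have h3 : |ω * (A (N + i) + t * B (N + i)) - ω' * (A (N + i) + t' * B (N + i))| ≤ 1 := by
        rw [abs_le] at *
        constructor <;> linarith [h1.1, h1.2, h2.1, h2.2]
      exact mul_le_of_le_one_right (norm_nonneg _) h3
    rw [norm_mul, norm_pow] at h1
    have h2 : ρ ^ N ≤ ‖θ j‖ ^ N := pow_le_pow_left₀ hρ0.le (hθ j) N
    rw [inv_pow, ← div_eq_mul_inv, le_div_iff₀ (by positivity), mul_comm]
    exact (mul_le_mul_of_nonneg_right h2 (norm_nonneg _)).trans h1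
  have hnorm : ∀ j, ‖a j‖ ≤ |ω| * E := by
    intro j
    simp only [ha]
    rw [norm_mul, Complex.norm_real, Real.norm_eq_abs]
    refine mul_le_mul_of_nonneg_left (le_trans ?_ (hE j)) (abs_nonneg _)
    refine (norm_add_le _ _).trans ?_
    rw [norm_mul, Complex.norm_real, Real.norm_eq_abs]
    gcongr
  -- The determinant of the two coordinate pairs contains the unknown frequencies only through the
  -- factor ωω', so it isolates t' - t. This is where two expanding roots are needed.
  have hdet : a 1 * (a 0 - a' 0) - a 0 * (a 1 - a' 1) =
      ((ω * ω' * (t' - t) : ℝ) : ℂ) * (α 0 * β 1 - α 1 * β 0) := by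
    simp only [ha, ha']
    push_cast
    ring
  have hfin : |ω| * (|t - t'| * (|ω'| * ‖α 0 * β 1 - α 1 * β 0‖)) ≤
      |ω| * (2 * E * Γ * ρ⁻¹ ^ N) := by
    have h1 : ‖((ω * ω' * (t' - t) : ℝ) : ℂ) * (α 0 * β 1 - α 1 * β 0)‖ =
        |ω| * (|t - t'| * (|ω'| * ‖α 0 * β 1 - α 1 * β 0‖)) := by
      rw [norm_mul, Complex.norm_real, Real.norm_eq_abs, abs_mul, abs_mul, abs_sub_comm t' t]
      ring
    rw [← h1, ← hdet]
    refine (norm_sub_le _ _).trans ?_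
    rw [norm_mul (a 1), norm_mul (a 0)]
    have hE0 : 0 ≤ |ω| * E := (norm_nonneg _).trans (hnorm 0)
    have h2 := mul_le_mul (hnorm 1) (hdiff 0) (norm_nonneg _) hE0
    have h3 := mul_le_mul (hnorm 0) (hdiff 1) (norm_nonneg _) hE0
    linarith
  exact le_of_mul_le_mul_left hfin (abs_pos.2 hω0)

/-- The parameters for which the Erdős–Kahane sum of length `n` is small for some frequency. -/
def ekBad (A B : ℕ → ℝ) (ε η τ : ℝ) (n : ℕ) : Set ℝ :=
  {t | |t| ≤ τ ∧ ∃ ω : ℝ, Real.exp (-(ε * n)) ≤ |ω| ∧ |ω| ≤ Real.exp (ε * n) ∧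
    ∑ k ∈ Finset.range n, distInt (ω * (A k + t * B k)) ^ 2 < η * n}

theorem SatisfiesRec.line {m : ℕ} {p : ℕ → ℤ} {A B : ℕ → ℝ} (hA : SatisfiesRec m p A)
    (hB : SatisfiesRec m p B) (ω t : ℝ) :
    SatisfiesRec m p fun k => ω * (A k + t * B k) := by
  intro k
  have h1 := hA k
  have h2 := hB k
  have : ∑ i ∈ Finset.range m, (p i : ℝ) * (ω * (A (k + i) + t * B (k + i))) =
      ω * (∑ i ∈ Finset.range m, (p i : ℝ) * A (k + i)) +
        ω * t * ∑ i ∈ Finset.range m, (p i : ℝ) * B (k + i) := by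
    rw [Finset.mul_sum, Finset.mul_sum, ← Finset.sum_add_distrib]
    exact Finset.sum_congr rfl fun i _ => by ring
  rw [this]
  linear_combination ω * h1 + ω * t * h2

-- Each bad t is coded by the first m roundings of its orbit and by the N recurrence defects, few of
-- which are nonzero. With n = N + m there are at most a constant times e^{(m+2)εn} codes, and two
-- parameters with the same code are within W e^{εn} ρ^{-N}. The choice of ε makes the product
-- O(ρ^{-N/2}).
set_option maxHeartbeats 1000000 in
theorem exists_volume_ekBad_le (m : ℕ) (p : ℕ → ℤ) {ρ : ℝ} (hρ : 1 < ρ) :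
    ∃ ε > 0, ∃ η > 0, ∀ (A B : ℕ → ℝ) (θ α β : Fin 2 → ℂ) (g : Fin 2 → ℕ → ℂ),
      SatisfiesRec m p A → SatisfiesRec m p B → (∀ j, ρ ≤ ‖θ j‖) →
      (∀ j N, ∑ i ∈ Finset.range m, g j i * A (N + i) = θ j ^ N * α j) →
      (∀ j N, ∑ i ∈ Finset.range m, g j i * B (N + i) = θ j ^ N * β j) →
      α 0 * β 1 - α 1 * β 0 ≠ 0 → ∀ τ : ℝ, 0 ≤ τ →
      ∃ C : ℝ, ∀ N : ℕ, volume (ekBad A B ε η τ (N + m)) ≤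
        ENNReal.ofReal (C * Real.exp (-(Real.log ρ / 2)) ^ N) := by
  have hlog : 0 < Real.log ρ := Real.log_pos hρ
  set P : ℝ := 1 + ∑ i ∈ Finset.range m, |(p i : ℝ)| with hP
  have hP1 : 1 ≤ P := by
    have : 0 ≤ ∑ i ∈ Finset.range m, |(p i : ℝ)| := Finset.sum_nonneg fun _ _ => abs_nonneg _
    linarith
  obtain ⟨H, hH⟩ := exists_nat_ge (P * (m + 1))
  have hH0 : (0 : ℝ) < H := lt_of_lt_of_le (by positivity) hH
  set C₁ : ℝ := P ^ 2 * (m + 1) ^ 2 with hC₁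
  have hC₁0 : 0 < C₁ := by positivity
  -- Of the m + 3 factors e^{εn}, m come from the initial roundings, two from the defects and one
  -- from the lower bound for the frequency. Half of log ρ is left for decay.
  set ε : ℝ := Real.log ρ / (2 * (m + 3)) with hε
  have hε0 : 0 < ε := by positivity
  -- The weight x keeps (1 + 2Hx)^N below e^{εn}; η below makes x^{-J} ≤ e^{εn} for J up to C₁ηn.
  -- The 1 in 1 - log x avoids a zero denominator at x = 1.
  set x : ℝ := min 1 (ε / (2 * H)) with hx
  have hx0 : 0 < x := lt_min one_pos (by positivity)
  have hx1 : x ≤ 1 := min_le_left _ _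
  have hHx : 2 * H * x ≤ ε := by
    have : x ≤ ε / (2 * H) := min_le_right _ _
    rw [le_div_iff₀ (by positivity)] at this
    linarith
  have hlx : Real.log x ≤ 0 := Real.log_nonpos hx0.le hx1
  set η : ℝ := ε / (C₁ * (1 - Real.log x)) with hη
  have hη0 : 0 < η := div_pos hε0 (mul_pos hC₁0 (by linarith))
  have hηx : C₁ * η * (-Real.log x) ≤ ε := by
    have h1 : C₁ * η * (1 - Real.log x) = ε := by
      have h2 : (1 - Real.log x) ≠ 0 := by linarith
      rw [hη]; field_simp
    have : 0 < C₁ * η := by positivity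
    nlinarith
  refine ⟨ε, hε0, η, hη0, ?_⟩
  intro A B θ α β g hA hB hθ hgA hgB hD τ hτ
  have hD0 : 0 < ‖α 0 * β 1 - α 1 * β 0‖ := norm_pos_iff.2 hD
  set Γ : ℝ := ∑ j, ∑ i ∈ Finset.range m, ‖g j i‖ with hΓ
  have hΓj : ∀ j, ∑ i ∈ Finset.range m, ‖g j i‖ ≤ Γ := fun j =>
    Finset.single_le_sum (f := fun j => ∑ i ∈ Finset.range m, ‖g j i‖)
      (fun _ _ => Finset.sum_nonneg fun _ _ => norm_nonneg _) (Finset.mem_univ j)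
  set E : ℝ := ∑ j, (‖α j‖ + τ * ‖β j‖) with hE
  have hEj : ∀ j, ‖α j‖ + τ * ‖β j‖ ≤ E := fun j =>
    Finset.single_le_sum (f := fun j => ‖α j‖ + τ * ‖β j‖)
      (fun _ _ => by positivity) (Finset.mem_univ j)
  have hΓ0 : 0 ≤ Γ := (Finset.sum_nonneg fun _ _ => norm_nonneg _).trans (hΓj 0)
  have hE0 : 0 ≤ E := le_trans (by positivity) (hEj 0)
  set E₀ : ℝ := ∑ i ∈ Finset.range m, (|A i| + τ * |B i|) with hE₀
  have hE₀i : ∀ i < m, |A i| + τ * |B i| ≤ E₀ := fun i hi =>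
    Finset.single_le_sum (f := fun i => |A i| + τ * |B i|)
      (fun _ _ => by positivity) (Finset.mem_range.2 hi)
  have hE₀0 : 0 ≤ E₀ := Finset.sum_nonneg fun _ _ => by positivity
  set W : ℝ := 2 * E * Γ / ‖α 0 * β 1 - α 1 * β 0‖ with hW
  have hW0 : 0 ≤ W := by positivity
  refine ⟨(2 * E₀ + 5) ^ m * W * Real.exp (Real.log ρ / 2 * m), fun N => ?_⟩
  set n : ℝ := ((N + m : ℕ) : ℝ) with hn
  have hn0 : 0 ≤ n := Nat.cast_nonneg _
  set e := Real.exp (ε * n) with he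
  have he1 : 1 ≤ e := Real.one_le_exp (by positivity)
  -- A witnessing frequency is fixed for each bad t, in no measurable way; the value 0 off the bad
  -- set is never used.
  have hex : ∀ t, ∃ ω : ℝ, t ∈ ekBad A B ε η τ (N + m) → Real.exp (-(ε * n)) ≤ |ω| ∧ |ω| ≤ e ∧
      ∑ k ∈ Finset.range (N + m), distInt (ω * (A k + t * B k)) ^ 2 < η * n := by
    intro t
    by_cases ht : t ∈ ekBad A B ε η τ (N + m)
    · obtain ⟨ω, hω⟩ := ht.2
      exact ⟨ω, fun _ => hω⟩
    · exact ⟨0, fun h => absurd h ht⟩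
  choose ω hω using hex
  set y : ℝ → ℕ → ℝ := fun t k => ω t * (A k + t * B k) with hy
  have hyrec : ∀ t, SatisfiesRec m p (y t) := fun t => hA.line hB _ _
  set d : ℝ → ℕ → ℤ := fun t k =>
    round (y t (k + m)) + ∑ i ∈ Finset.range m, p i * round (y t (k + i)) with hd
  set Q : ℕ := ⌈e * E₀⌉₊ + 1 with hQ
  set J : ℕ := ⌊C₁ * (η * n)⌋₊ with hJ
  set F₁ := Fintype.piFinset fun _ : Fin m => Finset.Icc (-(Q : ℤ)) Q with hF₁
  set F₂ := (Fintype.piFinset fun _ : Fin N => Finset.Icc (-(H : ℤ)) H).filter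
      fun d => (Finset.univ.filter fun k => d k ≠ 0).card ≤ J with hF₂
  have hvol := volume_le_card_mul (ekBad A B ε η τ (N + m))
    (fun t => ((fun i : Fin m => round (y t i)), fun k : Fin N => d t k)) (F₁ ×ˢ F₂)
    (r := W * e * ρ⁻¹ ^ N) ?_ ?_
  · refine hvol.trans (ENNReal.ofReal_le_ofReal ?_)
    have hc1 : (F₁.card : ℝ) ≤ ((2 * E₀ + 5) * e) ^ m := by
      rw [hF₁, Fintype.card_piFinset, Finset.prod_const, Finset.card_univ, Fintype.card_fin,
        Int.card_Icc]
      push_cast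
      refine pow_le_pow_left₀ (by positivity) ?_ m
      have h1 : (((Q : ℤ) + 1 - -(Q : ℤ)).toNat : ℝ) = 2 * Q + 1 := by
        have : ((Q : ℤ) + 1 - -(Q : ℤ)).toNat = 2 * Q + 1 := by omega
        rw [this]; push_cast; ring
      rw [h1, hQ]
      push_cast
      have h2 := (Nat.ceil_lt_add_one (a := e * E₀) (by positivity)).le
      nlinarith
    have hc2 : (F₂.card : ℝ) ≤ e * e := by
      have h1 := card_filter_few_nonzero_le N H J hx0 hx1
      have h2 : (1 + 2 * H * x) ^ N ≤ e := by
        refine (pow_le_pow_left₀ (by positivity) (b := Real.exp ε) ?_ N).trans ?_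
        · have := Real.add_one_le_exp ε
          linarith
        · rw [← Real.exp_nat_mul, he]
          refine Real.exp_le_exp.2 ?_
          rw [hn]
          push_cast
          nlinarith [(Nat.cast_nonneg m : (0 : ℝ) ≤ m)]
      have h3 : e⁻¹ ≤ x ^ J := by
        rw [he, ← Real.exp_neg, ← Real.exp_log (pow_pos hx0 J), Real.log_pow]
        refine Real.exp_le_exp.2 ?_
        have h4 : (J : ℝ) ≤ C₁ * (η * n) := Nat.floor_le (by positivity)
        have h5 : C₁ * η * (-Real.log x) * n ≤ ε * n := mul_le_mul_of_nonneg_right hηx hn0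
        have h6 : (J : ℝ) * (-Real.log x) ≤ C₁ * (η * n) * (-Real.log x) :=
          mul_le_mul_of_nonneg_right h4 (by linarith)
        linarith
      have h4 : (F₂.card : ℝ) * e⁻¹ ≤ e :=
        (mul_le_mul_of_nonneg_left h3 (Nat.cast_nonneg _)).trans (h1.trans h2)
      rwa [← div_eq_mul_inv, div_le_iff₀ (by linarith)] at h4
    rw [Finset.card_product]
    push_cast
    have hee : e ^ m * (e * e) * e * ρ⁻¹ ^ N =
        Real.exp (Real.log ρ / 2 * m) * Real.exp (-(Real.log ρ / 2)) ^ N := by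
      have h1 : e ^ m * (e * e) * e = e ^ (m + 3) := by ring
      have h2 : ρ⁻¹ = Real.exp (-Real.log ρ) := by
        rw [Real.exp_neg, Real.exp_log (by linarith)]
      rw [h1, h2, he, ← Real.exp_nat_mul, ← Real.exp_nat_mul, ← Real.exp_nat_mul, ← Real.exp_add,
        ← Real.exp_add]
      congr 1
      rw [hε, hn]
      push_cast
      field_simp
      ring
    calc (F₁.card : ℝ) * F₂.card * (W * e * ρ⁻¹ ^ N)
        ≤ ((2 * E₀ + 5) * e) ^ m * (e * e) * (W * e * ρ⁻¹ ^ N) := by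
          have : 0 < ρ := by linarith
          gcongr
      _ = (2 * E₀ + 5) ^ m * W * (e ^ m * (e * e) * e * ρ⁻¹ ^ N) := by
          rw [mul_pow]; ring
      _ = _ := by rw [hee]; ring
  · intro t ht
    obtain ⟨h1, h2, h3⟩ := hω t ht
    rw [Finset.mem_product]
    constructor
    · simp only [hF₁, Fintype.mem_piFinset, Finset.mem_Icc]
      intro i
      rw [← abs_le]
      have h4 : |y t i| ≤ e * E₀ := by
        simp only [hy]
        rw [abs_mul]
        refine mul_le_mul h2 (le_trans ?_ (hE₀i i i.2)) (abs_nonneg _) (zero_le_one.trans he1)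
        refine (abs_add_le _ _).trans ?_
        rw [abs_mul]
        have := mul_le_mul_of_nonneg_right ht.1 (abs_nonneg (B i))
        linarith
      have h5 : |(round (y t i) : ℝ)| ≤ |y t i| + 1 / 2 := by
        have := abs_sub_abs_le_abs_sub (round (y t i) : ℝ) (y t i)
        rw [abs_sub_comm] at this
        linarith [abs_sub_round (y t i)]
      have h6 : |(round (y t i) : ℝ)| ≤ Q := by
        rw [hQ]
        push_cast
        linarith [Nat.le_ceil (e * E₀)]
      exact_mod_cast h6
    · simp only [hF₂, Finset.mem_filter, Fintype.mem_piFinset, Finset.mem_Icc]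
      constructor
      · intro k
        rw [← abs_le]
        exact rec_defect_le_natCast (hyrec t) k hH
      · refine Nat.le_floor ?_
        refine (card_rec_defect_ne_zero_le (hyrec t) N).trans ?_
        exact mul_le_mul_of_nonneg_left h3.le hC₁0.le
  · intro t ht t' ht' hcode
    obtain ⟨hc1, hc2⟩ := Prod.mk.inj hcode
    have hK := eq_of_rec_defect_eq (p := p) (K := fun k => round (y t k))
      (K' := fun k => round (y t' k)) (m := m) (N := N)
      (fun i hi => congrFun hc1 ⟨i, hi⟩) (fun k hk => congrFun hc2 ⟨k, hk⟩)
    have hω1 := (hω t ht).1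
    have hω2 := (hω t' ht').1
    have hω0 : ω t ≠ 0 := abs_pos.1 ((Real.exp_pos _).trans_le hω1)
    have h := abs_sub_le_of_round_eq hρ hθ (fun j => hgA j N) (fun j => hgB j N) hΓj hEj
      ht.1 hω0 (fun k _ hk => hK k hk)
    have h1 : |t - t'| * (Real.exp (-(ε * n)) * ‖α 0 * β 1 - α 1 * β 0‖) ≤
        2 * E * Γ * ρ⁻¹ ^ N := le_trans (by gcongr) h
    rw [Real.exp_neg, ← he] at h1
    have h2 : |t - t'| * (e⁻¹ * ‖α 0 * β 1 - α 1 * β 0‖) =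
        |t - t'| * ‖α 0 * β 1 - α 1 * β 0‖ / e := by field_simp
    rw [h2, div_le_iff₀ (by linarith)] at h1
    have h3 : W * e * ρ⁻¹ ^ N = 2 * E * Γ * ρ⁻¹ ^ N * e / ‖α 0 * β 1 - α 1 * β 0‖ := by
      rw [hW]; ring
    rw [h3, le_div_iff₀ hD0]
    exact h1

/-- The Erdős–Kahane argument: on almost every point of a line, the orbit of every frequency stays
away from the integers in the quadratic mean, with constants that depend only on the recurrence. -/
theorem exists_ae_line_sum_distInt_sq_ge (m : ℕ) (p : ℕ → ℤ) {ρ : ℝ} (hρ : 1 < ρ) :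
    ∃ ε > 0, ∃ η > 0, ∀ (A B : ℕ → ℝ) (θ α β : Fin 2 → ℂ) (g : Fin 2 → ℕ → ℂ),
      SatisfiesRec m p A → SatisfiesRec m p B → (∀ j, ρ ≤ ‖θ j‖) →
      (∀ j N, ∑ i ∈ Finset.range m, g j i * A (N + i) = θ j ^ N * α j) →
      (∀ j N, ∑ i ∈ Finset.range m, g j i * B (N + i) = θ j ^ N * β j) →
      α 0 * β 1 - α 1 * β 0 ≠ 0 →
      ∀ᵐ t : ℝ, ∀ᶠ n : ℕ in Filter.atTop, ∀ ω : ℝ,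
        Real.exp (-(ε * n)) ≤ |ω| → |ω| ≤ Real.exp (ε * n) →
        η * n ≤ ∑ k ∈ Finset.range n, distInt (ω * (A k + t * B k)) ^ 2 := by
  obtain ⟨ε, hε, η, hη, h⟩ := exists_volume_ekBad_le m p hρ
  refine ⟨ε, hε, η, hη, ?_⟩
  intro A B θ α β g hA hB hθ hgA hgB hD
  -- Borel–Cantelli on each bounded piece |t| ≤ τ of the line; countably many τ exhaust it.
  have hτ : ∀ τ : ℕ, ∀ᵐ t : ℝ, ∀ᶠ N : ℕ in Filter.atTop, t ∉ ekBad A B ε η τ (N + m) := by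
    intro τ
    obtain ⟨C, hC⟩ := h A B θ α β g hA hB hθ hgA hgB hD τ (Nat.cast_nonneg _)
    refine ae_eventually_notMem (ne_top_of_le_ne_top ?_ (ENNReal.tsum_le_tsum hC))
    have hq : Real.exp (-(Real.log ρ / 2)) < 1 :=
      Real.exp_zero ▸ Real.exp_lt_exp.2 (by linarith [Real.log_pos hρ])
    exact ((summable_geometric_of_lt_one (Real.exp_pos _).le hq).mul_left C).tsum_ofReal_ne_top
  filter_upwards [ae_all_iff.2 hτ] with t ht
  obtain ⟨τ, hτ'⟩ := exists_nat_ge |t|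
  obtain ⟨N₀, hN₀⟩ := Filter.eventually_atTop.1 (ht τ)
  refine Filter.eventually_atTop.2 ⟨N₀ + m, fun n hn ω h1 h2 => ?_⟩
  obtain ⟨N, rfl⟩ := Nat.exists_eq_add_of_le' (show m ≤ n by omega)
  by_contra hlt
  exact hN₀ N (by omega) ⟨hτ', ω, h1, h2, not_le.1 hlt⟩

/-! ### Cyclic vectors and eigenvectors of an integer matrix -/

section Cyclic

variable {m : ℕ}

/-- A relation among l, Sl, …, S^{m-1}l is a nonzero f of degree below m with f(S)l = 0. By
irreducibility f is coprime to the characteristic polynomial, and Bézout with Cayley–Hamilton gives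
l = 0. So l is a cyclic vector. -/
theorem exists_mulVec_pow_sum_ne_zero {S : Matrix (Fin m) (Fin m) ℤ}
    (hirr : Irreducible (S.map (Int.cast : ℤ → ℚ)).charpoly) {l : Fin m → ℤ} (hl : l ≠ 0) :
    (Matrix.of fun i k : Fin m => (S ^ (k : ℕ)).mulVec l i).det ≠ 0 := by
  classical
  set M : Matrix (Fin m) (Fin m) ℤ := Matrix.of fun i k : Fin m => (S ^ (k : ℕ)).mulVec l i
  set Sq : Matrix (Fin m) (Fin m) ℚ := S.map (Int.cast : ℤ → ℚ) with hSq
  set lq : Fin m → ℚ := fun i => (l i : ℚ) with hlq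
  have hpow : ∀ k : ℕ, (Sq ^ k).mulVec lq = fun i => ((S ^ k).mulVec l i : ℚ) := by
    intro k
    have h1 : Sq ^ k = (S ^ k).map (Int.castRingHom ℚ) := by
      rw [Matrix.map_pow]; rfl
    ext i
    rw [h1]
    simp [Matrix.mulVec, dotProduct, hlq]
  intro hdet
  have hdet' : (M.map (Int.castRingHom ℚ)).det = 0 := by
    have := RingHom.map_det (Int.castRingHom ℚ) M
    rw [hdet, map_zero] at this
    exact this.symm
  obtain ⟨c, hc0, hc⟩ := Matrix.exists_mulVec_eq_zero_iff.2 hdet'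
  set f : Polynomial ℚ := ∑ k : Fin m, Polynomial.C (c k) * Polynomial.X ^ (k : ℕ) with hf
  have hfdeg : f.degree < m := Polynomial.degree_sum_fin_lt c
  have hf0 : f ≠ 0 := by
    intro h0
    refine hc0 (funext fun k => ?_)
    have := congrArg (fun q => Polynomial.coeff q (k : ℕ)) h0
    simp only [hf, Polynomial.finsetSum_coeff, Polynomial.coeff_C_mul, Polynomial.coeff_X_pow,
      Polynomial.coeff_zero] at this
    rw [Finset.sum_eq_single k] at this
    · simpa using this
    · intro b _ hb
      have : (k : ℕ) ≠ b := fun h => hb (Fin.ext h.symm)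
      simp [this]
    · simp
  have hfl : (Polynomial.aeval Sq f).mulVec lq = 0 := by
    rw [hf, map_sum, Matrix.sum_mulVec]
    rw [← hc]
    ext i
    simp only [map_mul, Polynomial.aeval_C, map_pow, Polynomial.aeval_X, Finset.sum_apply]
    simp only [Matrix.mulVec, dotProduct, M]
    refine Finset.sum_congr rfl fun k _ => ?_
    have h2 := congrFun (hpow k) i
    simp only [Matrix.mulVec, dotProduct] at h2
    simp only [Algebra.algebraMap_eq_smul_one, smul_mul_assoc, one_mul, Matrix.smul_apply,
      smul_eq_mul, mul_assoc, ← Finset.mul_sum, h2]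
    simp [mul_comm]
  have hcop : IsCoprime Sq.charpoly f := by
    refine (hirr.coprime_iff_not_dvd).2 fun hdvd => ?_
    have h1 := Polynomial.degree_le_of_dvd hdvd hf0
    rw [Matrix.charpoly_degree_eq_dim, Fintype.card_fin] at h1
    exact absurd hfdeg (not_lt.2 h1)
  obtain ⟨u, v, huv⟩ := hcop
  have h1 := congrArg (Polynomial.aeval Sq) huv
  rw [map_add, map_mul, map_mul, Matrix.aeval_self_charpoly, mul_zero, zero_add, map_one] at h1
  have h2 : lq = 0 := by
    have : ((1 : Matrix (Fin m) (Fin m) ℚ)).mulVec lq = 0 := by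
      rw [← h1, ← Matrix.mulVec_mulVec, hfl, Matrix.mulVec_zero]
    rwa [Matrix.one_mulVec] at this
  refine hl (funext fun i => ?_)
  have := congrFun h2 i
  simpa [hlq] using this

theorem satisfiesRec_mulVec_pow (S : Matrix (Fin m) (Fin m) ℤ) (l : Fin m → ℤ) (s : Fin m → ℝ) :
    SatisfiesRec m (fun i => S.charpoly.coeff i)
      fun k => ∑ i, s i * ((S ^ k).mulVec l i : ℝ) := by
  intro k
  have hCH : S ^ m + ∑ i ∈ Finset.range m, S.charpoly.coeff i • S ^ i = 0 := by
    have h := S.aeval_self_charpoly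
    rw [Polynomial.aeval_eq_sum_range, Matrix.charpoly_natDegree_eq_dim, Fintype.card_fin,
      Finset.sum_range_succ] at h
    have h1 : S.charpoly.coeff m = 1 := by
      have := S.charpoly_monic
      rw [Polynomial.Monic, Polynomial.leadingCoeff, Matrix.charpoly_natDegree_eq_dim,
        Fintype.card_fin] at this
      exact this
    rw [h1, one_smul, add_comm] at h
    exact h
  have hk : (S ^ (k + m)).mulVec l +
      ∑ i ∈ Finset.range m, S.charpoly.coeff i • (S ^ (k + i)).mulVec l = 0 := by
    have h := congrArg (fun M => (S ^ k * M).mulVec l) hCH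
    simp only [mul_add, Finset.mul_sum, Matrix.mul_smul, ← pow_add, mul_zero, Matrix.zero_mulVec,
      Matrix.add_mulVec, Matrix.sum_mulVec, Matrix.smul_mulVec] at h
    exact h
  have hk' : ∀ a, ((S ^ (k + m)).mulVec l a : ℝ) +
      ∑ i ∈ Finset.range m, (S.charpoly.coeff i : ℝ) * ((S ^ (k + i)).mulVec l a : ℝ) = 0 := by
    intro a
    have h := congrFun hk a
    simp only [Pi.add_apply, Finset.sum_apply, Pi.smul_apply, Pi.zero_apply, smul_eq_mul] at h
    exact_mod_cast h
  simp only [Finset.mul_sum]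
  rw [Finset.sum_comm, ← Finset.sum_add_distrib]
  refine Finset.sum_eq_zero fun a _ => ?_
  rw [← mul_zero (s a), ← hk' a, mul_add, Finset.mul_sum]
  congr 1
  exact Finset.sum_congr rfl fun i _ => by ring

/-- For each root `θ` of the characteristic polynomial there is an eigenvector which is a
combination of the first `m` vectors of the orbit of `l`. -/
theorem exists_eigenvector_of_root {S : Matrix (Fin m) (Fin m) ℤ}
    (hirr : Irreducible (S.map (Int.cast : ℤ → ℚ)).charpoly) {l : Fin m → ℤ} (hl : l ≠ 0) {θ : ℂ}
    (hθ : (S.map (Int.cast : ℤ → ℂ)).charpoly.IsRoot θ) :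
    ∃ (g : ℕ → ℂ) (ξ : Fin m → ℂ), ξ ≠ 0 ∧ (S.map (Int.cast : ℤ → ℂ)).mulVec ξ = θ • ξ ∧
      ∀ (N : ℕ) (a : Fin m), ∑ i ∈ Finset.range m, g i * ((S ^ (N + i)).mulVec l a : ℂ) =
        θ ^ N * ξ a := by
  classical
  set Sc : Matrix (Fin m) (Fin m) ℂ := S.map (Int.cast : ℤ → ℂ) with hSc
  set lc : Fin m → ℂ := fun i => (l i : ℂ) with hlc
  have hpow : ∀ k : ℕ, (Sc ^ k).mulVec lc = fun i => ((S ^ k).mulVec l i : ℂ) := by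
    intro k
    have h1 : Sc ^ k = (S ^ k).map (Int.castRingHom ℂ) := by
      rw [Matrix.map_pow]; rfl
    ext i
    rw [h1]
    simp [Matrix.mulVec, dotProduct, hlc]
  -- With G the characteristic polynomial divided by X - θ, the vector G(S)l is annihilated by S -
  -- θ; the coefficients of G serve as `g`.
  obtain ⟨G, hG⟩ := Polynomial.dvd_iff_isRoot.2 hθ
  have hdegp : Sc.charpoly.natDegree = m := by
    rw [Matrix.charpoly_natDegree_eq_dim, Fintype.card_fin]
  have hG0 : G ≠ 0 := by
    rintro rfl
    rw [mul_zero] at hG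
    exact Sc.charpoly_monic.ne_zero hG
  have hdeg : G.natDegree + 1 = m := by
    rw [← hdegp, hG, Polynomial.natDegree_mul (Polynomial.X_sub_C_ne_zero θ) hG0,
      Polynomial.natDegree_X_sub_C, add_comm]
  set ξ : Fin m → ℂ := (Polynomial.aeval Sc G).mulVec lc with hξ
  have hsum : Polynomial.aeval Sc G = ∑ i ∈ Finset.range m, G.coeff i • Sc ^ i := by
    rw [Polynomial.aeval_eq_sum_range, hdeg]
  have hξN : ∀ N a, ∑ i ∈ Finset.range m, G.coeff i * ((S ^ (N + i)).mulVec l a : ℂ) =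
      (Sc ^ N).mulVec ξ a := by
    intro N a
    rw [hξ, hsum, Matrix.mulVec_mulVec, Finset.mul_sum, Matrix.sum_mulVec, Finset.sum_apply]
    refine Finset.sum_congr rfl fun i _ => ?_
    rw [Matrix.mul_smul, ← pow_add, Matrix.smul_mulVec, hpow]
    rfl
  have heig : Sc.mulVec ξ = θ • ξ := by
    have h := Sc.aeval_self_charpoly
    rw [hG, map_mul, map_sub, Polynomial.aeval_X, Polynomial.aeval_C, sub_mul, sub_eq_zero] at h
    rw [hξ, Matrix.mulVec_mulVec, h, ← Algebra.smul_def, Matrix.smul_mulVec]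
  have heigN : ∀ N, (Sc ^ N).mulVec ξ = θ ^ N • ξ := by
    intro N
    induction N with
    | zero => simp
    | succ N ih => rw [pow_succ, ← Matrix.mulVec_mulVec, heig, Matrix.mulVec_smul, ih, smul_smul,
        pow_succ']
  refine ⟨G.coeff, ξ, ?_, heig, fun N a => by rw [hξN, heigN]; rfl⟩
  -- If G(S)l vanished, G would be a nonzero relation of degree m - 1 along the orbit of l, against
  -- cyclicity, which the integer determinant carries over to ℂ.
  intro h0
  have hdet := exists_mulVec_pow_sum_ne_zero hirr hl
  have hdet' : ((Matrix.of fun i k : Fin m => (S ^ (k : ℕ)).mulVec l i).map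
      (Int.castRingHom ℂ)).det ≠ 0 := by
    have := RingHom.map_det (Int.castRingHom ℂ)
      (Matrix.of fun i k : Fin m => (S ^ (k : ℕ)).mulVec l i)
    rw [RingHom.mapMatrix_apply] at this
    rw [← this]
    simpa using hdet
  refine hdet' (Matrix.exists_mulVec_eq_zero_iff.1 ⟨fun k => G.coeff k, ?_, ?_⟩)
  · intro hc
    refine hG0 (Polynomial.leadingCoeff_eq_zero.1 ?_)
    exact congrFun hc ⟨G.natDegree, by omega⟩
  · ext a
    have h1 := hξN 0 a
    rw [pow_zero, Matrix.one_mulVec, h0, ← Fin.sum_univ_eq_sum_range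
      (fun i => G.coeff i * ((S ^ (0 + i)).mulVec l a : ℂ))] at h1
    rw [← h1]
    simp only [Matrix.mulVec, dotProduct, zero_add]
    refine Finset.sum_congr rfl fun k _ => ?_
    simp [mul_comm]

/-- Irreducibility over ℚ makes the roots simple, so the first two entries of the sorted list belong
to different roots, the first modulus being at least the second. The default 0 of `getD` excludes
shorter lists. -/
theorem exists_two_roots {S : Matrix (Fin m) (Fin m) ℤ}
    (hirr : Irreducible (S.map (Int.cast : ℤ → ℚ)).charpoly)
    (hθ : 1 < (((S.map (Int.cast : ℤ → ℂ)).charpoly.roots.map fun z => ‖z‖).sort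
      (· ≥ ·)).getD 1 0) :
    ∃ θ : Fin 2 → ℂ, θ 0 ≠ θ 1 ∧ ∀ j, (S.map (Int.cast : ℤ → ℂ)).charpoly.IsRoot (θ j) ∧
      1 < ‖θ j‖ := by
  set P := (S.map (Int.cast : ℤ → ℂ)).charpoly with hP
  have hnd : P.roots.Nodup := by
    have h1 : P = (S.map (Int.cast : ℤ → ℚ)).charpoly.map (algebraMap ℚ ℂ) := by
      rw [← Matrix.charpoly_map]
      congr 1
    rw [h1]
    exact Polynomial.nodup_roots (hirr.separable.map)
  have hsort := (Multiset.pairwise_sort (P.roots.map fun z => ‖z‖) (· ≥ ·))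
  have hcoe := Multiset.sort_eq (P.roots.map fun z => ‖z‖) (· ≥ ·)
  generalize (P.roots.map fun z => ‖z‖).sort (· ≥ ·) = L at hsort hcoe hθ
  match L with
  | [] => simp at hθ; linarith
  | [_] => simp at hθ; linarith
  | a :: b :: L =>
    simp only [List.getD_cons_succ, List.getD_cons_zero] at hθ
    have hab : b ≤ a := (List.pairwise_cons.1 hsort).1 b (by simp)
    have h1 : P.roots.map (fun z => ‖z‖) = a ::ₘ b ::ₘ (L : Multiset ℝ) := by rw [← hcoe]; rfl
    obtain ⟨z, hz, hza, h2⟩ := (Multiset.map_eq_cons _ _ _ _).2 h1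
    obtain ⟨w, hw, hwb, -⟩ := (Multiset.map_eq_cons _ _ _ _).2 h2
    have hP0 : P ≠ 0 := (Matrix.charpoly_monic _).ne_zero
    refine ⟨![z, w], ?_, ?_⟩
    · intro h
      have h : z = w := h
      subst h
      exact (Multiset.Nodup.notMem_erase hnd) hw
    · intro j
      fin_cases j
      · exact ⟨(Polynomial.mem_roots hP0).1 hz, by simp [hza]; linarith⟩
      · exact ⟨(Polynomial.mem_roots hP0).1 (Multiset.mem_of_mem_erase hw), by simp [hwb]; linarith⟩

end Cyclic

/-! ### Almost every roof vector -/

theorem lipschitzWith_distInt : LipschitzWith 1 distInt := by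
  refine LipschitzWith.of_le_add fun a b => ?_
  have h : distInt a ≤ |a - round b| := round_le a (round b)
  refine h.trans ?_
  rw [Real.dist_eq, add_comm]
  have : a - round b = (a - b) + (b - round b) := by ring
  rw [this]
  exact (abs_add_le _ _).trans (by rw [distInt, add_comm])

theorem continuous_distInt : Continuous distInt := lipschitzWith_distInt.continuous

/-- The frequencies in `[e^{-εn}, e^{εn}]` have Erdős–Kahane sums of size at least `η n`, for all
large `n`. -/
def EKGood (L : ℕ → ℝ) (ε η : ℝ) : Prop :=
  ∀ᶠ n : ℕ in Filter.atTop, ∀ ω : ℝ, Real.exp (-(ε * n)) ≤ |ω| → |ω| ≤ Real.exp (ε * n) →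
    η * n ≤ ∑ k ∈ Finset.range n, distInt (ω * L k) ^ 2

/-- For fixed n the condition is an uncountable intersection over ω, but of closed sets, hence
closed. Measurability is what Fubini along lines requires. -/
theorem measurableSet_ekGood {E : Type*} [TopologicalSpace E] [MeasurableSpace E]
    [OpensMeasurableSpace E] {L : E → ℕ → ℝ} (hL : ∀ k, Continuous fun z => L z k) (ε η : ℝ) :
    MeasurableSet {z | EKGood (L z) ε η} := by
  have h : {z | EKGood (L z) ε η} = ⋃ N : ℕ, ⋂ n : ℕ, ⋂ (_ : N ≤ n), {z | ∀ ω : ℝ,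
      Real.exp (-(ε * n)) ≤ |ω| → |ω| ≤ Real.exp (ε * n) →
      η * n ≤ ∑ k ∈ Finset.range n, distInt (ω * L z k) ^ 2} := by
    ext z
    simp [EKGood, Filter.eventually_atTop]
  rw [h]
  refine MeasurableSet.iUnion fun N => MeasurableSet.iInter fun n => MeasurableSet.iInter fun _ =>
    IsClosed.measurableSet ?_
  simp only [Set.ofPred_forall]
  refine isClosed_iInter fun ω => isClosed_iInter fun _ => isClosed_iInter fun _ => ?_
  refine isClosed_le continuous_const (continuous_finsetSum _ fun k _ => ?_)
  exact (continuous_distInt.comp (continuous_const.mul (hL k))).pow 2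

/-- The parametrization of the hyperplane `∑ s_a = 1` by all coordinates but the first. -/
def hyperplaneParam (n : ℕ) (z : Fin n → ℝ) : Fin (n + 1) → ℝ := Fin.cons (1 - ∑ i, z i) z

theorem hyperplaneParam_add_smul (n : ℕ) (z : Fin n → ℝ) (t : ℝ) {u : Fin (n + 1) → ℝ}
    (hu : ∑ a, u a = 0) :
    hyperplaneParam n (z + t • Fin.tail u) = hyperplaneParam n z + t • u := by
  ext a
  refine Fin.cases ?_ (fun i => ?_) a
  · rw [Fin.sum_univ_succ] at hu
    simp only [hyperplaneParam, Fin.cons_zero, Pi.add_apply, Pi.smul_apply, smul_eq_mul,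
      Finset.sum_add_distrib, ← Finset.mul_sum, Fin.tail]
    linear_combination (-t) * hu
  · simp [hyperplaneParam, Fin.tail]

theorem hyperplaneParam_tail (n : ℕ) {s : Fin (n + 1) → ℝ} (hs : ∑ a, s a = 1) :
    hyperplaneParam n (Fin.tail s) = s := by
  rw [Fin.sum_univ_succ] at hs
  ext a
  refine Fin.cases ?_ (fun i => ?_) a
  · simp only [hyperplaneParam, Fin.cons_zero, Fin.tail]
    linarith
  · simp [hyperplaneParam, Fin.tail]

theorem lipschitzWith_hyperplaneParam (n : ℕ) :
    LipschitzWith (n + 1) (hyperplaneParam n) := by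
  refine LipschitzWith.of_dist_le_mul fun z w => ?_
  have h0 : ∀ i, dist (z i) (w i) ≤ dist z w := fun i => dist_le_pi_dist z w i
  have hn : (0 : ℝ) ≤ n := Nat.cast_nonneg n
  rw [dist_pi_le_iff (by positivity)]
  intro a
  refine Fin.cases ?_ (fun i => ?_) a
  · simp only [hyperplaneParam, Fin.cons_zero]
    rw [Real.dist_eq, show 1 - ∑ i, z i - (1 - ∑ i, w i) = -∑ i, (z i - w i) by
      rw [Finset.sum_sub_distrib]; ring, abs_neg]
    refine (Finset.abs_sum_le_sum_abs _ _).trans ((Finset.sum_le_card_nsmul _ _ _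
      fun i _ => h0 i).trans ?_)
    simp only [Finset.card_univ, Fintype.card_fin, nsmul_eq_mul]
    push_cast
    nlinarith [dist_nonneg (x := z) (y := w)]
  · simp only [hyperplaneParam, Fin.cons_succ]
    push_cast
    nlinarith [h0 i, dist_nonneg (x := z) (y := w)]

/-- A property that holds for almost every point of the parametrized hyperplane holds almost
everywhere on the simplex. -/
theorem ae_roofSimplex_of_ae_param {n : ℕ} {P : (Fin (n + 1) → ℝ) → Prop}
    (h : ∀ᵐ z : Fin n → ℝ, P (hyperplaneParam n z)) :
    ∀ᵐ s ∂(Measure.hausdorffMeasure (((n + 1 : ℕ) : ℝ) - 1) : Measure (Fin (n + 1) → ℝ)),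
      s ∈ roofSimplex (n + 1) → P s := by
  have hn : ((n + 1 : ℕ) : ℝ) - 1 = n := by push_cast; ring
  rw [hn, ae_iff]
  have h0 : Measure.hausdorffMeasure (n : ℝ) {z : Fin n → ℝ | ¬ P (hyperplaneParam n z)} = 0 := by
    have := hausdorffMeasure_pi_real (ι := Fin n)
    rw [Fintype.card_fin] at this
    rw [this]
    exact h
  -- A Lipschitz map sends Hausdorff null sets to null sets, and in the parameter space Hausdorff
  -- measure is Lebesgue measure.
  refine measure_mono_null (t := hyperplaneParam n '' {z | ¬ P (hyperplaneParam n z)}) ?_ ?_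
  · intro s hs
    simp only [Set.mem_ofPred_eq, Classical.not_imp] at hs
    exact ⟨Fin.tail s, by simpa [hyperplaneParam_tail n hs.1.2] using hs.2,
      hyperplaneParam_tail n hs.1.2⟩
  · refine le_antisymm (((lipschitzWith_hyperplaneParam n).hausdorffMeasure_image_le
      (Nat.cast_nonneg n) _).trans ?_) zero_le
    rw [h0, mul_zero]

theorem ae_of_forall_ae_line {n : ℕ} {G : Set (Fin n → ℝ)} (hG : MeasurableSet G) (u : Fin n → ℝ)
    (h : ∀ y : Fin n → ℝ, ∀ᵐ t : ℝ, y + t • u ∈ G) : ∀ᵐ y : Fin n → ℝ, y ∈ G :=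
  ae_mem_of_ae_add_linearMap_mem (LinearMap.toSpanSingleton ℝ (Fin n → ℝ) u) volume volume hG
    fun y => by simpa using h y

theorem sum_ofReal_single_sub_single_mul {m : ℕ} (a b : Fin m) (δ : Fin m → ℂ) :
    ∑ i, (((Pi.single a 1 - Pi.single b 1 : Fin m → ℝ) i : ℝ) : ℂ) * δ i = δ a - δ b := by
  have h : ∀ c i : Fin m, (((Pi.single c 1 : Fin m → ℝ) i : ℝ) : ℂ) = if i = c then 1 else 0 := by
    intro c i
    rw [Pi.single_apply]
    split_ifs <;> simp
  simp [sub_mul, Finset.sum_sub_distrib, h]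

/-- This provides a direction u tangent to the simplex for which the determinant in the line
argument, a linear form in the base point, is not identically zero. If all such u annihilated both
eigenvectors, these would be constant vectors and both eigenvalues would equal a row sum of S.
Otherwise independence of eigenvectors for distinct eigenvalues applies. -/
theorem exists_direction {m : ℕ} {S : Matrix (Fin m) (Fin m) ℂ} {θ : Fin 2 → ℂ}
    (hne : θ 0 ≠ θ 1) {ξ : Fin 2 → Fin m → ℂ} (h0 : ∀ j, ξ j ≠ 0)
    (heig : ∀ j, S.mulVec (ξ j) = θ j • ξ j) :
    ∃ (u : Fin m → ℝ) (a : Fin m), ∑ i, u i = 0 ∧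
      ξ 0 a * (∑ i, u i * ξ 1 i) - ξ 1 a * (∑ i, u i * ξ 0 i) ≠ 0 := by
  classical
  have hu : ∃ u : Fin m → ℝ, ∑ i, u i = 0 ∧ ∃ j, ∑ i, (u i : ℂ) * ξ j i ≠ 0 := by
    by_contra hcon
    push Not at hcon
    have hconst : ∀ j a b, ξ j a = ξ j b := by
      intro j a b
      have h := hcon (Pi.single a 1 - Pi.single b 1) (by simp) j
      rw [sum_ofReal_single_sub_single_mul] at h
      exact sub_eq_zero.1 h
    obtain ⟨a, ha⟩ := Function.ne_iff.1 (h0 0)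
    have hrow : ∀ j, ∑ i, S a i = θ j := by
      intro j
      obtain ⟨b, hb⟩ := Function.ne_iff.1 (h0 j)
      rw [hconst j b a] at hb
      have h := congrFun (heig j) a
      simp only [Matrix.mulVec, dotProduct, Pi.smul_apply, smul_eq_mul] at h
      rw [Finset.sum_congr rfl fun i _ => by rw [hconst j i a], ← Finset.sum_mul] at h
      exact mul_right_cancel₀ hb h
    exact hne ((hrow 0).symm.trans (hrow 1))
  obtain ⟨u, hu0, j, hj⟩ := hu
  set β : Fin 2 → ℂ := fun j => ∑ i, (u i : ℂ) * ξ j i with hβ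
  by_contra hcon
  push Not at hcon
  have hprop : β 1 • ξ 0 = β 0 • ξ 1 := by
    ext a
    have := hcon u a hu0
    simp only [Pi.smul_apply, smul_eq_mul]
    linear_combination this
  have h1 := congrArg S.mulVec hprop
  rw [Matrix.mulVec_smul, Matrix.mulVec_smul, heig, heig, smul_comm (β 1), smul_comm (β 0),
    ← hprop, smul_smul, smul_smul, ← sub_eq_zero, ← sub_smul, smul_eq_zero] at h1
  have hβ1 : β 1 = 0 := by
    rcases h1 with h1 | h1
    · rw [← sub_mul] at h1
      exact (mul_eq_zero.1 h1).resolve_left (sub_ne_zero.2 hne)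
    · exact absurd h1 (h0 0)
  rw [hβ1, zero_smul] at hprop
  have hβ0 : β 0 = 0 := (smul_eq_zero.1 hprop.symm).resolve_right (h0 1)
  fin_cases j
  · exact hj hβ0
  · exact hj hβ1

/-- If all δ a agree, the form equals that nonzero constant on the hyperplane. If δ a ≠ δ b, it is
affine and nonconstant along e_a - e_b and vanishes at most once on each such line. -/
theorem ae_affine_ne_zero {n : ℕ} (δ : Fin (n + 1) → ℂ) (hδ : δ ≠ 0) :
    ∀ᵐ z : Fin n → ℝ, ∑ a, (hyperplaneParam n z a : ℂ) * δ a ≠ 0 := by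
  classical
  have hcont : Continuous fun z : Fin n → ℝ => ∑ a, (hyperplaneParam n z a : ℂ) * δ a := by
    refine continuous_finsetSum _ fun a _ => ?_
    have := (continuous_apply a).comp (lipschitzWith_hyperplaneParam n).continuous
    exact (Complex.continuous_ofReal.comp this).mul continuous_const
  have hmeas : MeasurableSet {z : Fin n → ℝ | ∑ a, (hyperplaneParam n z a : ℂ) * δ a ≠ 0} :=
    (isOpen_ne_fun hcont continuous_const).measurableSet
  by_cases hconst : ∀ a b, δ a = δ b
  · refine Filter.Eventually.of_forall fun z => ?_
    obtain ⟨a, ha⟩ := Function.ne_iff.1 hδ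
    rw [Finset.sum_congr rfl fun b _ => by rw [hconst b a], ← Finset.sum_mul]
    have : ∑ b, (hyperplaneParam n z b : ℂ) = 1 := by
      rw [Fin.sum_univ_succ]
      simp [hyperplaneParam]
    rw [this, one_mul]
    exact ha
  · push Not at hconst
    obtain ⟨a, b, hab⟩ := hconst
    set u : Fin (n + 1) → ℝ := Pi.single a 1 - Pi.single b 1 with hu
    have hu0 : ∑ i, u i = 0 := by simp [hu]
    have hud : ∑ i, (u i : ℂ) * δ i ≠ 0 := by
      rw [hu, sum_ofReal_single_sub_single_mul]
      exact sub_ne_zero.2 hab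
    refine ae_of_forall_ae_line hmeas (Fin.tail u) fun y => ?_
    refine (Set.Subsingleton.measure_zero (s := {t : ℝ | ¬ (y + t • Fin.tail u ∈
      {z : Fin n → ℝ | ∑ a, (hyperplaneParam n z a : ℂ) * δ a ≠ 0})}) ?_ volume)
    intro t ht t' ht'
    simp only [Set.mem_ofPred_eq, not_not, hyperplaneParam_add_smul n y _ hu0, Pi.add_apply,
      Pi.smul_apply, smul_eq_mul, Complex.ofReal_add, Complex.ofReal_mul, add_mul, mul_assoc,
      Finset.sum_add_distrib, ← Finset.mul_sum] at ht ht'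
    have : ((t : ℂ) - t') * ∑ i, (u i : ℂ) * δ i = 0 := by linear_combination ht - ht'
    have := (mul_eq_zero.1 this).resolve_right hud
    exact_mod_cast sub_eq_zero.1 this

/-- The form δ, which gives the determinant of the line argument, annihilates u and so is constant
along lines of direction u. Each line either lies in the zero set of δ, which is null, or satisfies
the hypotheses of the line theorem. The numbers ε and η come from the recurrence and ρ alone. -/
theorem ae_roofSimplex_ekGood {m : ℕ} {S : Matrix (Fin m) (Fin m) ℤ}
    (hirr : Irreducible (S.map (Int.cast : ℤ → ℚ)).charpoly) {l : Fin m → ℤ} (hl : l ≠ 0)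
    (hθ : 1 < (((S.map (Int.cast : ℤ → ℂ)).charpoly.roots.map fun z => ‖z‖).sort
      (· ≥ ·)).getD 1 0) :
    ∃ ε > 0, ∃ η > 0,
      ∀ᵐ s ∂(Measure.hausdorffMeasure ((m : ℝ) - 1) : Measure (Fin m → ℝ)),
        s ∈ roofSimplex m → EKGood (fun k => ∑ i, s i * ((S ^ k).mulVec l i : ℝ)) ε η := by
  obtain ⟨θ, hne, hroot⟩ := exists_two_roots hirr hθ
  choose g ξ hξ0 heig hg using fun j => exists_eigenvector_of_root hirr hl (hroot j).1
  obtain ⟨n, rfl⟩ : ∃ n, m = n + 1 := by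
    obtain ⟨a, -⟩ := Function.ne_iff.1 hl
    exact ⟨m - 1, by have := a.2; omega⟩
  set ρ := min ‖θ 0‖ ‖θ 1‖ with hρ
  have hρ1 : 1 < ρ := lt_min (hroot 0).2 (hroot 1).2
  have hρθ : ∀ j, ρ ≤ ‖θ j‖ := by
    intro j
    fin_cases j
    · exact min_le_left _ _
    · exact min_le_right _ _
  obtain ⟨ε, hε, η, hη, hline⟩ :=
    exists_ae_line_sum_distInt_sq_ge (n + 1) (fun i => S.charpoly.coeff i) hρ1
  refine ⟨ε, hε, η, hη, ?_⟩
  obtain ⟨u, a, hu0, hua⟩ := exists_direction hne hξ0 heig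
  set L : (Fin (n + 1) → ℝ) → ℕ → ℝ := fun s k => ∑ i, s i * ((S ^ k).mulVec l i : ℝ) with hL
  set δ : Fin (n + 1) → ℂ := fun a => ξ 0 a * (∑ i, u i * ξ 1 i) - ξ 1 a * (∑ i, u i * ξ 0 i)
    with hδ
  have hδ0 : δ ≠ 0 := fun h => hua (congrFun h a)
  have hgL : ∀ (s : Fin (n + 1) → ℝ) j N,
      ∑ i ∈ Finset.range (n + 1), g j i * L s (N + i) = θ j ^ N * ∑ b, s b * ξ j b := by
    intro s j N
    simp only [hL, Complex.ofReal_sum, Finset.mul_sum]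
    rw [Finset.sum_comm]
    refine Finset.sum_congr rfl fun b _ => ?_
    have h := hg j N b
    calc _ = (s b : ℂ) * ∑ i ∈ Finset.range (n + 1), g j i * ((S ^ (N + i)).mulVec l b : ℂ) := by
          rw [Finset.mul_sum]
          refine Finset.sum_congr rfl fun i _ => ?_
          push_cast
          ring
      _ = _ := by rw [h]; ring
  have hae : ∀ᵐ z : Fin n → ℝ, z ∈ {z : Fin n → ℝ | EKGood (L (hyperplaneParam n z)) ε η} ∪
      {z : Fin n → ℝ | ∑ a, (hyperplaneParam n z a : ℂ) * δ a = 0} := by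
    have hcont : ∀ a, Continuous fun z : Fin n → ℝ => hyperplaneParam n z a := fun a =>
      (continuous_apply a).comp (lipschitzWith_hyperplaneParam n).continuous
    refine ae_of_forall_ae_line (MeasurableSet.union (measurableSet_ekGood (fun k => ?_) _ _)
      (IsClosed.measurableSet (isClosed_eq ?_ continuous_const))) (Fin.tail u) fun y => ?_
    · exact continuous_finsetSum _ fun a _ => (hcont a).mul continuous_const
    · exact continuous_finsetSum _ fun a _ =>
        (Complex.continuous_ofReal.comp (hcont a)).mul continuous_const
    · by_cases hy : ∑ a, (hyperplaneParam n y a : ℂ) * δ a = 0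
      · refine Filter.Eventually.of_forall fun t => Or.inr ?_
        have hu1 : ∑ a, (u a : ℂ) * δ a = 0 := by
          have : ∑ a, (u a : ℂ) * δ a = (∑ a, (u a : ℂ) * ξ 0 a) * (∑ i, u i * ξ 1 i) -
              (∑ a, (u a : ℂ) * ξ 1 a) * (∑ i, u i * ξ 0 i) := by
            rw [Finset.sum_mul, Finset.sum_mul, ← Finset.sum_sub_distrib]
            exact Finset.sum_congr rfl fun a _ => by simp only [hδ]; ring
          rw [this]; ring
        simp only [Set.mem_ofPred_eq, hyperplaneParam_add_smul n y _ hu0, Pi.add_apply,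
          Pi.smul_apply, smul_eq_mul, Complex.ofReal_add, Complex.ofReal_mul, add_mul, mul_assoc,
          Finset.sum_add_distrib, ← Finset.mul_sum, hy, hu1, mul_zero, add_zero]
      · have h := hline (L (hyperplaneParam n y)) (L u) θ
          (fun j => ∑ b, (hyperplaneParam n y b : ℂ) * ξ j b) (fun j => ∑ b, (u b : ℂ) * ξ j b) g
          (satisfiesRec_mulVec_pow S l _) (satisfiesRec_mulVec_pow S l u) hρθ
          (hgL _) (hgL u) ?_
        · filter_upwards [h] with t ht
          refine Or.inl ?_
          have e : ∀ k, L (hyperplaneParam n (y + t • Fin.tail u)) k =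
              L (hyperplaneParam n y) k + t * L u k := by
            intro k
            simp only [hL, hyperplaneParam_add_smul n y _ hu0, Pi.add_apply, Pi.smul_apply,
              smul_eq_mul, add_mul, Finset.sum_add_distrib, Finset.mul_sum, mul_assoc]
          simp only [Set.mem_ofPred_eq, EKGood, e]
          exact ht
        · convert hy using 1
          simp only [hδ, Finset.sum_mul, mul_sub, Finset.sum_sub_distrib]
          congr 1 <;> exact Finset.sum_congr rfl fun b _ => by ring
  refine ae_roofSimplex_of_ae_param (P := fun s => EKGood (L s) ε η) ?_
  filter_upwards [hae, ae_affine_ne_zero δ hδ0] with z h1 h2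
  exact h1.resolve_right h2

namespace Substitution

variable {m : ℕ} {ζ : Substitution m} {s : Fin m → ℝ}

/-! ### Small frequencies and functions of mean zero -/

theorem twistedSum_zero_sub_const (s : Fin m → ℝ) (M : Fin m → ℂ) (z : ℂ) (w : List (Fin m)) :
    twistedSum s 0 (fun a => M a - z) w = twistedSum s 0 M w - z * w.length := by
  induction w with
  | nil => simp [twistedSum]
  | cons a w ih =>
    rw [twistedSum, twistedSum, ih, zero_mul, twist_zero]
    push_cast [List.length_cons]
    ring

/-- Averages over blocks contract to a common value. -/
theorem BlockBound.contract {M : Fin m → ℂ} {z : ℂ} {k : ℕ} {r : ℝ}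
    (h : ζ.BlockBound s 0 (fun a => M a - z) k r) {p : ℕ} (hp : ∀ a b, a ∈ ζ.onWord^[p] [b]) :
    ∃ z', ζ.BlockBound s 0 (fun a => M a - z') (k + p)
      ((1 - 1 / (ζ.maxLength : ℝ) ^ (p + p)) * r) := by
  rcases isEmpty_or_nonempty (Fin m) with hm | ⟨⟨d⟩⟩
  · exact ⟨0, fun b => hm.elim b⟩
  set δ : ℝ := 1 / (ζ.maxLength : ℝ) ^ (p + p) with hδ
  have hA : (0 : ℝ) < ζ.maxLength := by
    have := ζ.two_le_maxLength
    exact_mod_cast (by omega : 0 < ζ.maxLength)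
  have hδ0 : 0 ≤ δ := by positivity
  have hℓ : (0 : ℝ) < (ζ.onWord^[k] [d]).length := by
    exact_mod_cast ζ.length_iterate_singleton_pos k d
  set y : ℂ := twistedSum s 0 (fun a => M a - z) (ζ.onWord^[k] [d]) /
    (ζ.onWord^[k] [d]).length with hy
  have hyd : twistedSum s 0 (fun a => M a - z) (ζ.onWord^[k] [d]) =
      y * (ζ.onWord^[k] [d]).length := by
    have : ((ζ.onWord^[k] [d]).length : ℂ) ≠ 0 := by exact_mod_cast hℓ.ne'
    rw [hy]; field_simp
  have hyr : ‖y‖ ≤ r := by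
    rw [hy, norm_div, Complex.norm_natCast, div_le_iff₀ hℓ]
    exact h d
  -- Each block of level k + p contains a copy of ζ^k(d), a proportion at least δ of it, and y is
  -- the average there. Subtracting δy cancels that share in all blocks at once, which shrinks the
  -- deviation by 1 - δ.
  refine ⟨z + δ * y, fun b => ?_⟩
  obtain ⟨P, R, e⟩ := List.append_of_mem (hp d b)
  have hsplit : ζ.onWord^[k + p] [b] = ζ.onWord^[k] P ++ (ζ.onWord^[k] [d] ++ ζ.onWord^[k] R) := by
    rw [Function.iterate_add_apply, e, iterate_append, iterate_cons _ _ d R]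
  have hlen : δ * (ζ.onWord^[k + p] [b]).length ≤ (ζ.onWord^[k] [d]).length := by
    rw [hδ, one_div_mul_eq_div, div_le_iff₀ (by positivity), mul_comm]
    exact_mod_cast length_iterate_add_le_of_mem hp k p b d
  have hL : ((ζ.onWord^[k + p] [b]).length : ℝ) = (ζ.onWord^[k] P).length +
      (ζ.onWord^[k] [d]).length + (ζ.onWord^[k] R).length := by
    rw [hsplit]; simp only [List.length_append]; push_cast; ring
  have hfun : (fun a => M a - (z + δ * y)) = fun a => (fun a => M a - z) a - δ * y := by
    ext a; ring
  have hT : twistedSum s 0 (fun a => M a - (z + δ * y)) (ζ.onWord^[k + p] [b]) =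
      twistedSum s 0 (fun a => M a - z) (ζ.onWord^[k] P) +
      twistedSum s 0 (fun a => M a - z) (ζ.onWord^[k] R) +
      y * (((ζ.onWord^[k] [d]).length - δ * (ζ.onWord^[k + p] [b]).length : ℝ) : ℂ) := by
    rw [hfun, twistedSum_zero_sub_const, hsplit, twistedSum_append, twistedSum_append, hyd]
    simp only [zero_mul, twist_zero, one_mul]
    push_cast
    ring
  rw [hT]
  have h1 := h.norm_le P
  have h2 := h.norm_le R
  have h3 : ‖y * (((ζ.onWord^[k] [d]).length - δ * (ζ.onWord^[k + p] [b]).length : ℝ) : ℂ)‖ ≤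
      r * ((ζ.onWord^[k] [d]).length - δ * (ζ.onWord^[k + p] [b]).length) := by
    rw [norm_mul, Complex.norm_real, Real.norm_eq_abs, abs_of_nonneg (by linarith)]
    exact mul_le_mul_of_nonneg_right hyr (by linarith)
  refine (norm_add₃_le).trans ?_
  have : (1 - δ) * r * (ζ.onWord^[k + p] [b]).length =
      r * (ζ.onWord^[k + p] [b]).length - r * (δ * (ζ.onWord^[k + p] [b]).length) := by ring
  rw [this]
  nth_rewrite 2 [hL]
  linarith

theorem exists_blockBound_sub_const {M : Fin m → ℂ} {B : ℝ} (hB : ∀ a, ‖M a‖ ≤ B)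
    {p : ℕ} (hp : ∀ a b, a ∈ ζ.onWord^[p] [b]) (j : ℕ) :
    ∃ z, ζ.BlockBound s 0 (fun a => M a - z) (p * j)
      ((1 - 1 / (ζ.maxLength : ℝ) ^ (p + p)) ^ j * B) := by
  induction j with
  | zero =>
    refine ⟨0, fun b => ?_⟩
    simpa using norm_twistedSum_le s 0 hB [b]
  | succ j ih =>
    obtain ⟨z, hz⟩ := ih
    obtain ⟨z', hz'⟩ := hz.contract hp
    refine ⟨z', ?_⟩
    rw [mul_add, mul_one, pow_succ']
    rwa [← mul_assoc] at hz'

theorem block_eq_cons (x : ℤ → Fin m) (i : ℤ) (N : ℕ) :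
    block x i (N + 1) = x i :: block x (i + 1) N := by
  have := block_add x i 1 N
  rw [add_comm] at this
  rw [this]
  simp [block]

theorem length_block (x : ℤ → Fin m) (i : ℤ) (N : ℕ) : (block x i N).length = N := by
  simp [block]

theorem twistedSum_zero_block (s : Fin m → ℝ) (M : Fin m → ℂ) (x : ℤ → Fin m) (i : ℤ) (N : ℕ) :
    twistedSum s 0 M (block x i N) = ∑ k ∈ Finset.range N, M (x (i + k)) := by
  induction N generalizing i with
  | zero => simp [block, twistedSum]
  | succ N ih =>
    rw [block_eq_cons, twistedSum, ih, zero_mul, twist_zero, one_mul, Finset.sum_range_succ',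
      add_comm]
    simp [add_left_comm, add_comm]

theorem exists_block_infix (x : ζ.Space) (N : ℕ) :
    ∃ K a, block x.1 0 N <:+: ζ.onWord^[K] [a] := by
  obtain ⟨K, a, h⟩ := x.2 N
  exact ⟨K, a, (block_infix x.1 0 (-(N : ℤ)) N (2 * N + 1) (by omega) (by push_cast; omega)).trans h⟩

theorem measurable_letter (i : ℤ) : Measurable fun x : ζ.Space => x.1 i :=
  (measurable_pi_apply i).comp measurable_subtype_coe

theorem integral_letter_eq {μ : Measure ζ.Space} (hμ : MeasurePreserving (ζ.shift 1) μ μ)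
    (M : Fin m → ℂ) (k : ℕ) : ∫ x : ζ.Space, M (x.1 k) ∂μ = ∫ x : ζ.Space, M (x.1 0) ∂μ := by
  have hmeas : Measurable M := measurable_of_finite M
  induction k with
  | zero => rfl
  | succ k ih =>
    rw [← ih]
    have h := integral_map (μ := μ) (f := fun x : ζ.Space => M (x.1 k)) hμ.measurable.aemeasurable
      (hmeas.comp (measurable_letter _)).aestronglyMeasurable
    rw [hμ.map_eq] at h
    rw [h]
    rfl

/-- If `M(x_0)` has mean zero for an invariant measure, then its averages over long blocks are
small. -/
theorem blockBound_of_integral_eq_zero {μ : Measure ζ.Space} [IsProbabilityMeasure μ]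
    (hμ : MeasurePreserving (ζ.shift 1) μ μ) {M : Fin m → ℂ} {B : ℝ} (hB0 : 0 ≤ B)
    (hB : ∀ a, ‖M a‖ ≤ B) (hM : ∫ x : ζ.Space, M (x.1 0) ∂μ = 0)
    {p : ℕ} (hp : ∀ a b, a ∈ ζ.onWord^[p] [b]) (j : ℕ) :
    ζ.BlockBound s 0 M (p * j) (2 * B * (1 - 1 / (ζ.maxLength : ℝ) ^ (p + p)) ^ j) := by
  obtain ⟨z, hz⟩ := exists_blockBound_sub_const (s := s) hB hp j
  have hA : (1 : ℝ) ≤ ζ.maxLength := by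
    have := ζ.two_le_maxLength
    exact_mod_cast (by omega : 1 ≤ ζ.maxLength)
  have hδ : 0 ≤ 1 - 1 / (ζ.maxLength : ℝ) ^ (p + p) := by
    rw [sub_nonneg]
    exact div_le_one_of_le₀ (one_le_pow₀ hA) (by positivity)
  set r : ℝ := (1 - 1 / (ζ.maxLength : ℝ) ^ (p + p)) ^ j * B with hr
  have hr0 : 0 ≤ r := by positivity
  set D : ℝ := 2 * (B + ‖z‖) * (ζ.maxLength : ℝ) ^ (p * j) with hD
  -- Integrating the sum of M - z over the first N letters leaves -Nz, because M has mean zero,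
  -- while the integrand is at most rN + D. Letting N grow gives ‖z‖ ≤ r, so z may be dropped at the
  -- price of a factor 2.
  have hz1 : ∀ N : ℕ, N * ‖z‖ ≤ r * N + D := by
    intro N
    have hint : ∀ k : ℕ, Integrable (fun x : ζ.Space => M (x.1 k)) μ := fun k =>
      Integrable.of_bound ((measurable_of_finite M).comp (measurable_letter _)).aestronglyMeasurable
        B (Filter.Eventually.of_forall fun x => hB _)
    have h1 : ∫ x : ζ.Space, twistedSum s 0 (fun a => M a - z) (block x.1 0 N) ∂μ = -(N * z) := by
      have h2 : ∀ x : ζ.Space, twistedSum s 0 (fun a => M a - z) (block x.1 0 N) =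
          (∑ k ∈ Finset.range N, M (x.1 k)) - z * N := by
        intro x
        rw [twistedSum_zero_sub_const, twistedSum_zero_block, length_block]
        simp
      simp only [h2]
      rw [integral_sub (integrable_finsetSum _ fun k _ => hint k) (integrable_const _),
        integral_finsetSum _ fun k _ => hint k]
      simp only [integral_letter_eq hμ, hM]
      simp [mul_comm]
    have h3 : ‖∫ x : ζ.Space, twistedSum s 0 (fun a => M a - z) (block x.1 0 N) ∂μ‖ ≤ r * N + D := by
      refine (norm_integral_le_of_norm_le_const (C := r * N + D)
        (Filter.Eventually.of_forall fun x => ?_)).trans (by simp)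
      obtain ⟨K, a, hK⟩ := exists_block_infix x N
      have := hz.norm_le_of_infix hr0 (B := B + ‖z‖) (by positivity)
        (fun a => (norm_sub_le _ _).trans (by gcongr; exact hB a)) hK
      rwa [length_block] at this
    rw [h1, norm_neg, norm_mul, Complex.norm_natCast] at h3
    exact h3
  have hzr : ‖z‖ ≤ r := by
    by_contra hlt
    push Not at hlt
    obtain ⟨N, hN⟩ := exists_nat_gt (D / (‖z‖ - r))
    rw [div_lt_iff₀ (by linarith)] at hN
    have := hz1 N
    linarith
  intro b
  have h1 := hz b
  rw [twistedSum_zero_sub_const] at h1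
  have h2 : ‖z * ((ζ.onWord^[p * j] [b]).length : ℂ)‖ ≤ r * (ζ.onWord^[p * j] [b]).length := by
    rw [norm_mul, Complex.norm_natCast]
    gcongr
  have h3 := norm_sub_norm_le (twistedSum s 0 M (ζ.onWord^[p * j] [b]))
    (z * ((ζ.onWord^[p * j] [b]).length : ℂ))
  have h4 : 2 * B * (1 - 1 / (ζ.maxLength : ℝ) ^ (p + p)) ^ j = 2 * r := by rw [hr]; ring
  rw [h4]
  linarith

/-- Removing the phases one tile at a time costs 2π|ω| times the remaining sum at each step. The
error is quadratic in the length, hence useful only for very small ω. -/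
theorem norm_twistedSum_sub_le (hs : ∀ a, |s a| ≤ 1) {ω : ℝ} {c M : Fin m → ℂ} {B κ : ℝ}
    (hB0 : 0 ≤ B) (hB : ∀ a, ‖c a‖ ≤ B) (hκ : ∀ a, ‖c a - M a‖ ≤ κ) (w : List (Fin m)) :
    ‖twistedSum s ω c w - twistedSum s 0 M w‖ ≤
      w.length * (κ + 2 * Real.pi * |ω| * B * w.length) := by
  induction w with
  | nil => simp [twistedSum]
  | cons a w ih =>
    have hpi := Real.pi_pos
    have e : twistedSum s ω c (a :: w) - twistedSum s 0 M (a :: w) = (c a - M a) +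
        (twist (ω * s a) - 1) * twistedSum s ω c w +
        (twistedSum s ω c w - twistedSum s 0 M w) := by
      rw [twistedSum, twistedSum, zero_mul, twist_zero]
      ring
    have h1 : ‖(twist (ω * s a) - 1) * twistedSum s ω c w‖ ≤
        2 * Real.pi * |ω| * (B * w.length) := by
      rw [norm_mul]
      refine mul_le_mul ((norm_twist_sub_one_le _).trans ?_) (norm_twistedSum_le s ω hB w)
        (norm_nonneg _) (by positivity)
      rw [abs_mul, ← mul_assoc]
      exact mul_le_of_le_one_right (by positivity) (hs a)
    rw [e]
    refine (norm_add₃_le).trans ?_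
    have h2 := hκ a
    push_cast [List.length_cons]
    have h3 : 0 ≤ 2 * Real.pi * |ω| * B * (w.length + 1 : ℝ) := by positivity
    have h4 : 0 ≤ 2 * Real.pi * |ω| * B := by positivity
    nlinarith [(Nat.cast_nonneg w.length : (0 : ℝ) ≤ w.length)]

end Substitution

/-! ### Exponential decay over blocks, uniformly in the frequency. -/

namespace Substitution

variable {m : ℕ}

theorem ekGood_wordLength (ζ : Substitution m) (s : Fin m → ℝ) (w : List (Fin m)) {ε η : ℝ}
    (h : EKGood (fun k => ∑ i, s i * ((ζ.matrix ^ k).mulVec (population w) i : ℝ)) ε η) :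
    EKGood (fun k => wordLength s (ζ.onWord^[k] w)) ε η := by
  convert h using 2 with k
  rw [wordLength_eq_sum, population_iterate]

set_option maxHeartbeats 1000000 in
/-- Uniform bounds for twisted sums over blocks: for every frequency `ω` there is a level at most
`n + q` at which the sums are exponentially smaller, in `n`, than the trivial bound. -/
theorem exists_blockBound_exp {ζ : Substitution m} {p q : ℕ} (hp0 : 0 < p) (hq0 : 0 < q)
    (hp : ∀ a b, a ∈ ζ.onWord^[p] [b]) {d : Fin m} {v : List (Fin m)}
    (hv : ∀ b, ∃ p r, ζ.onWord^[q] [b] = p ++ (d :: v) ++ (d :: r)) {ε η : ℝ} (hε : 0 < ε)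
    (hη : 0 < η) :
    ∃ κ > 0, ∀ s ∈ roofSimplex m, EKGood (fun k => wordLength s (ζ.onWord^[k] (d :: v))) ε η →
      ∃ C > 0, ∀ (c : ℝ → Fin m → ℂ) (Λ : ℝ), 0 ≤ Λ → (∀ ω a, ‖c ω a‖ ≤ Λ) →
        (∀ ω a, ‖c ω a‖ * |ω| ≤ 4 * Λ) → (∀ ω a, ‖c ω a - c 0 a‖ ≤ 2 * Real.pi * |ω| * Λ) →
        (∀ j, ζ.BlockBound s 0 (c 0) (p * j)
          (2 * Λ * (1 - 1 / (ζ.maxLength : ℝ) ^ (p + p)) ^ j)) →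
        ∀ (n : ℕ) (ω : ℝ), ∃ k ≤ n + q,
          ζ.BlockBound s ω (c ω) k (C * Λ * Real.exp (-(κ * n))) := by
  set A : ℝ := (ζ.maxLength : ℝ) with hA
  have hA2 : 2 ≤ A := by rw [hA]; exact_mod_cast ζ.two_le_maxLength
  have hlogA : 0 < Real.log A := Real.log_pos (by linarith)
  have hp1 : (1 : ℝ) ≤ p := by exact_mod_cast hp0
  have hq1 : (1 : ℝ) ≤ q := by exact_mod_cast hq0
  set δ : ℝ := 1 / A ^ (p + p) with hδ
  have hδ0 : 0 < δ := by positivity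
  have hδ1 : δ ≤ 1 := div_le_one_of_le₀ (one_le_pow₀ (by linarith)) (by positivity)
  -- With j = ⌊σn⌋, the first entry gives pj ≤ n; the second keeps the blocks ζ^{pj}(b) shorter than
  -- e^{εn/2}, half the exponent by which small frequencies are below 1.
  set σ : ℝ := min (1 / p) (ε / (2 * p * Real.log A)) with hσ
  have hσ0 : 0 < σ := lt_min (by positivity) (by positivity)
  set γ : ℝ := 4 / A ^ (p + q) * η / q with hγ
  have hγ0 : 0 < γ := by positivity
  -- The three rates belong to the extreme frequencies, to the Erdős–Kahane range and to the
  -- contraction of averages. None depends on s; only the threshold n₀ does, and it enters through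
  -- C.
  set κ : ℝ := min (ε / 2) (min γ (δ * σ)) with hκ
  have hκ0 : 0 < κ := lt_min (by positivity) (lt_min hγ0 (by positivity))
  have hκε : κ ≤ ε / 2 := min_le_left _ _
  have hκγ : κ ≤ γ := (min_le_right _ _).trans (min_le_left _ _)
  have hκσ : κ ≤ δ * σ := (min_le_right _ _).trans (min_le_right _ _)
  refine ⟨κ, hκ0, fun s hs hgood => ?_⟩
  obtain ⟨n₀, hn₀⟩ := Filter.eventually_atTop.1 hgood
  have hpi := Real.pi_pos
  have hs1 : ∀ a, |s a| ≤ 1 := fun a => by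
    rw [abs_of_pos (hs.1 a), ← hs.2]
    exact Finset.single_le_sum (f := s) (fun i _ => (hs.1 i).le) (Finset.mem_univ a)
  set C : ℝ := Real.exp (κ * n₀) + 4 + (2 * Real.exp δ + 4 * Real.pi) with hC
  have hexpδ := Real.exp_pos δ
  have hexpκ : 1 ≤ Real.exp (κ * n₀) := Real.one_le_exp (by positivity)
  refine ⟨C, by positivity, fun c Λ hΛ hc1 hc2 hc3 hmean n ω => ?_⟩
  have h0 : ζ.BlockBound s ω (c ω) 0 Λ := fun b => norm_twistedSum_le s ω (hc1 ω) _
  rcases lt_or_ge n n₀ with hn | hn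
  · refine ⟨0, by omega, h0.mono ?_⟩
    have h1 : Real.exp (κ * n₀) * Real.exp (-(κ * n)) ≥ 1 := by
      rw [← Real.exp_add]
      refine Real.one_le_exp ?_
      have : (n : ℝ) ≤ n₀ := by exact_mod_cast hn.le
      nlinarith
    have h2 : Real.exp (κ * n₀) ≤ C := by rw [hC]; linarith
    calc Λ = 1 * Λ := by ring
      _ ≤ (Real.exp (κ * n₀) * Real.exp (-(κ * n))) * Λ := by gcongr
      _ ≤ (C * Real.exp (-(κ * n))) * Λ := by gcongr
      _ = _ := by ring
  have hnn : (0 : ℝ) ≤ n := Nat.cast_nonneg n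
  have hexpn := Real.exp_pos (-(κ * n))
  -- Large frequencies: the weights themselves are at most 4Λ/|ω|.
  rcases lt_or_ge (Real.exp (ε * n)) |ω| with hbig | hbig
  · refine ⟨0, by omega, ?_⟩
    have hω : 0 < |ω| := (Real.exp_pos _).trans hbig
    have h1 : ζ.BlockBound s ω (c ω) 0 (4 * Λ / |ω|) := fun b =>
      norm_twistedSum_le s ω (fun a => by rw [le_div_iff₀ hω]; exact hc2 ω a) _
    refine h1.mono ?_
    have h2 : |ω|⁻¹ ≤ Real.exp (-(κ * n)) := by
      have : Real.exp (-(κ * n)) = (Real.exp (κ * n))⁻¹ := Real.exp_neg _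
      rw [this]
      refine inv_anti₀ (Real.exp_pos _) (le_trans (Real.exp_le_exp.2 ?_) hbig.le)
      nlinarith
    rw [div_eq_mul_inv]
    have h4 : 4 ≤ C := by rw [hC]; linarith
    gcongr
  -- Small frequencies: on blocks of level pj the sum is compared with the untwisted mean-zero one.
  -- In the remaining range the accumulated gains are used.
  rcases lt_or_ge |ω| (Real.exp (-(ε * n))) with hsmall | hmid
  · set j : ℕ := ⌊σ * n⌋₊ with hj
    have hj1 : (j : ℝ) ≤ σ * n := Nat.floor_le (by positivity)
    have hj2 : σ * n - 1 ≤ j := (Nat.sub_one_lt_floor _).le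
    have hpj : p * j ≤ n := by
      have h1 : (p : ℝ) * j ≤ n := by
        have h2 : σ ≤ 1 / p := min_le_left _ _
        have h3 : σ * p ≤ 1 := by rwa [le_div_iff₀ (by positivity)] at h2
        nlinarith
      exact_mod_cast h1
    have hApj : A ^ (p * j) ≤ Real.exp (ε / 2 * n) := by
      rw [← Real.exp_log (by positivity : 0 < A ^ (p * j)), Real.log_pow]
      refine Real.exp_le_exp.2 ?_
      have h2 : σ ≤ ε / (2 * p * Real.log A) := min_le_right _ _
      rw [le_div_iff₀ (by positivity)] at h2
      push_cast
      have h3 : (p : ℝ) * j * Real.log A ≤ p * (σ * n) * Real.log A := by gcongr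
      nlinarith
    refine ⟨p * j, by omega, fun b => ?_⟩
    set w := ζ.onWord^[p * j] [b] with hw
    have hwl : (w.length : ℝ) ≤ Real.exp (ε / 2 * n) := by
      refine le_trans ?_ hApj
      rw [hA]
      exact_mod_cast ζ.length_iterate_singleton_le (p * j) b
    have h1 := norm_twistedSum_sub_le hs1 (ω := ω) hΛ (hc1 ω) (hc3 ω) w
    have h2 := hmean j b
    rw [← hw] at h2
    have h3 := norm_sub_norm_le (twistedSum s ω (c ω) w) (twistedSum s 0 (c 0) w)
    have h4 : (1 - δ) ^ j ≤ Real.exp δ * Real.exp (-(κ * n)) := by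
      have h5 : 1 - δ ≤ Real.exp (-δ) := by linarith [Real.add_one_le_exp (-δ)]
      refine (pow_le_pow_left₀ (by linarith) h5 j).trans ?_
      rw [← Real.exp_nat_mul, ← Real.exp_add]
      refine Real.exp_le_exp.2 ?_
      have h6 : δ * (σ * n - 1) ≤ δ * j := by gcongr
      have h7 : κ * n ≤ δ * σ * n := by gcongr
      linarith
    have h5 : |ω| * Real.exp (ε / 2 * n) ≤ Real.exp (-(κ * n)) := by
      calc |ω| * Real.exp (ε / 2 * n) ≤ Real.exp (-(ε * n)) * Real.exp (ε / 2 * n) := by gcongr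
        _ = Real.exp (-(ε / 2 * n)) := by rw [← Real.exp_add]; congr 1; ring
        _ ≤ _ := Real.exp_le_exp.2 (by nlinarith)
    have h6 : |ω| ≤ Real.exp (-(κ * n)) := by
      refine le_trans ?_ h5
      exact le_mul_of_one_le_right (abs_nonneg _) (Real.one_le_exp (by positivity))
    have h7 : |ω| * w.length ≤ Real.exp (-(κ * n)) :=
      le_trans (by gcongr) h5
    have h8 : 2 * Real.pi * |ω| * Λ + 2 * Real.pi * |ω| * Λ * w.length ≤
        4 * Real.pi * Λ * Real.exp (-(κ * n)) := by
      have : 0 ≤ 2 * Real.pi * Λ := by positivity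
      nlinarith
    have h9 : ‖twistedSum s ω (c ω) w‖ ≤ (2 * Λ * (Real.exp δ * Real.exp (-(κ * n))) +
        4 * Real.pi * Λ * Real.exp (-(κ * n))) * w.length := by
      have h10 : 2 * Λ * (1 - δ) ^ j * w.length ≤
          2 * Λ * (Real.exp δ * Real.exp (-(κ * n))) * w.length := by gcongr
      have h11 : (w.length : ℝ) * (2 * Real.pi * |ω| * Λ + 2 * Real.pi * |ω| * Λ * w.length) ≤
          w.length * (4 * Real.pi * Λ * Real.exp (-(κ * n))) := by gcongr
      linarith
    refine h9.trans (mul_le_mul_of_nonneg_right ?_ (Nat.cast_nonneg _))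
    have h12 : 2 * Real.exp δ + 4 * Real.pi ≤ C := by rw [hC]; linarith
    calc _ = (2 * Real.exp δ + 4 * Real.pi) * Λ * Real.exp (-(κ * n)) := by ring
      _ ≤ _ := by gcongr
  · refine ⟨n + q, le_rfl, ?_⟩
    have h1 := h0.exists_of_sum hΛ hq0
      (fun k => 4 / A ^ (p + q) * distInt (ω * wordLength s (ζ.onWord^[k] (d :: v))) ^ 2)
      (fun n ρ hρ h => by simpa [neg_mul] using h.gain hρ hp hv) n
    refine h1.mono ?_
    have h2 := hn₀ n hn ω hmid hbig
    rw [← Finset.mul_sum]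
    have h3 : -(4 / A ^ (p + q) * ∑ k ∈ Finset.range n,
        distInt (ω * wordLength s (ζ.onWord^[k] (d :: v))) ^ 2) / q ≤ -(κ * n) := by
      rw [neg_div, neg_le_neg_iff]
      calc κ * n ≤ γ * n := by gcongr
        _ = 4 / A ^ (p + q) * (η * n) / q := by rw [hγ]; ring
        _ ≤ _ := by gcongr
    have h4 : 1 ≤ C := by rw [hC]; linarith
    calc Λ * _ ≤ Λ * Real.exp (-(κ * n)) := by gcongr
      _ = 1 * Λ * Real.exp (-(κ * n)) := by ring
      _ ≤ _ := by gcongr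

end Substitution

/-! ### Transference of Fourier bounds to measure-preserving flows -/

section Circle

open AddCircle

variable {T : ℝ}

theorem fourier_neg_eq_mul (n : ℤ) (t τ : AddCircle T) :
    fourier (-n) τ = fourier n t * fourier (-n) (t + τ) := by
  simp only [fourier_apply]
  rw [← Circle.coe_mul, ← toCircle_add]
  congr 2
  simp [smul_add]

variable [hT : Fact (0 < T)]

/-- Young's inequality with the sup norm of the Fourier coefficients, on the circle. -/
theorem integral_norm_sq_correlation_le {U G : AddCircle T → ℂ} (hU : Measurable U)
    (hG : Measurable G) {B : ℝ} (hB : ∀ t, ‖U t‖ ≤ B) (hG2 : MemLp G 2 (@haarAddCircle T hT))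
    {M : ℝ} (hM : ∀ n : ℤ, ‖∫ t, U t * fourier n t ∂(@haarAddCircle T hT)‖ ≤ M) :
    ∫ τ, ‖∫ t, U t * G (t + τ) ∂(@haarAddCircle T hT)‖ ^ 2 ∂(@haarAddCircle T hT) ≤
      M ^ 2 * ∫ τ, ‖G τ‖ ^ 2 ∂(@haarAddCircle T hT) := by
  set h : Measure (AddCircle T) := @haarAddCircle T hT with hh
  set H : AddCircle T → ℂ := fun τ => ∫ t, U t * G (t + τ) ∂h with hH
  have hG1 : Integrable G h := hG2.integrable (by norm_num)
  have hint : Integrable (fun z : AddCircle T × AddCircle T => U z.1 * G (z.1 + z.2))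
      (h.prod h) := by
    have h1 : Integrable (fun z : AddCircle T × AddCircle T => G (z.1 + z.2)) (h.prod h) :=
      (measurePreserving_prod_add h h).integrable_comp_of_integrable (hG1.comp_snd h)
    exact h1.bdd_mul (hU.comp measurable_fst).aestronglyMeasurable
      (Filter.Eventually.of_forall fun z => hB z.1)
  have hHmeas : AEStronglyMeasurable H h := by
    have : Measurable fun z : AddCircle T × AddCircle T => U z.2 * G (z.2 + z.1) := by fun_prop
    exact this.stronglyMeasurable.integral_prod_right'.aestronglyMeasurable
  have hHb : ∀ τ, ‖H τ‖ ≤ B * ∫ t, ‖G t‖ ∂h := by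
    intro τ
    refine (norm_integral_le_integral_norm _).trans ?_
    rw [← integral_add_right_eq_self (fun t => ‖G t‖) τ, ← integral_const_mul]
    refine integral_mono_of_nonneg (Filter.Eventually.of_forall fun _ => norm_nonneg _) ?_ ?_
    · exact ((hG1.norm).comp_add_right τ).const_mul B
    · refine Filter.Eventually.of_forall fun t => ?_
      simp only [norm_mul]
      gcongr
      exact hB t
  have hH2 : MemLp H 2 h := MemLp.of_bound hHmeas _ (Filter.Eventually.of_forall hHb)
  -- Correlation becomes a product of Fourier coefficients; with the first factor bounded by M,
  -- Parseval for H and for G finishes the proof.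
  have hcoef : ∀ n, fourierCoeff H n = (∫ t, U t * fourier n t ∂h) * fourierCoeff G n := by
    intro n
    have e1 : fourierCoeff H n = ∫ τ, ∫ t, fourier (-n) τ * (U t * G (t + τ)) ∂h ∂h := by
      simp only [fourierCoeff, hH, smul_eq_mul, integral_const_mul]
      rfl
    have hint' : Integrable (Function.uncurry fun τ t : AddCircle T =>
        fourier (-n) τ * (U t * G (t + τ))) (h.prod h) := by
      have h1 : Integrable (fun z : AddCircle T × AddCircle T => U z.2 * G (z.2 + z.1))
        (h.prod h) := hint.swap
      refine h1.bdd_mul (c := 1) ?_ (Filter.Eventually.of_forall fun z => ?_)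
      · exact ((map_continuous (fourier (-n))).measurable.comp
          measurable_fst).aestronglyMeasurable
      · rw [fourier_apply, Circle.norm_coe]
    rw [e1, integral_integral_swap hint', ← integral_mul_const]
    refine integral_congr_ae (Filter.Eventually.of_forall fun t => ?_)
    have e2 : fourierCoeff G n = ∫ τ, fourier (-n) (t + τ) * G (t + τ) ∂h := by
      rw [integral_add_left_eq_self (fun τ => fourier (-n) τ * G τ) t]
      rfl
    simp only
    rw [e2, ← integral_const_mul]
    refine integral_congr_ae (Filter.Eventually.of_forall fun τ => ?_)
    simp only
    rw [fourier_neg_eq_mul n t τ]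
    ring
  have parseval : ∀ F : AddCircle T → ℂ, MemLp F 2 h →
      HasSum (fun n => ‖fourierCoeff F n‖ ^ 2) (∫ τ, ‖F τ‖ ^ 2 ∂h) := by
    intro F hF
    have h1 := hasSum_sq_fourierCoeff hF.toLp
    have h2 : ∀ n, fourierCoeff hF.toLp n = fourierCoeff F n :=
      fun n => congrFun (fourierCoeff_congr_ae hF.coeFn_toLp) n
    simp only [h2] at h1
    convert h1 using 1
    refine integral_congr_ae ?_
    filter_upwards [hF.coeFn_toLp] with x hx
    rw [hx]
  refine hasSum_le (fun n => ?_) (parseval H hH2) ((parseval G hG2).mul_left (M ^ 2))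
  rw [hcoef, norm_mul, mul_pow]
  gcongr
  exact hM n

end Circle

theorem measurable_liftIoc {T : ℝ} [Fact (0 < T)] {f : ℝ → ℂ} (hf : Measurable f) :
    Measurable (AddCircle.liftIoc T 0 f) :=
  (hf.comp measurable_subtype_coe).comp (AddCircle.measurableEquivIoc T 0).measurable

theorem integral_haarAddCircle_eq {T : ℝ} [hT : Fact (0 < T)] {E : Type*} [NormedAddCommGroup E]
    [NormedSpace ℝ E] (f : AddCircle T → E) :
    ∫ t, f t ∂(@AddCircle.haarAddCircle T hT) = T⁻¹ • ∫ t in (0 : ℝ)..T, f t := by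
  rw [AddCircle.integral_haarAddCircle, ← AddCircle.intervalIntegral_preimage T 0 f, zero_add]

/-- The circle has length 2R and u is cut off to (0, R]. For t and x in (0, R] the sum t + x stays
within one period, so the circular correlation is the one on the line. -/
theorem integral_norm_sq_translates_le {R : ℝ} (hR : 0 < R) {u G : ℝ → ℂ} (hu : Measurable u)
    (hG : Measurable G) {B : ℝ} (hB : ∀ t, ‖u t‖ ≤ B)
    (hG2 : MemLp G 2 (volume.restrict (Set.Ioc 0 (2 * R)))) {M : ℝ}
    (hM : ∀ ω : ℝ, ‖∫ t in (0 : ℝ)..R, twist (ω * t) * u t‖ ≤ M) :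
    ∫ x in Set.Ioc 0 R, ‖∫ t in Set.Ioc 0 R, u t * G (t + x)‖ ^ 2 ≤
      M ^ 2 * ∫ t in Set.Ioc 0 (2 * R), ‖G t‖ ^ 2 := by
  set T : ℝ := 2 * R with hTdef
  have hT0 : 0 < T := by positivity
  have : Fact (0 < T) := ⟨hT0⟩
  set U : AddCircle T → ℂ := AddCircle.liftIoc T 0 ((Set.Ioc 0 R).indicator u) with hU
  set Gc : AddCircle T → ℂ := AddCircle.liftIoc T 0 G with hGc
  have hB0 : 0 ≤ B := (norm_nonneg _).trans (hB 0)
  have hUv : ∀ t ∈ Set.Ioc 0 T, U (t : AddCircle T) = (Set.Ioc 0 R).indicator u t := fun t ht =>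
    AddCircle.liftIoc_zero_coe_apply ht
  have hGv : ∀ t ∈ Set.Ioc 0 T, Gc (t : AddCircle T) = G t := fun t ht =>
    AddCircle.liftIoc_zero_coe_apply ht
  have hsub : Set.Ioc 0 R ⊆ Set.Ioc 0 T := Set.Ioc_subset_Ioc_right (by linarith)
  have hUint : ∀ F : AddCircle T → ℂ, ∫ t, U t * F t ∂AddCircle.haarAddCircle =
      T⁻¹ • ∫ t in Set.Ioc 0 R, u t * F (t : AddCircle T) := by
    intro F
    rw [integral_haarAddCircle_eq, intervalIntegral.integral_of_le hT0.le]
    congr 1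
    rw [← integral_indicator measurableSet_Ioc, ← integral_indicator measurableSet_Ioc]
    congr 1
    ext t
    by_cases ht : t ∈ Set.Ioc 0 T
    · rw [Set.indicator_of_mem ht, hUv t ht]
      by_cases ht' : t ∈ Set.Ioc 0 R
      · rw [Set.indicator_of_mem ht', Set.indicator_of_mem ht']
      · rw [Set.indicator_of_notMem ht', Set.indicator_of_notMem ht', zero_mul]
    · rw [Set.indicator_of_notMem ht, Set.indicator_of_notMem fun h => ht (hsub h)]
  have hUB : ∀ t, ‖U t‖ ≤ B := by
    intro t
    change ‖(Set.Ioc 0 R).indicator u _‖ ≤ B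
    exact (norm_indicator_le_norm_self _ _).trans (hB _)
  have hGL2 : MemLp Gc 2 (@AddCircle.haarAddCircle T _) := by
    have h1 : MemLp G 2 (volume.restrict (Set.Ioc 0 (0 + T))) := by rwa [zero_add]
    exact h1.memLp_liftIoc.haarAddCircle
  have hMn : ∀ n : ℤ, ‖∫ t, U t * fourier n t ∂(@AddCircle.haarAddCircle T _)‖ ≤ M / T := by
    intro n
    rw [hUint (fun t => fourier n t), norm_smul, Real.norm_of_nonneg (by positivity), mul_comm,
      ← div_eq_mul_inv]
    refine div_le_div_of_nonneg_right ?_ hT0.le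
    rw [← intervalIntegral.integral_of_le hR.le]
    have e : ∀ t : ℝ, u t * fourier n (t : AddCircle T) = twist (-(n / T) * t) * u t := by
      intro t
      rw [fourier_coe_apply, twist, mul_comm]
      congr 2
      push_cast
      ring
    simp only [e]
    exact hM _
  have key := integral_norm_sq_correlation_le
    (measurable_liftIoc (hu.indicator measurableSet_Ioc)) (measurable_liftIoc hG) hUB hGL2 hMn
  simp only [← hU, ← hGc] at key
  rw [integral_haarAddCircle_eq, integral_haarAddCircle_eq,
    intervalIntegral.integral_of_le hT0.le, intervalIntegral.integral_of_le hT0.le] at key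
  have hGeq : ∫ t in Set.Ioc 0 T, ‖Gc (t : AddCircle T)‖ ^ 2 = ∫ t in Set.Ioc 0 T, ‖G t‖ ^ 2 :=
    setIntegral_congr_fun measurableSet_Ioc fun t ht => by simp only [hGv t ht]
  rw [hGeq] at key
  have hHv : ∀ x ∈ Set.Ioc 0 R, T⁻¹ ^ 2 * ‖∫ t in Set.Ioc 0 R, u t * G (t + x)‖ ^ 2 =
      ‖∫ t, U t * Gc (t + (x : AddCircle T)) ∂(@AddCircle.haarAddCircle T _)‖ ^ 2 := by
    intro x hx
    rw [hUint (fun t => Gc (t + (x : AddCircle T))), norm_smul,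
      Real.norm_of_nonneg (by positivity), mul_pow]
    congr 3
    refine setIntegral_congr_fun measurableSet_Ioc fun t ht => ?_
    rw [← AddCircle.coe_add, hGv (t + x) ⟨by linarith [ht.1, hx.1], by linarith [ht.2, hx.2]⟩]
  have hle : ∫ x in Set.Ioc 0 R, T⁻¹ ^ 2 * ‖∫ t in Set.Ioc 0 R, u t * G (t + x)‖ ^ 2 ≤
      ∫ x in Set.Ioc 0 T,
        ‖∫ t, U t * Gc (t + (x : AddCircle T)) ∂(@AddCircle.haarAddCircle T _)‖ ^ 2 := by
    rw [setIntegral_congr_fun measurableSet_Ioc hHv]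
    refine setIntegral_mono_set ?_ (Filter.Eventually.of_forall fun _ => by positivity)
      hsub.eventuallyLE
    have hG1 : Integrable Gc (@AddCircle.haarAddCircle T _) := hGL2.integrable (by norm_num)
    refine Measure.integrableOn_of_bounded (M := (B * ∫ t, ‖Gc t‖ ∂AddCircle.haarAddCircle) ^ 2)
      (by simp) ?_ (Filter.Eventually.of_forall fun x => ?_)
    · have h1 : Measurable fun z : ℝ × AddCircle T => U z.2 * Gc (z.2 + (z.1 : AddCircle T)) := by
        have hU' : Measurable U := measurable_liftIoc (hu.indicator measurableSet_Ioc)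
        have hG' : Measurable Gc := measurable_liftIoc hG
        exact (hU'.comp measurable_snd).mul (hG'.comp
          (measurable_snd.add (AddCircle.measurable_mk'.comp measurable_fst)))
      exact ((h1.stronglyMeasurable.integral_prod_right'
        (ν := @AddCircle.haarAddCircle T _)).norm.pow 2).aestronglyMeasurable
    · rw [Real.norm_of_nonneg (by positivity)]
      refine pow_le_pow_left₀ (norm_nonneg _) ?_ 2
      refine (norm_integral_le_integral_norm _).trans ?_
      rw [← integral_add_right_eq_self (fun t => ‖Gc t‖) (x : AddCircle T), ← integral_const_mul]
      refine integral_mono_of_nonneg (Filter.Eventually.of_forall fun _ => norm_nonneg _) ?_ ?_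
      · exact ((hG1.norm).comp_add_right (x : AddCircle T)).const_mul B
      · refine Filter.Eventually.of_forall fun t => ?_
        simp only [norm_mul]
        gcongr
        exact hUB t
  rw [integral_const_mul] at hle
  simp only [smul_eq_mul] at key
  have h1 := mul_le_mul_of_nonneg_left hle (inv_nonneg.2 hT0.le)
  have h2 := h1.trans key
  have h3 : (0 : ℝ) < T⁻¹ ^ 3 := by positivity
  refine le_of_mul_le_mul_left ?_ h3
  calc _ = T⁻¹ * (T⁻¹ ^ 2 * ∫ x in Set.Ioc 0 R, ‖∫ t in Set.Ioc 0 R, u t * G (t + x)‖ ^ 2) := by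
        ring
    _ ≤ _ := h2
    _ = _ := by ring

/-- Cauchy–Schwarz in the form |F||G| ≤ |F|²/(2M) + M|G|²/2. By the L² bound for F, both terms
integrate to at most half of the right-hand side. -/
theorem norm_integral_correlation_le {R : ℝ} (hR : 0 < R) {u G : ℝ → ℂ} (hu : Measurable u)
    (hG : Measurable G) {B : ℝ} (hB : ∀ t, ‖u t‖ ≤ B)
    (hG2 : MemLp G 2 (volume.restrict (Set.Ioc 0 (2 * R)))) {M : ℝ} (hM0 : 0 < M)
    (hM : ∀ ω : ℝ, ‖∫ t in (0 : ℝ)..R, twist (ω * t) * u t‖ ≤ M) :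
    ‖∫ x in Set.Ioc 0 R, (∫ t in Set.Ioc 0 R, u t * G (t + x)) * (starRingEnd ℂ) (G x)‖ ≤
      M * ∫ t in Set.Ioc 0 (2 * R), ‖G t‖ ^ 2 := by
  have h1 := integral_norm_sq_translates_le hR hu hG hB hG2 hM
  have hsub : Set.Ioc 0 R ⊆ Set.Ioc 0 (2 * R) := Set.Ioc_subset_Ioc_right (by linarith)
  have hGsq : IntegrableOn (fun t => ‖G t‖ ^ 2) (Set.Ioc 0 (2 * R)) := by
    have h := hG2.integrable_norm_pow (by norm_num)
    exact_mod_cast h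
  have h2 : ∫ t in Set.Ioc 0 R, ‖G t‖ ^ 2 ≤ ∫ t in Set.Ioc 0 (2 * R), ‖G t‖ ^ 2 :=
    setIntegral_mono_set hGsq (Filter.Eventually.of_forall fun _ => by positivity)
      hsub.eventuallyLE
  set F : ℝ → ℂ := fun x => ∫ t in Set.Ioc 0 R, u t * G (t + x) with hF
  set N : ℝ := ∫ t in Set.Ioc 0 (2 * R), ‖G t‖ ^ 2 with hN
  have hFmeas : StronglyMeasurable F := by
    have : Measurable fun z : ℝ × ℝ => u z.2 * G (z.2 + z.1) := by fun_prop
    exact this.stronglyMeasurable.integral_prod_right'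
  have hFb : ∀ x ∈ Set.Ioc 0 R, ‖F x‖ ≤ B * ∫ t in Set.Ioc 0 (2 * R), ‖G t‖ := by
    intro x hx
    have hG1 : IntegrableOn G (Set.Ioc 0 (2 * R)) := hG2.integrable (by norm_num)
    have hB0 : 0 ≤ B := (norm_nonneg _).trans (hB 0)
    refine (norm_integral_le_integral_norm _).trans ?_
    have e : ∫ t in Set.Ioc 0 R, ‖G (t + x)‖ = ∫ t in Set.Ioc x (R + x), ‖G t‖ := by
      rw [← intervalIntegral.integral_of_le hR.le,
        intervalIntegral.integral_comp_add_right (fun t => ‖G t‖),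
        intervalIntegral.integral_of_le (by linarith), zero_add]
    have hsub' : Set.Ioc x (R + x) ⊆ Set.Ioc 0 (2 * R) :=
      Set.Ioc_subset_Ioc hx.1.le (by linarith [hx.2])
    have hGx : IntegrableOn (fun t => ‖G (t + x)‖) (Set.Ioc 0 R) := by
      have h3 : IntervalIntegrable (fun t => ‖G t‖) volume x (R + x) :=
        (intervalIntegrable_iff_integrableOn_Ioc_of_le (by linarith)).2 (hG1.mono_set hsub').norm
      have h4 := h3.comp_add_right x
      simp only [sub_self, add_sub_cancel_right] at h4
      exact (intervalIntegrable_iff_integrableOn_Ioc_of_le hR.le).1 h4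
    calc ∫ t in Set.Ioc 0 R, ‖u t * G (t + x)‖ ≤ ∫ t in Set.Ioc 0 R, B * ‖G (t + x)‖ := by
          refine integral_mono_of_nonneg (Filter.Eventually.of_forall fun _ => norm_nonneg _)
            (hGx.const_mul B) (Filter.Eventually.of_forall fun t => ?_)
          simp only [norm_mul]
          gcongr
          exact hB t
      _ = B * ∫ t in Set.Ioc x (R + x), ‖G t‖ := by rw [integral_const_mul, e]
      _ ≤ _ := by
          gcongr
          · exact Filter.Eventually.of_forall fun _ => norm_nonneg _
          · exact hG1.norm
  have hFsq : IntegrableOn (fun x => ‖F x‖ ^ 2) (Set.Ioc 0 R) := by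
    refine Measure.integrableOn_of_bounded (M := (B * ∫ t in Set.Ioc 0 (2 * R), ‖G t‖) ^ 2)
      (by simp) (hFmeas.norm.pow 2).aestronglyMeasurable ?_
    filter_upwards [ae_restrict_mem measurableSet_Ioc] with x hx
    rw [Real.norm_of_nonneg (by positivity)]
    exact pow_le_pow_left₀ (norm_nonneg _) (hFb x hx) 2
  have hpt : ∀ x, ‖F x * (starRingEnd ℂ) (G x)‖ ≤ (2 * M)⁻¹ * ‖F x‖ ^ 2 + M / 2 * ‖G x‖ ^ 2 := by
    intro x
    rw [norm_mul, RCLike.norm_conj]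
    have h3 : 0 ≤ (2 * M)⁻¹ * (‖F x‖ - M * ‖G x‖) ^ 2 := by positivity
    have h4 : (2 * M)⁻¹ * (‖F x‖ - M * ‖G x‖) ^ 2 =
        (2 * M)⁻¹ * ‖F x‖ ^ 2 + M / 2 * ‖G x‖ ^ 2 - ‖F x‖ * ‖G x‖ := by
      field_simp
      ring
    linarith
  calc ‖∫ x in Set.Ioc 0 R, F x * (starRingEnd ℂ) (G x)‖
      ≤ ∫ x in Set.Ioc 0 R, ‖F x * (starRingEnd ℂ) (G x)‖ := norm_integral_le_integral_norm _
    _ ≤ ∫ x in Set.Ioc 0 R, ((2 * M)⁻¹ * ‖F x‖ ^ 2 + M / 2 * ‖G x‖ ^ 2) :=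
        integral_mono_of_nonneg (Filter.Eventually.of_forall fun _ => norm_nonneg _)
          ((hFsq.const_mul _).add ((hGsq.mono_set hsub).const_mul _))
          (Filter.Eventually.of_forall hpt)
    _ = (2 * M)⁻¹ * (∫ x in Set.Ioc 0 R, ‖F x‖ ^ 2) +
          M / 2 * ∫ x in Set.Ioc 0 R, ‖G x‖ ^ 2 := by
        rw [integral_add (hFsq.const_mul _) ((hGsq.mono_set hsub).const_mul _),
          integral_const_mul, integral_const_mul]
    _ ≤ (2 * M)⁻¹ * (M ^ 2 * N) + M / 2 * N := by gcongr
    _ = M * N := by field_simp; ring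

section Flow

variable {Y : Type*} [MeasurableSpace Y] [AddAction ℝ Y] [MeasurableVAdd₂ ℝ Y] {ν : Measure Y}
  [VAddInvariantMeasure ℝ Y ν]

theorem integral_comp_vadd {E : Type*} [NormedAddCommGroup E] [NormedSpace ℝ E] (t : ℝ)
    {F : Y → E} (hF : AEStronglyMeasurable F ν) : ∫ y, F (t +ᵥ y) ∂ν = ∫ y, F y ∂ν := by
  have h := measurePreserving_vadd t ν
  conv_rhs => rw [← h.map_eq]
  rw [integral_map h.measurable.aemeasurable (by rwa [h.map_eq])]

variable [IsProbabilityMeasure ν]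

theorem integrable_comp_vadd {α : Type*} [MeasurableSpace α] {μ : Measure α} [IsFiniteMeasure μ]
    {k : α → ℝ} (hk : Measurable k) {F : Y → ℝ} (hF : Integrable F ν) :
    Integrable (fun z : α × Y => F (k z.1 +ᵥ z.2)) (μ.prod ν) := by
  have h1 : MeasurePreserving (fun z : α × Y => (z.1, k z.1 +ᵥ z.2)) (μ.prod ν) (μ.prod ν) := by
    refine (MeasurePreserving.id μ).skew_product (g := fun a y => k a +ᵥ y) ?_
      (Filter.Eventually.of_forall fun a => (measurePreserving_vadd (k a) ν).map_eq)
    exact (hk.comp measurable_fst).vadd measurable_snd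
  exact h1.integrable_comp_of_integrable (hF.comp_snd μ)

/-- Transference: an average of the autocorrelation of `g` along a measure-preserving flow against a
weight `u` is bounded by the sup norm of the Fourier transform of `u`. -/
theorem norm_integral_mul_autocorrelation_le {R : ℝ} (hR : 0 < R) {u : ℝ → ℂ} (hu : Measurable u)
    {B : ℝ} (hB : ∀ t, ‖u t‖ ≤ B) {M : ℝ} (hM0 : 0 < M)
    (hM : ∀ ω : ℝ, ‖∫ t in (0 : ℝ)..R, twist (ω * t) * u t‖ ≤ M) {g : Y → ℂ} (hg : Measurable g)
    (hg2 : MemLp g 2 ν) :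
    ‖∫ t in (0 : ℝ)..R, u t * ∫ y, g (t +ᵥ y) * (starRingEnd ℂ) (g y) ∂ν‖ ≤
      2 * M * ∫ y, ‖g y‖ ^ 2 ∂ν := by
  have hB0 : 0 ≤ B := (norm_nonneg _).trans (hB 0)
  have hgsq : Integrable (fun y => ‖g y‖ ^ 2) ν := by
    simpa using hg2.integrable_norm_pow (by norm_num)
  set lam : Measure ℝ := volume.restrict (Set.Ioc 0 R) with hlam
  -- The integrand is translated along the flow by a further time x = a.1. By invariance each x in
  -- (0, R] gives the same integral I, hence R·I in total; exchanging integrals, each orbit t ↦ g(t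
  -- +ᵥ y) falls under the estimate on the line. Averaging over y, the interval (0, 2R] there
  -- accounts for the factor 2.
  set K : (ℝ × ℝ) → Y → ℂ := fun a y =>
    u a.2 * g ((a.2 + a.1) +ᵥ y) * (starRingEnd ℂ) (g (a.1 +ᵥ y)) with hK
  have hKmeas : Measurable (Function.uncurry K) := by
    have h1 : Measurable fun z : (ℝ × ℝ) × Y => g ((z.1.2 + z.1.1) +ᵥ z.2) :=
      hg.comp (((measurable_snd.comp measurable_fst).add
        (measurable_fst.comp measurable_fst)).vadd measurable_snd)
    have h2 : Measurable fun z : (ℝ × ℝ) × Y => (starRingEnd ℂ) (g (z.1.1 +ᵥ z.2)) :=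
      Complex.continuous_conj.measurable.comp
        (hg.comp ((measurable_fst.comp measurable_fst).vadd measurable_snd))
    exact ((hu.comp (measurable_snd.comp measurable_fst)).mul h1).mul h2
  have hKint : Integrable (Function.uncurry K) ((lam.prod lam).prod ν) := by
    have h1 := integrable_comp_vadd (μ := lam.prod lam) (ν := ν) (k := fun a : ℝ × ℝ => a.2 + a.1)
      (by fun_prop) hgsq
    have h2 := integrable_comp_vadd (μ := lam.prod lam) (ν := ν) (k := fun a : ℝ × ℝ => a.1)
      (by fun_prop) hgsq
    refine ((h1.add h2).const_mul B).mono' hKmeas.aestronglyMeasurable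
      (Filter.Eventually.of_forall fun z => ?_)
    simp only [Function.uncurry, hK, norm_mul, RCLike.norm_conj, Pi.add_apply]
    rw [mul_assoc]
    refine mul_le_mul (hB _) ?_ (by positivity) hB0
    nlinarith [sq_nonneg (‖g ((z.1.2 + z.1.1) +ᵥ z.2)‖ - ‖g (z.1.1 +ᵥ z.2)‖),
      norm_nonneg (g ((z.1.2 + z.1.1) +ᵥ z.2)), norm_nonneg (g (z.1.1 +ᵥ z.2))]
  set I : ℂ := ∫ t in (0 : ℝ)..R, u t * ∫ y, g (t +ᵥ y) * (starRingEnd ℂ) (g y) ∂ν with hI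
  have e1 : (R : ℂ) * I = ∫ a, ∫ y, K a y ∂ν ∂(lam.prod lam) := by
    rw [integral_prod (fun a => ∫ y, K a y ∂ν) hKint.integral_prod_left]
    have h1 : ∀ x, ∫ t, ∫ y, K (x, t) y ∂ν ∂lam = I := by
      intro x
      rw [hI, intervalIntegral.integral_of_le hR.le]
      refine integral_congr_ae (Filter.Eventually.of_forall fun t => ?_)
      simp only [hK, mul_assoc, integral_const_mul, add_vadd]
      congr 1
      refine integral_comp_vadd x (F := fun y => g (t +ᵥ y) * (starRingEnd ℂ) (g y)) ?_
      exact ((hg.comp (measurable_const_vadd t)).mul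
        (Complex.continuous_conj.measurable.comp hg)).aestronglyMeasurable
    simp only [h1]
    rw [integral_const, measureReal_def, hlam, Measure.restrict_apply_univ, Real.volume_Ioc]
    rw [ENNReal.toReal_ofReal (by linarith), sub_zero]
    simp
  rw [integral_integral_swap hKint] at e1
  have hGy : Integrable (fun z : ℝ × Y => ‖g (z.1 +ᵥ z.2)‖ ^ 2)
      ((volume.restrict (Set.Ioc 0 (2 * R))).prod ν) :=
    integrable_comp_vadd measurable_id hgsq
  have hbound : ∀ᵐ y ∂ν, ‖∫ a, K a y ∂(lam.prod lam)‖ ≤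
      M * ∫ t in Set.Ioc 0 (2 * R), ‖g (t +ᵥ y)‖ ^ 2 := by
    filter_upwards [hGy.prod_left_ae, hKint.prod_left_ae] with y h1 h2
    have hGm : Measurable fun t : ℝ => g (t +ᵥ y) :=
      hg.comp (measurable_id.vadd measurable_const)
    have hG2 : MemLp (fun t : ℝ => g (t +ᵥ y)) 2 (volume.restrict (Set.Ioc 0 (2 * R))) :=
      (memLp_two_iff_integrable_sq_norm hGm.aestronglyMeasurable).2 h1
    rw [integral_prod (fun a => K a y) h2]
    have := norm_integral_correlation_le hR hu hGm hB hG2 hM0 hM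
    simp only [← integral_mul_const] at this
    exact this
  have e2 : ∫ y, (∫ t in Set.Ioc 0 (2 * R), ‖g (t +ᵥ y)‖ ^ 2) ∂ν = 2 * R * ∫ y, ‖g y‖ ^ 2 ∂ν := by
    rw [integral_integral_swap (f := fun y (t : ℝ) => ‖g (t +ᵥ y)‖ ^ 2) hGy.swap]
    have h1 : ∀ t : ℝ, ∫ y, ‖g (t +ᵥ y)‖ ^ 2 ∂ν = ∫ y, ‖g y‖ ^ 2 ∂ν := fun t =>
      integral_comp_vadd t hgsq.aestronglyMeasurable
    simp only [h1]
    rw [integral_const, measureReal_def, Measure.restrict_apply_univ, Real.volume_Ioc,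
      ENNReal.toReal_ofReal (by linarith), sub_zero, smul_eq_mul]
  have h3 : ‖(R : ℂ) * I‖ ≤ M * (2 * R * ∫ y, ‖g y‖ ^ 2 ∂ν) := by
    rw [e1, ← e2, ← integral_const_mul]
    refine (norm_integral_le_integral_norm _).trans (integral_mono_ae ?_ ?_ hbound)
    · exact hKint.integral_prod_right.norm
    · exact hGy.integral_prod_right.const_mul M
  rw [norm_mul, Complex.norm_real, Real.norm_of_nonneg hR.le] at h3
  refine le_of_mul_le_mul_left (h3.trans (le_of_eq ?_)) hR
  ring

end Flow

/-! ### Finite Fourier transforms of Lipschitz functions -/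

theorem twist_neg_half {ω : ℝ} (hω : ω ≠ 0) (r : ℝ) :
    twist (ω * (r + 1 / (2 * ω))) = -twist (ω * r) := by
  have h1 : ω * (r + 1 / (2 * ω)) = ω * r + 1 / 2 := by field_simp
  have h2 : twist (1 / 2) = -1 := by
    rw [twist, ← Complex.exp_neg_pi_mul_I]
    congr 1
    push_cast
    ring
  rw [h1, twist_add, h2]
  ring

section Transform

variable {φ : ℝ → ℂ} {Λ ℓ : ℝ}

theorem norm_transform_le (hb : ∀ r, ‖φ r‖ ≤ Λ) (hℓ : |ℓ| ≤ 1) (ω : ℝ) :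
    ‖∫ r in (0 : ℝ)..ℓ, twist (ω * r) * φ r‖ ≤ Λ := by
  have hΛ : 0 ≤ Λ := (norm_nonneg _).trans (hb 0)
  refine (intervalIntegral.norm_integral_le_of_norm_le_const (C := Λ) fun r _ => ?_).trans ?_
  · rw [norm_mul, norm_twist, one_mul]; exact hb r
  · rw [sub_zero]; exact mul_le_of_le_one_right hΛ hℓ

theorem norm_transform_sub_le (hφ : Continuous φ) (hb : ∀ r, ‖φ r‖ ≤ Λ) (hℓ0 : 0 ≤ ℓ)
    (hℓ : ℓ ≤ 1) (ω : ℝ) :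
    ‖(∫ r in (0 : ℝ)..ℓ, twist (ω * r) * φ r) - ∫ r in (0 : ℝ)..ℓ, twist (0 * r) * φ r‖ ≤
      2 * Real.pi * |ω| * Λ := by
  have hΛ : 0 ≤ Λ := (norm_nonneg _).trans (hb 0)
  have hpi := Real.pi_pos
  have hc : ∀ ω : ℝ, Continuous fun r => twist (ω * r) * φ r := fun ω =>
    (continuous_twist.comp (continuous_const.mul continuous_id)).mul hφ
  rw [← intervalIntegral.integral_sub ((hc ω).intervalIntegrable _ _)
    ((hc 0).intervalIntegrable _ _)]
  refine (intervalIntegral.norm_integral_le_of_norm_le_const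
    (C := 2 * Real.pi * |ω| * Λ) fun r hr => ?_).trans ?_
  · rw [Set.uIoc_of_le hℓ0] at hr
    rw [zero_mul, twist_zero, ← sub_mul, norm_mul]
    refine mul_le_mul ((norm_twist_sub_one_le _).trans ?_) (hb r) (norm_nonneg _) (by positivity)
    rw [abs_mul, ← mul_assoc]
    refine mul_le_of_le_one_right (by positivity) ?_
    rw [abs_of_pos hr.1]
    exact hr.2.trans hℓ
  · rw [sub_zero, abs_of_nonneg hℓ0]
    exact mul_le_of_le_one_right (by positivity) hℓ

/-- Shifting by the half period h = 1/(2ω) changes the sign of the character. So 2I is the integral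
of φ(r) - φ(r - h) plus two boundary pieces of length |h|, each of the three being at most Λ|h|. No
derivative of φ is needed. -/
theorem norm_transform_mul_le (hφ : Continuous φ) (hb : ∀ r, ‖φ r‖ ≤ Λ)
    (hlip : ∀ r r', ‖φ r - φ r'‖ ≤ Λ * |r - r'|) (hℓ : |ℓ| ≤ 1) (ω : ℝ) :
    ‖∫ r in (0 : ℝ)..ℓ, twist (ω * r) * φ r‖ * |ω| ≤ 4 * Λ := by
  have hΛ : 0 ≤ Λ := (norm_nonneg _).trans (hb 0)
  rcases eq_or_ne ω 0 with rfl | hω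
  · simp; linarith
  set h : ℝ := 1 / (2 * ω) with hh
  set I : ℂ := ∫ r in (0 : ℝ)..ℓ, twist (ω * r) * φ r with hI
  have hc : Continuous fun r => twist (ω * r) * φ r :=
    (continuous_twist.comp (continuous_const.mul continuous_id)).mul hφ
  have hc' : Continuous fun r => twist (ω * r) * φ (r - h) :=
    (continuous_twist.comp (continuous_const.mul continuous_id)).mul
      (hφ.comp (continuous_id.sub continuous_const))
  have e1 : ∫ r in h..ℓ + h, twist (ω * r) * φ (r - h) = -I := by
    have h1 := intervalIntegral.integral_comp_add_right (a := 0) (b := ℓ)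
      (fun r => twist (ω * r) * φ (r - h)) h
    rw [zero_add] at h1
    rw [← h1, hI, ← intervalIntegral.integral_neg]
    congr 1
    ext r
    rw [add_sub_cancel_right, hh, twist_neg_half hω]
    ring
  have e2 : ∫ r in (0 : ℝ)..ℓ, twist (ω * r) * (φ r - φ (r - h)) =
      I - ∫ r in (0 : ℝ)..ℓ, twist (ω * r) * φ (r - h) := by
    rw [hI, ← intervalIntegral.integral_sub (hc.intervalIntegrable _ _)
      (hc'.intervalIntegrable _ _)]
    congr 1
    ext r
    ring
  have e3 := intervalIntegral.integral_interval_sub_interval_comm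
    (hc'.intervalIntegrable (μ := volume) 0 ℓ) (hc'.intervalIntegrable h (ℓ + h))
    (hc'.intervalIntegrable 0 h)
  rw [e1] at e3
  have e4 : 2 * I = (∫ r in (0 : ℝ)..ℓ, twist (ω * r) * (φ r - φ (r - h))) +
      ((∫ r in (0 : ℝ)..h, twist (ω * r) * φ (r - h)) -
        ∫ r in ℓ..ℓ + h, twist (ω * r) * φ (r - h)) := by
    rw [e2, ← e3]; ring
  have b1 : ‖∫ r in (0 : ℝ)..ℓ, twist (ω * r) * (φ r - φ (r - h))‖ ≤ Λ * |h| := by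
    refine (intervalIntegral.norm_integral_le_of_norm_le_const (C := Λ * |h|) fun r _ => ?_).trans ?_
    · rw [norm_mul, norm_twist, one_mul]
      have := hlip r (r - h)
      rwa [sub_sub_cancel] at this
    · rw [sub_zero]; exact mul_le_of_le_one_right (by positivity) hℓ
  have b2 : ∀ a : ℝ, ‖∫ r in a..a + h, twist (ω * r) * φ (r - h)‖ ≤ Λ * |h| := by
    intro a
    refine (intervalIntegral.norm_integral_le_of_norm_le_const (C := Λ) fun r _ => ?_).trans ?_
    · rw [norm_mul, norm_twist, one_mul]; exact hb _
    · rw [add_sub_cancel_left]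
  have b3 : ‖(2 : ℂ) * I‖ ≤ 3 * (Λ * |h|) := by
    rw [e4]
    refine (norm_add_le _ _).trans ?_
    have := norm_sub_le (∫ r in (0 : ℝ)..h, twist (ω * r) * φ (r - h))
      (∫ r in ℓ..ℓ + h, twist (ω * r) * φ (r - h))
    have h0 := b2 0
    rw [zero_add] at h0
    linarith [b2 ℓ]
  rw [norm_mul, Complex.norm_ofNat] at b3
  have hωh : |h| * |ω| = 1 / 2 := by
    rw [← abs_mul, hh]
    have : 1 / (2 * ω) * ω = 1 / 2 := by field_simp
    rw [this]; norm_num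
  have b4 := mul_le_mul_of_nonneg_right b3 (abs_nonneg ω)
  have b5 : 3 * (Λ * |h|) * |ω| = 3 * Λ * (|h| * |ω|) := by ring
  rw [b5, hωh] at b4
  linarith

end Transform

namespace Substitution

variable {m : ℕ}

/-! ### The suspension flow in coordinates -/

section Tiles

theorem strictMono_roofSum {s : Fin m → ℝ} (hs : ∀ a, 0 < s a) (x : ℤ → Fin m) : StrictMono (roofSum s x) :=
  strictMono_int_of_lt_succ fun n => by rw [roofSum_add_one]; linarith [hs (x n)]

variable {s : Fin m → ℝ} (hs : ∀ a, 0 < s a)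

theorem tileIndex_spec (x : ℤ → Fin m) (u : ℝ) :
    roofSum s x (tileIndex s hs x u) ≤ u ∧ u < roofSum s x (tileIndex s hs x u + 1) :=
  (exists_tile s hs x u).choose_spec

theorem tileIndex_eq {x : ℤ → Fin m} {u : ℝ} {n : ℤ} (h1 : roofSum s x n ≤ u)
    (h2 : u < roofSum s x (n + 1)) : tileIndex s hs x u = n := by
  have hmono := strictMono_roofSum hs x
  obtain ⟨h3, h4⟩ := tileIndex_spec hs x u
  have h5 := hmono.lt_iff_lt.1 (h3.trans_lt h2)
  have h6 := hmono.lt_iff_lt.1 (h1.trans_lt h4)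
  omega

theorem roofSum_zero (s : Fin m → ℝ) (x : ℤ → Fin m) : roofSum s x 0 = 0 := by
  change roofSum s x (Int.ofNat 0) = 0
  simp [roofSum]

/-- The cylindrical function with profiles `ψ` along the orbit of `(x, 0)`. -/
noncomputable def orbitFun (ψ : Fin m → ℝ → ℂ) (x : ℤ → Fin m) (u : ℝ) : ℂ :=
  ψ (x (tileIndex s hs x u)) (u - roofSum s x (tileIndex s hs x u))

theorem cylindrical_flow (ζ : Substitution m) (ψ : Fin m → ℝ → ℂ) (t : ℝ) (p : ζ.Suspension s) :
    ζ.cylindrical s ψ (ζ.flow s hs t p) = orbitFun hs ψ p.1.1.1 (p.1.2 + t) := by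
  simp [cylindrical, flow, shift, orbitFun]

theorem measurable_roofSum (s : Fin m → ℝ) (n : ℤ) :
    Measurable fun x : ℤ → Fin m => roofSum s x n := by
  have h : ∀ i : ℤ, Measurable fun x : ℤ → Fin m => s (x i) := fun i =>
    (measurable_of_finite s).comp (measurable_pi_apply i)
  rcases n with n | n
  · simp only [roofSum]
    exact Finset.measurable_fun_sum _ fun i _ => h i
  · simp only [roofSum]
    exact (Finset.measurable_fun_sum _ fun i _ => h _).neg

/-- `tileIndex` is made by choice, but the chosen integer is unique, so its fibres are cut out by
two inequalities. -/
theorem measurable_tileIndex :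
    Measurable fun z : (ℤ → Fin m) × ℝ => tileIndex s hs z.1 z.2 := by
  refine measurable_to_countable' fun n => ?_
  have h : (fun z : (ℤ → Fin m) × ℝ => tileIndex s hs z.1 z.2) ⁻¹' {n} =
      {z | roofSum s z.1 n ≤ z.2} ∩ {z | z.2 < roofSum s z.1 (n + 1)} := by
    ext z
    constructor
    · rintro rfl
      exact tileIndex_spec hs z.1 z.2
    · rintro ⟨h1, h2⟩
      exact tileIndex_eq hs h1 h2
  rw [h]
  exact (measurableSet_le ((measurable_roofSum s n).comp measurable_fst) measurable_snd).inter
    (measurableSet_lt measurable_snd ((measurable_roofSum s (n + 1)).comp measurable_fst))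

theorem measurable_orbitFun {ψ : Fin m → ℝ → ℂ} (hψ : ∀ a, Measurable (ψ a)) :
    Measurable fun z : (ℤ → Fin m) × ℝ => orbitFun hs ψ z.1 z.2 := by
  have h1 : Measurable fun w : ℤ × ((ℤ → Fin m) × ℝ) =>
      ψ (w.2.1 w.1) (w.2.2 - roofSum s w.2.1 w.1) := by
    refine measurable_from_prod_countable_right fun n => ?_
    have h2 : Measurable fun w : Fin m × ℝ => ψ w.1 w.2 :=
      measurable_from_prod_countable_right hψ
    exact h2.comp (((measurable_pi_apply n).comp measurable_fst).prodMk
      (measurable_snd.sub ((measurable_roofSum s n).comp measurable_fst)))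
  exact h1.comp ((measurable_tileIndex hs).prodMk measurable_id)

theorem block_succ (x : ℤ → Fin m) (N : ℕ) : block x 0 (N + 1) = block x 0 N ++ [x N] := by
  rw [block_add]
  simp [block]

theorem wordLength_block (s : Fin m → ℝ) (x : ℤ → Fin m) (N : ℕ) :
    wordLength s (block x 0 N) = roofSum s x N := by
  induction N with
  | zero => simp [block, wordLength, roofSum_zero]
  | succ N ih =>
    rw [block_succ, wordLength_append, ih]
    push_cast
    rw [roofSum_add_one]
    simp [wordLength]

/-- The finite Fourier transform of the profile `ψ a` on the tile `[0, s a]`. -/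
noncomputable def tileTransform (s : Fin m → ℝ) (ψ : Fin m → ℝ → ℂ) (ω : ℝ) (a : Fin m) : ℂ :=
  ∫ r in (0 : ℝ)..s a, twist (ω * r) * ψ a r

section Integrals

variable {ψ : Fin m → ℝ → ℂ} {Λ : ℝ}

theorem intervalIntegrable_twist_mul_orbitFun (hψ : ∀ a, Continuous (ψ a))
    (hb : ∀ a r, ‖ψ a r‖ ≤ Λ) (x : ℤ → Fin m) (ω a b : ℝ) :
    IntervalIntegrable (fun u => twist (ω * u) * orbitFun hs ψ x u) volume a b := by
  have hmeas : Measurable fun u => twist (ω * u) * orbitFun hs ψ x u :=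
    (continuous_twist.measurable.comp (measurable_const.mul measurable_id)).mul
      ((measurable_orbitFun hs fun a => (hψ a).measurable).comp
        (measurable_const.prodMk measurable_id))
  rw [intervalIntegrable_iff]
  refine Measure.integrableOn_of_bounded (M := Λ) (by simp [Set.uIoc])
    hmeas.aestronglyMeasurable (Filter.Eventually.of_forall fun u => ?_)
  rw [norm_mul, norm_twist, one_mul]
  exact hb _ _

theorem integral_tile (x : ℤ → Fin m) (ω : ℝ) (n : ℤ) :
    ∫ u in roofSum s x n..roofSum s x (n + 1), twist (ω * u) * orbitFun hs ψ x u =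
      twist (ω * roofSum s x n) * tileTransform s ψ ω (x n) := by
  have hle : roofSum s x n ≤ roofSum s x (n + 1) := by
    rw [roofSum_add_one]; linarith [hs (x n)]
  have h1 : ∫ u in roofSum s x n..roofSum s x (n + 1), twist (ω * u) * orbitFun hs ψ x u =
      ∫ u in roofSum s x n..roofSum s x (n + 1), twist (ω * u) * ψ (x n) (u - roofSum s x n) := by
    rw [intervalIntegral.integral_of_le hle, intervalIntegral.integral_of_le hle,
      integral_Ioc_eq_integral_Ioo, integral_Ioc_eq_integral_Ioo]
    refine setIntegral_congr_fun measurableSet_Ioo fun u hu => ?_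
    simp only [orbitFun, tileIndex_eq hs hu.1.le hu.2]
  have h2 := intervalIntegral.integral_comp_add_right (a := 0) (b := s (x n))
    (fun u => twist (ω * u) * ψ (x n) (u - roofSum s x n)) (roofSum s x n)
  rw [zero_add, add_comm (s (x n)), ← roofSum_add_one] at h2
  rw [h1, ← h2, tileTransform, ← intervalIntegral.integral_const_mul]
  congr 1
  ext r
  rw [add_sub_cancel_right, mul_add, twist_add]
  ring

theorem integral_tiles (hψ : ∀ a, Continuous (ψ a)) (hb : ∀ a r, ‖ψ a r‖ ≤ Λ)
    (x : ℤ → Fin m) (ω : ℝ) (N : ℕ) :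
    ∫ u in (0 : ℝ)..roofSum s x N, twist (ω * u) * orbitFun hs ψ x u =
      twistedSum s ω (tileTransform s ψ ω) (block x 0 N) := by
  induction N with
  | zero => simp [block, twistedSum, roofSum_zero]
  | succ N ih =>
    rw [block_succ, twistedSum_append, ← ih, wordLength_block,
      ← intervalIntegral.integral_add_adjacent_intervals
        (intervalIntegrable_twist_mul_orbitFun hs hψ hb x ω 0 (roofSum s x N))
        (intervalIntegrable_twist_mul_orbitFun hs hψ hb x ω _ _)]
    congr 1
    push_cast
    rw [integral_tile]
    simp [twistedSum]

theorem natCast_mul_le_roofSum {σ : ℝ} (hσ : ∀ a, σ ≤ s a) (x : ℤ → Fin m) (N : ℕ) :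
    N * σ ≤ roofSum s x N := by
  induction N with
  | zero => simp [roofSum_zero]
  | succ N ih =>
    push_cast
    rw [roofSum_add_one]
    linarith [hσ (x N)]

/-- A twisted ergodic integral is, up to boundary terms, a twisted sum over a word of the
language. -/
theorem exists_norm_twisted_integral_le (ζ : Substitution m) (hs1 : ∀ a, s a ≤ 1) {σ : ℝ}
    (hσ0 : 0 < σ) (hσ : ∀ a, σ ≤ s a) (hψ : ∀ a, Continuous (ψ a)) (hb : ∀ a r, ‖ψ a r‖ ≤ Λ)
    (p : ζ.Suspension s) (ω : ℝ) {R : ℝ} (hR : 0 ≤ R) :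
    ∃ N : ℕ, N ≤ (R + 1) / σ ∧
      ‖∫ t in (0 : ℝ)..R, twist (ω * t) * ζ.cylindrical s ψ (ζ.flow s hs t p)‖ ≤
        ‖twistedSum s ω (tileTransform s ψ ω) (block p.1.1.1 0 N)‖ + 2 * Λ := by
  set x := p.1.1.1 with hx
  set r := p.1.2 with hr
  have hr0 : 0 ≤ r := p.2.1
  have hr1 : r ≤ 1 := p.2.2.le.trans (hs1 _)
  have hΛ : 0 ≤ Λ := (norm_nonneg _).trans (hb (x 0) 0)
  obtain ⟨h1, h2⟩ := tileIndex_spec hs x (r + R)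
  have hn0 : 0 ≤ tileIndex s hs x (r + R) := by
    by_contra hneg
    have h3 : tileIndex s hs x (r + R) + 1 ≤ 0 := by omega
    have h4 := (strictMono_roofSum hs x).monotone h3
    rw [roofSum_zero] at h4
    linarith
  obtain ⟨N, hN⟩ := Int.eq_ofNat_of_zero_le hn0
  rw [hN] at h1 h2
  refine ⟨N, ?_, ?_⟩
  · rw [le_div_iff₀ hσ0]
    have := natCast_mul_le_roofSum hσ x N
    linarith
  set F : ℝ → ℂ := fun u => twist (ω * u) * orbitFun hs ψ x u with hF
  have hFi : ∀ a b, IntervalIntegrable F volume a b := fun a b =>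
    intervalIntegrable_twist_mul_orbitFun hs hψ hb x ω a b
  have hFb : ∀ a b : ℝ, ‖∫ u in a..b, F u‖ ≤ Λ * |b - a| := fun a b =>
    intervalIntegral.norm_integral_le_of_norm_le_const fun u _ => by
      rw [hF, norm_mul, norm_twist, one_mul]; exact hb _ _
  have e1 : twist (ω * r) *
      ∫ t in (0 : ℝ)..R, twist (ω * t) * ζ.cylindrical s ψ (ζ.flow s hs t p) =
      ∫ u in r..r + R, F u := by
    have h3 := intervalIntegral.integral_comp_add_left (a := 0) (b := R) F r
    rw [add_zero] at h3
    rw [← h3, ← intervalIntegral.integral_const_mul]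
    congr 1
    ext t
    rw [cylindrical_flow, ← mul_assoc, ← twist_add, ← mul_add]
  -- Whole tiles from 0 to `roofSum s x N`, corrected by an incomplete tile at each end; both have
  -- length at most 1 and cost Λ each.
  have e2 : ∫ u in r..r + R, F u = (∫ u in (0 : ℝ)..roofSum s x N, F u) -
      (∫ u in (0 : ℝ)..r, F u) + ∫ u in roofSum s x N..r + R, F u := by
    rw [← intervalIntegral.integral_add_adjacent_intervals (hFi r (roofSum s x N))
      (hFi _ (r + R)), ← intervalIntegral.integral_interval_sub_left (hFi 0 _) (hFi 0 r)]
  have e3 : ‖∫ t in (0 : ℝ)..R, twist (ω * t) * ζ.cylindrical s ψ (ζ.flow s hs t p)‖ =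
      ‖∫ u in r..r + R, F u‖ := by
    rw [← e1, norm_mul, norm_twist, one_mul]
  rw [e3, e2, integral_tiles hs hψ hb x ω N]
  refine (norm_add_le _ _).trans ?_
  have b1 := norm_sub_le (twistedSum s ω (tileTransform s ψ ω) (block x 0 N))
    (∫ u in (0 : ℝ)..r, F u)
  have b2 : ‖∫ u in (0 : ℝ)..r, F u‖ ≤ Λ := by
    refine (hFb 0 r).trans (mul_le_of_le_one_right hΛ ?_)
    rw [sub_zero, abs_of_nonneg hr0]; exact hr1
  have b3 : ‖∫ u in roofSum s x N..r + R, F u‖ ≤ Λ := by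
    refine (hFb _ _).trans (mul_le_of_le_one_right hΛ ?_)
    rw [abs_of_nonneg (by linarith)]
    rw [roofSum_add_one] at h2
    linarith [hs1 (x N)]
  linarith

end Integrals

end Tiles

end Substitution

/-! ### Lipschitz profiles -/

/-- A real supremum of an unbounded family is 0, so boundedness has to be known before `lipNorm`
controls anything. -/
theorem bddAbove_range_norm_of_lipschitzOnWith {ℓ : ℝ} (hℓ : 0 ≤ ℓ) {φ : ℝ → ℂ} {K : NNReal}
    (h : LipschitzOnWith K φ (Set.Icc 0 ℓ)) :
    BddAbove (Set.range fun t : Set.Icc (0 : ℝ) ℓ => ‖φ t‖) := by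
  refine ⟨‖φ 0‖ + K * ℓ, ?_⟩
  rintro _ ⟨t, rfl⟩
  have h1 := h.dist_le_mul t t.2 0 ⟨le_rfl, hℓ⟩
  rw [dist_eq_norm, Real.dist_eq, sub_zero, abs_of_nonneg t.2.1] at h1
  have h2 := norm_sub_norm_le (φ t) (φ 0)
  have h3 : (K : ℝ) * t ≤ K * ℓ := mul_le_mul_of_nonneg_left t.2.2 K.2
  simp only
  linarith

theorem bddAbove_range_slope_of_lipschitzOnWith {ℓ : ℝ} {φ : ℝ → ℂ} {K : NNReal}
    (h : LipschitzOnWith K φ (Set.Icc 0 ℓ)) :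
    BddAbove (Set.range fun p : Set.Icc (0 : ℝ) ℓ × Set.Icc (0 : ℝ) ℓ =>
      ‖φ p.1 - φ p.2‖ / |(p.1 : ℝ) - p.2|) := by
  refine ⟨K, ?_⟩
  rintro _ ⟨p, rfl⟩
  have h1 := h.dist_le_mul p.1 p.1.2 p.2 p.2.2
  rw [dist_eq_norm, Real.dist_eq] at h1
  exact div_le_of_le_mul₀ (abs_nonneg _) K.2 h1

theorem norm_le_lipNorm {ℓ : ℝ} (hℓ : 0 ≤ ℓ) {φ : ℝ → ℂ} {K : NNReal}
    (h : LipschitzOnWith K φ (Set.Icc 0 ℓ)) {t : ℝ} (ht : t ∈ Set.Icc 0 ℓ) :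
    ‖φ t‖ ≤ lipNorm ℓ φ := by
  have h1 := le_ciSup (bddAbove_range_norm_of_lipschitzOnWith hℓ h) ⟨t, ht⟩
  have h2 : 0 ≤ ⨆ p : Set.Icc (0 : ℝ) ℓ × Set.Icc (0 : ℝ) ℓ,
      ‖φ p.1 - φ p.2‖ / |(p.1 : ℝ) - p.2| := Real.iSup_nonneg fun p => by positivity
  rw [lipNorm]
  simp only at h1
  linarith

theorem norm_sub_le_lipNorm_mul {ℓ : ℝ} {φ : ℝ → ℂ} {K : NNReal}
    (h : LipschitzOnWith K φ (Set.Icc 0 ℓ)) {t t' : ℝ} (ht : t ∈ Set.Icc 0 ℓ)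
    (ht' : t' ∈ Set.Icc 0 ℓ) : ‖φ t - φ t'‖ ≤ lipNorm ℓ φ * |t - t'| := by
  rcases eq_or_ne t t' with rfl | hne
  · simp
  have h1 := le_ciSup (bddAbove_range_slope_of_lipschitzOnWith h) (⟨t, ht⟩, ⟨t', ht'⟩)
  have h2 : 0 ≤ ⨆ t : Set.Icc (0 : ℝ) ℓ, ‖φ t‖ := Real.iSup_nonneg fun p => norm_nonneg _
  rw [← div_le_iff₀ (abs_pos.2 (sub_ne_zero.2 hne)), lipNorm]
  simp only at h1
  linarith

theorem lipNorm_le_cylLipNorm {m : ℕ} (s : Fin m → ℝ) (ψ : Fin m → ℝ → ℂ) (a : Fin m) :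
    lipNorm (s a) (ψ a) ≤ cylLipNorm s ψ :=
  le_ciSup (f := fun a => lipNorm (s a) (ψ a)) (Set.finite_range _).bddAbove a

/-- The extension of a function on `[0, ℓ]` by its boundary values. -/
def clampExtend (ℓ : ℝ) (φ : ℝ → ℂ) (r : ℝ) : ℂ := φ (max 0 (min r ℓ))

theorem clampExtend_of_mem {ℓ : ℝ} (φ : ℝ → ℂ) {r : ℝ} (h0 : 0 ≤ r) (h1 : r ≤ ℓ) :
    clampExtend ℓ φ r = φ r := by
  rw [clampExtend, min_eq_left h1, max_eq_right h0]

theorem clamp_mem {ℓ : ℝ} (hℓ : 0 ≤ ℓ) (r : ℝ) : max 0 (min r ℓ) ∈ Set.Icc 0 ℓ :=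
  ⟨le_max_left _ _, max_le hℓ (min_le_right _ _)⟩

theorem abs_clamp_sub_le (ℓ r r' : ℝ) :
    |max 0 (min r ℓ) - max 0 (min r' ℓ)| ≤ |r - r'| := by
  have h1 := abs_max_sub_max_le_max 0 (min r ℓ) 0 (min r' ℓ)
  have h2 := abs_min_sub_min_le_max r ℓ r' ℓ
  simp only [sub_self, abs_zero, abs_nonneg, sup_of_le_left, sup_of_le_right] at h1 h2
  exact h1.trans h2

/-! ### Power saving for twisted ergodic integrals. -/

namespace Substitution

variable {m : ℕ}

theorem two_le_of_one_lt_absTheta₂ {ζ : Substitution m}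
    (hirr : Irreducible (ζ.matrix.map (Int.cast : ℤ → ℚ)).charpoly) (hθ : 1 < ζ.absTheta₂) :
    2 ≤ m := by
  obtain ⟨θ, hne, h⟩ := exists_two_roots hirr hθ
  set P := (ζ.matrix.map (Int.cast : ℤ → ℂ)).charpoly with hP
  have hP0 : P ≠ 0 := (Matrix.charpoly_monic _).ne_zero
  have h1 : ({θ 0, θ 1} : Finset ℂ) ⊆ P.roots.toFinset := by
    intro z hz
    rw [Multiset.mem_toFinset, Polynomial.mem_roots hP0]
    rcases Finset.mem_insert.1 hz with rfl | hz
    · exact (h 0).1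
    · rw [Finset.mem_singleton.1 hz]; exact (h 1).1
  have h2 := Finset.card_le_card h1
  rw [Finset.card_pair hne] at h2
  have h3 := h2.trans (Multiset.toFinset_card_le _)
  have h4 := h3.trans (Polynomial.card_roots' P)
  rwa [hP, Matrix.charpoly_natDegree_eq_dim, Fintype.card_fin] at h4

/-- Uniform power saving for twisted ergodic integrals, for almost every roof vector. -/
theorem exists_norm_twisted_integral_le_rpow {ζ : Substitution m} (hprim : ζ.Primitive)
    (hirr : Irreducible (ζ.matrix.map (Int.cast : ℤ → ℚ)).charpoly) (hθ : 1 < ζ.absTheta₂) :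
    ∃ α : ℝ, 0 < α ∧
      ∀ᵐ s ∂(Measure.hausdorffMeasure ((m : ℝ) - 1) : Measure (Fin m → ℝ)),
      ∀ hs : s ∈ roofSimplex m, ∃ C > 0,
      ∀ (μ : Measure ζ.Space) [IsProbabilityMeasure μ], MeasurePreserving (ζ.shift 1) μ μ →
      ∀ (ψ : Fin m → ℝ → ℂ) (Λ : ℝ), (∀ a, Continuous (ψ a)) → (∀ a r, ‖ψ a r‖ ≤ Λ) →
        (∀ a r r', ‖ψ a r - ψ a r'‖ ≤ Λ * |r - r'|) →
        ∫ x : ζ.Space, tileTransform s ψ 0 (x.1 0) ∂μ = 0 →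
      ∀ (p : ζ.Suspension s) (ω R : ℝ), 0 < R →
        ‖∫ t in (0 : ℝ)..R, twist (ω * t) * ζ.cylindrical s ψ (ζ.flow s hs.1 t p)‖ ≤
          C * Λ * R ^ (1 - α) := by
  have hm := two_le_of_one_lt_absTheta₂ hirr hθ
  obtain ⟨p, hp0, hp⟩ := hprim.exists_mem
  obtain ⟨q, d, v, hq0, hv⟩ := hprim.exists_return_word hm
  have hl : population (d :: v) ≠ 0 := by
    intro h
    have := congrFun h d
    simp [population] at this
    omega
  obtain ⟨ε, hε, η, hη, hae⟩ := ae_roofSimplex_ekGood hirr hl hθ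
  obtain ⟨κ, hκ, hblock⟩ := exists_blockBound_exp hp0 hq0 hp hv hε hη
  set A : ℝ := (ζ.maxLength : ℝ) with hA
  have hA2 : 2 ≤ A := by rw [hA]; exact_mod_cast ζ.two_le_maxLength
  have hlogA : 0 < Real.log A := Real.log_pos (by linarith)
  -- With n about log R / (2 log A), the boundary blocks cost A^n ≤ R^{1/2} and the block bound
  -- saves e^{-κn}, about R^{-κ/(2 log A)}.
  set α : ℝ := min (1 / 2) (κ / (2 * Real.log A)) with hα
  have hα0 : 0 < α := lt_min (by norm_num) (by positivity)
  have hα1 : α ≤ 1 / 2 := min_le_left _ _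
  have hα2 : α ≤ κ / (2 * Real.log A) := min_le_right _ _
  refine ⟨α, hα0, ?_⟩
  filter_upwards [hae] with s hgood hs
  obtain ⟨C, hC, hbd⟩ := hblock s hs (ekGood_wordLength ζ s _ (hgood hs))
  have : Nonempty (Fin m) := ⟨d⟩
  obtain ⟨a₀, ha₀⟩ := Finite.exists_min s
  have hσ0 : 0 < s a₀ := hs.1 a₀
  have hs1 : ∀ a, s a ≤ 1 := fun a => by
    rw [← hs.2]
    exact Finset.single_le_sum (f := s) (fun i _ => (hs.1 i).le) (Finset.mem_univ a)
  have hs1' : ∀ a, |s a| ≤ 1 := fun a => by rw [abs_of_pos (hs.1 a)]; exact hs1 a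
  set C' : ℝ := C * Real.exp κ * (2 / s a₀) + 2 * A ^ q + 2 with hC'
  have hC'2 : 2 ≤ C' := by
    have : 0 ≤ C * Real.exp κ * (2 / s a₀) + 2 * A ^ q := by positivity
    linarith
  refine ⟨C', by linarith, ?_⟩
  intro μ _ hμ ψ Λ hψ hb hlip hmean P ω R hR
  have hΛ : 0 ≤ Λ := (norm_nonneg _).trans (hb d 0)
  -- For R < 1 the trivial bound ΛR is enough, since R ≤ R^{1-α}.
  rcases lt_or_ge R 1 with hR1 | hR1
  · have h1 : ‖∫ t in (0 : ℝ)..R, twist (ω * t) * ζ.cylindrical s ψ (ζ.flow s hs.1 t P)‖ ≤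
        Λ * R := by
      refine (intervalIntegral.norm_integral_le_of_norm_le_const (C := Λ) fun t _ => ?_).trans ?_
      · rw [norm_mul, norm_twist, one_mul]; exact hb _ _
      · rw [sub_zero, abs_of_pos hR]
    have h2 : R ≤ R ^ (1 - α) := by
      nth_rewrite 1 [← Real.rpow_one R]
      exact Real.rpow_le_rpow_of_exponent_ge hR hR1.le (by linarith)
    calc _ ≤ Λ * R := h1
      _ ≤ Λ * R ^ (1 - α) := by gcongr
      _ ≤ _ := by
        gcongr
        nlinarith
  obtain ⟨N, hN, hint⟩ := exists_norm_twisted_integral_le hs.1 ζ hs1 hσ0 ha₀ hψ hb P ω hR.le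
  set n : ℕ := ⌊Real.log R / (2 * Real.log A)⌋₊ with hn
  have hlogR : 0 ≤ Real.log R := Real.log_nonneg hR1
  have hn1 : (n : ℝ) ≤ Real.log R / (2 * Real.log A) := Nat.floor_le (by positivity)
  have hn2 : Real.log R / (2 * Real.log A) - 1 ≤ n := (Nat.sub_one_lt_floor _).le
  have hmean' : ∀ j, ζ.BlockBound s 0 (tileTransform s ψ 0) (p * j)
      (2 * Λ * (1 - 1 / (ζ.maxLength : ℝ) ^ (p + p)) ^ j) := fun j =>
    blockBound_of_integral_eq_zero hμ hΛ
      (fun a => norm_transform_le (hb a) (hs1' a) 0) hmean hp j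
  obtain ⟨k, hk, hkb⟩ := hbd (tileTransform s ψ) Λ hΛ
    (fun ω a => norm_transform_le (hb a) (hs1' a) ω)
    (fun ω a => norm_transform_mul_le (hψ a) (hb a) (hlip a) (hs1' a) ω)
    (fun ω a => norm_transform_sub_le (hψ a) (hb a) (hs.1 a).le (hs1 a) ω) hmean' n ω
  obtain ⟨K, a, hK⟩ := exists_block_infix P.1.1 N
  have hword := hkb.norm_le_of_infix (by positivity) hΛ
    (fun a => norm_transform_le (hb a) (hs1' a) ω) hK
  rw [length_block] at hword
  have hAk : A ^ k ≤ A ^ q * R ^ (1 - α) := by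
    calc A ^ k ≤ A ^ (n + q) := pow_le_pow_right₀ (by linarith) hk
      _ = A ^ q * A ^ n := by rw [pow_add, mul_comm]
      _ ≤ _ := by
        gcongr
        rw [← Real.exp_log (by positivity : 0 < A ^ n), Real.log_pow, Real.rpow_def_of_pos hR]
        refine Real.exp_le_exp.2 ?_
        rw [le_div_iff₀ (by positivity)] at hn1
        nlinarith
  have hexp : Real.exp (-(κ * n)) * R ≤ Real.exp κ * R ^ (1 - α) := by
    nth_rewrite 1 [← Real.exp_log hR]
    rw [Real.rpow_def_of_pos hR, ← Real.exp_add, ← Real.exp_add]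
    refine Real.exp_le_exp.2 ?_
    have h1 : κ * (Real.log R / (2 * Real.log A) - 1) ≤ κ * n := by gcongr
    have h2 : α * Real.log R ≤ κ / (2 * Real.log A) * Real.log R := by gcongr
    have h3 : κ / (2 * Real.log A) * Real.log R = κ * (Real.log R / (2 * Real.log A)) := by ring
    linarith
  have hone : 1 ≤ R ^ (1 - α) := Real.one_le_rpow hR1 (by linarith)
  have hNR : (N : ℝ) ≤ 2 / s a₀ * R := by
    refine hN.trans ?_
    rw [div_mul_eq_mul_div]
    gcongr
    linarith
  calc _ ≤ _ := hint
    _ ≤ C * Λ * Real.exp (-(κ * n)) * N + 2 * Λ * A ^ k + 2 * Λ := by linarith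
    _ ≤ C * Λ * Real.exp (-(κ * n)) * (2 / s a₀ * R) + 2 * Λ * (A ^ q * R ^ (1 - α)) +
        2 * Λ * R ^ (1 - α) := by
        refine add_le_add ?_ (le_mul_of_one_le_right (by positivity) hone)
        gcongr
    _ = C * Λ * (2 / s a₀) * (Real.exp (-(κ * n)) * R) + 2 * Λ * (A ^ q * R ^ (1 - α)) +
        2 * Λ * R ^ (1 - α) := by ring
    _ ≤ C * Λ * (2 / s a₀) * (Real.exp κ * R ^ (1 - α)) + 2 * Λ * (A ^ q * R ^ (1 - α)) +
        2 * Λ * R ^ (1 - α) := by gcongr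
    _ = _ := by rw [hC']; ring

/-! ### The measure on the suspension -/

theorem measurableSet_suspension (ζ : Substitution m) (s : Fin m → ℝ) :
    MeasurableSet {p : ζ.Space × ℝ | 0 ≤ p.2 ∧ p.2 < s (p.1.1 0)} :=
  (measurableSet_le measurable_const measurable_snd).inter (measurableSet_lt measurable_snd
    ((measurable_of_finite s).comp ((measurable_letter 0).comp measurable_fst)))

theorem suspensionMeasure_univ_le_one (ζ : Substitution m) (s : Fin m → ℝ) (μ : Measure ζ.Space) :
    ζ.suspensionMeasure s μ Set.univ ≤ 1 := by
  simp only [suspensionMeasure, Measure.smul_apply, smul_eq_mul]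
  exact ENNReal.inv_mul_le_one _

theorem volume_suspension_lt_top (ζ : Substitution m) {s : Fin m → ℝ} (hs1 : ∀ a, s a ≤ 1)
    (μ : Measure ζ.Space) [IsProbabilityMeasure μ] :
    (μ.prod (volume : Measure ℝ)) {p : ζ.Space × ℝ | 0 ≤ p.2 ∧ p.2 < s (p.1.1 0)} < ⊤ := by
  refine lt_of_le_of_lt (measure_mono (t := Set.univ ×ˢ Set.Icc (0 : ℝ) 1) ?_) ?_
  · rintro z ⟨h0, h1⟩
    exact ⟨trivial, h0, h1.le.trans (hs1 _)⟩
  · rw [Measure.prod_prod]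
    simp

/-- By Fubini over the fundamental domain, the mean of f is, up to normalisation, the μ-mean of the
integral of ψ over the tile at the origin, which is its transform at frequency 0. -/
theorem integral_tileTransform_eq_zero (ζ : Substitution m) {s : Fin m → ℝ} (hs : ∀ a, 0 < s a)
    (hs1 : ∀ a, s a ≤ 1) (μ : Measure ζ.Space) [IsProbabilityMeasure μ] {ψ : Fin m → ℝ → ℂ}
    {Λ : ℝ} (hψ : ∀ a, Continuous (ψ a)) (hb : ∀ a r, ‖ψ a r‖ ≤ Λ)
    (hmean : ∫ p, ζ.cylindrical s ψ p ∂(ζ.suspensionMeasure s μ) = 0) :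
    ∫ x : ζ.Space, tileTransform s ψ 0 (x.1 0) ∂μ = 0 := by
  set D : Set (ζ.Space × ℝ) := {p : ζ.Space × ℝ | 0 ≤ p.2 ∧ p.2 < s (p.1.1 0)} with hD
  have hDm : MeasurableSet D := measurableSet_suspension ζ s
  have hDfin := volume_suspension_lt_top ζ hs1 μ
  set F : ζ.Space × ℝ → ℂ := fun z => ψ (z.1.1 0) z.2 with hF
  have hFm : Measurable F := by
    have h2 : Measurable fun w : Fin m × ℝ => ψ w.1 w.2 :=
      measurable_from_prod_countable_right fun a => (hψ a).measurable
    exact h2.comp (((measurable_letter 0).comp measurable_fst).prodMk measurable_snd)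
  set ρ : Measure (ζ.Suspension s) := (μ.prod (volume : Measure ℝ)).comap Subtype.val with hρ
  have hρu : ρ Set.univ = (μ.prod (volume : Measure ℝ)) D := by
    refine (comap_subtype_coe_apply hDm _ _).trans ?_
    rw [Set.image_univ, Subtype.range_coe]
  have h1 : ∫ p, ζ.cylindrical s ψ p ∂ρ = 0 := by
    by_cases h0 : ρ Set.univ = 0
    · rw [Measure.measure_univ_eq_zero.1 h0, integral_zero_measure]
    · have h2 : ∫ p, ζ.cylindrical s ψ p ∂((ρ Set.univ)⁻¹ • ρ) = 0 := hmean
      rw [integral_smul_measure] at h2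
      refine (smul_eq_zero.1 h2).resolve_left ?_
      refine ENNReal.toReal_ne_zero.2 ⟨ENNReal.inv_ne_zero.2 ?_, ENNReal.inv_ne_top.2 h0⟩
      rw [hρu]
      exact hDfin.ne
  have h2 : ∫ z in D, F z ∂(μ.prod (volume : Measure ℝ)) = 0 := by
    rw [← integral_subtype_comap hDm]
    exact h1
  have hFi : Integrable (D.indicator F) (μ.prod (volume : Measure ℝ)) := by
    rw [integrable_indicator_iff hDm]
    exact Measure.integrableOn_of_bounded hDfin.ne hFm.aestronglyMeasurable (M := Λ)
      (Filter.Eventually.of_forall fun z => hb _ _)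
  rw [← integral_indicator hDm, integral_prod _ hFi] at h2
  rw [← h2]
  refine integral_congr_ae (Filter.Eventually.of_forall fun x => ?_)
  have h3 : (fun r : ℝ => D.indicator F (x, r)) =
      (Set.Ico 0 (s (x.1 0))).indicator (fun r => ψ (x.1 0) r) := by
    ext r
    by_cases hr : r ∈ Set.Ico 0 (s (x.1 0))
    · rw [Set.indicator_of_mem hr, Set.indicator_of_mem (show (x, r) ∈ D from hr)]
    · rw [Set.indicator_of_notMem hr, Set.indicator_of_notMem (show (x, r) ∉ D from hr)]
  simp only
  rw [h3, integral_indicator measurableSet_Ico, integral_Ico_eq_integral_Ioc,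
    ← intervalIntegral.integral_of_le (hs _).le, tileTransform]
  simp [twist_zero]

end Substitution

/-! ### Correlations of tensor products -/

theorem integral_norm_sq_eq_eLpNorm_sq {Y : Type*} [MeasurableSpace Y] {ν : Measure Y} {g : Y → ℂ}
    (hg : MemLp g 2 ν) : ∫ y, ‖g y‖ ^ 2 ∂ν = (eLpNorm g 2 ν).toReal ^ 2 := by
  have h0 : 0 ≤ ∫ y, ‖g y‖ ^ 2 ∂ν := integral_nonneg fun y => by positivity
  rw [hg.eLpNorm_eq_integral_rpow_norm (by norm_num) (by norm_num),
    ENNReal.toReal_ofReal (by positivity), ← Real.rpow_natCast, ← Real.rpow_mul (by positivity)]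
  simp

section TensorProduct

variable {X Y : Type*} [MeasurableSpace X] [MeasurableSpace Y] [AddAction ℝ Y]
  [MeasurableVAdd₂ ℝ Y] {ρ : Measure X} {ν : Measure Y} [VAddInvariantMeasure ℝ Y ν]

theorem norm_autocorrelation_le {g : Y → ℂ} (hg2 : MemLp g 2 ν) (t : ℝ) :
    ‖∫ y, g (t +ᵥ y) * (starRingEnd ℂ) (g y) ∂ν‖ ≤ ∫ y, ‖g y‖ ^ 2 ∂ν := by
  have hi : Integrable (fun y => ‖g y‖ ^ 2) ν := hg2.norm.integrable_sq
  have hit : Integrable (fun y => ‖g (t +ᵥ y)‖ ^ 2) ν :=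
    (measurePreserving_vadd t ν).integrable_comp_of_integrable hi
  calc ‖∫ y, g (t +ᵥ y) * (starRingEnd ℂ) (g y) ∂ν‖
      ≤ ∫ y, (‖g (t +ᵥ y)‖ ^ 2 / 2 + ‖g y‖ ^ 2 / 2) ∂ν := by
        refine norm_integral_le_of_norm_le ((hit.div_const 2).add (hi.div_const 2))
          (Filter.Eventually.of_forall fun y => ?_)
        rw [norm_mul, RCLike.norm_conj]
        nlinarith [sq_nonneg (‖g (t +ᵥ y)‖ - ‖g y‖)]
    _ = ∫ y, ‖g y‖ ^ 2 ∂ν := by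
        rw [integral_add (hit.div_const 2) (hi.div_const 2), integral_div, integral_div,
          integral_comp_vadd t hi.aestronglyMeasurable]
        ring

variable [IsProbabilityMeasure ν]

/-- After exchanging the integrals over t and x, transference applies for each x with weight u(t) =
F t x; the remaining factor f(x) is at most Λ and ρ has mass at most 1. -/
theorem norm_integral_tensor_autocorrelation_le_of_measurable [IsFiniteMeasure ρ]
    (hρ : ρ Set.univ ≤ 1) {R : ℝ} (hR : 0 < R) {F : ℝ → X → ℂ}
    (hF : Measurable fun z : ℝ × X => F z.1 z.2) {f : X → ℂ} (hf : Measurable f) {Λ : ℝ}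
    (hFb : ∀ t x, ‖F t x‖ ≤ Λ) (hfb : ∀ x, ‖f x‖ ≤ Λ) (hΛ : 0 ≤ Λ) {M : ℝ} (hM0 : 0 < M)
    (hM : ∀ x, ∀ ω : ℝ, ‖∫ t in (0 : ℝ)..R, twist (ω * t) * F t x‖ ≤ M) {g : Y → ℂ}
    (hg : Measurable g) (hg2 : MemLp g 2 ν) :
    ‖∫ t in (0 : ℝ)..R, (∫ x, F t x * (starRingEnd ℂ) (f x) ∂ρ) *
        ∫ y, g (t +ᵥ y) * (starRingEnd ℂ) (g y) ∂ν‖ ≤ 2 * Λ * M * ∫ y, ‖g y‖ ^ 2 ∂ν := by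
  set φ : ℝ → ℂ := fun t => ∫ y, g (t +ᵥ y) * (starRingEnd ℂ) (g y) ∂ν with hφ
  set E : ℝ := ∫ y, ‖g y‖ ^ 2 ∂ν with hE
  have hE0 : 0 ≤ E := integral_nonneg fun y => by positivity
  have hconj : Measurable (starRingEnd ℂ) := Complex.continuous_conj.measurable
  have hφm : Measurable φ := by
    have h : Measurable fun z : ℝ × Y => g (z.1 +ᵥ z.2) * (starRingEnd ℂ) (g z.2) :=
      (hg.comp (measurable_fst.vadd measurable_snd)).mul (hconj.comp (hg.comp measurable_snd))
    exact h.stronglyMeasurable.integral_prod_right'.measurable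
  set G : ℝ × X → ℂ := fun z => F z.1 z.2 * (starRingEnd ℂ) (f z.2) * φ z.1 with hG
  have hGi : Integrable G ((volume.restrict (Set.Ioc 0 R)).prod ρ) := by
    have hGm : Measurable G :=
      (hF.mul (hconj.comp (hf.comp measurable_snd))).mul (hφm.comp measurable_fst)
    refine Integrable.of_bound hGm.aestronglyMeasurable (Λ * Λ * E)
      (Filter.Eventually.of_forall fun z => ?_)
    rw [hG, norm_mul, norm_mul, RCLike.norm_conj]
    gcongr
    · exact hFb _ _
    · exact hfb _
    · exact norm_autocorrelation_le hg2 _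
  have hswap : ∫ t in (0 : ℝ)..R, (∫ x, F t x * (starRingEnd ℂ) (f x) ∂ρ) * φ t =
      ∫ x, ((starRingEnd ℂ) (f x) * ∫ t in (0 : ℝ)..R, F t x * φ t) ∂ρ := by
    rw [intervalIntegral.integral_of_le hR.le]
    calc _ = ∫ t in Set.Ioc 0 R, ∫ x, G (t, x) ∂ρ := by
          refine integral_congr_ae (Filter.Eventually.of_forall fun t => ?_)
          simp only [hG]
          rw [integral_mul_const]
      _ = ∫ x, (∫ t in Set.Ioc 0 R, G (t, x)) ∂ρ :=
          integral_integral_swap (f := fun t x => G (t, x)) hGi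
      _ = _ := by
          refine integral_congr_ae (Filter.Eventually.of_forall fun x => ?_)
          simp only [hG]
          rw [intervalIntegral.integral_of_le hR.le, ← integral_const_mul]
          refine integral_congr_ae (Filter.Eventually.of_forall fun t => ?_)
          simp only
          ring
  rw [hswap]
  have hpt : ∀ x, ‖(starRingEnd ℂ) (f x) * ∫ t in (0 : ℝ)..R, F t x * φ t‖ ≤ 2 * Λ * M * E := by
    intro x
    have h := norm_integral_mul_autocorrelation_le hR (u := fun t => F t x)
      (hF.comp (measurable_id.prodMk measurable_const)) (fun t => hFb t x) hM0 (hM x) hg hg2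
    rw [norm_mul, RCLike.norm_conj]
    calc _ ≤ Λ * (2 * M * E) := mul_le_mul (hfb x) h (norm_nonneg _) hΛ
      _ = _ := by ring
  refine (norm_integral_le_of_norm_le_const (Filter.Eventually.of_forall hpt)).trans ?_
  refine mul_le_of_le_one_right (by positivity) ?_
  exact ENNReal.toReal_le_of_le_ofReal zero_le_one (by simpa using hρ)

/-- The integral over the product splits into two factors, and g may be replaced by a measurable
representative because the flow preserves null sets. -/
theorem norm_integral_tensor_autocorrelation_le [IsFiniteMeasure ρ]
    (hρ : ρ Set.univ ≤ 1) {R : ℝ} (hR : 0 < R) {F : ℝ → X → ℂ}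
    (hF : Measurable fun z : ℝ × X => F z.1 z.2) {f : X → ℂ} (hf : Measurable f) {Λ : ℝ}
    (hFb : ∀ t x, ‖F t x‖ ≤ Λ) (hfb : ∀ x, ‖f x‖ ≤ Λ) (hΛ : 0 ≤ Λ) {M : ℝ} (hM0 : 0 < M)
    (hM : ∀ x, ∀ ω : ℝ, ‖∫ t in (0 : ℝ)..R, twist (ω * t) * F t x‖ ≤ M) {g : Y → ℂ}
    (hg2 : MemLp g 2 ν) :
    ‖∫ t in (0 : ℝ)..R, ∫ z : X × Y,
        (F t z.1 * g (t +ᵥ z.2)) * (starRingEnd ℂ) (f z.1 * g z.2) ∂(ρ.prod ν)‖ ≤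
      2 * Λ * M * ∫ y, ‖g y‖ ^ 2 ∂ν := by
  set g' : Y → ℂ := hg2.1.mk g with hg'
  have hae : g =ᵐ[ν] g' := hg2.1.ae_eq_mk
  have hsq : ∫ y, ‖g y‖ ^ 2 ∂ν = ∫ y, ‖g' y‖ ^ 2 ∂ν := by
    refine integral_congr_ae ?_
    filter_upwards [hae] with y hy
    rw [hy]
  have hcorr : ∀ t : ℝ, ∫ z : X × Y,
      (F t z.1 * g (t +ᵥ z.2)) * (starRingEnd ℂ) (f z.1 * g z.2) ∂(ρ.prod ν) =
      (∫ x, F t x * (starRingEnd ℂ) (f x) ∂ρ) *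
        ∫ y, g' (t +ᵥ y) * (starRingEnd ℂ) (g' y) ∂ν := by
    intro t
    have h1 : ∫ y, g' (t +ᵥ y) * (starRingEnd ℂ) (g' y) ∂ν =
        ∫ y, g (t +ᵥ y) * (starRingEnd ℂ) (g y) ∂ν := by
      refine integral_congr_ae ?_
      filter_upwards [hae, (measurePreserving_vadd t ν).quasiMeasurePreserving.ae_eq_comp hae]
        with y hy hy'
      simp only [Function.comp_apply] at hy'
      rw [hy, hy']
    rw [h1, ← integral_prod_mul]
    refine integral_congr_ae (Filter.Eventually.of_forall fun z => ?_)
    simp only [map_mul]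
    ring
  simp only [hcorr]
  rw [hsq]
  exact norm_integral_tensor_autocorrelation_le_of_measurable hρ hR hF hf hFb hfb hΛ hM0 hM
    hg2.1.stronglyMeasurable_mk.measurable ((memLp_congr_ae hae).1 hg2)

end TensorProduct

/-! ### The theorem. -/

theorem theorem1 (m : ℕ) (ζ : Substitution m) (hprim : ζ.Primitive) (haper : ζ.Aperiodic)
    (hirr : Irreducible (ζ.matrix.map (Int.cast : ℤ → ℚ)).charpoly)
    (hθ : 1 < ζ.absTheta₂) :
    ∃ α : ℝ, 0 < α ∧
      ∀ᵐ s ∂(Measure.hausdorffMeasure ((m : ℝ) - 1) : Measure (Fin m → ℝ)),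
      ∀ hs : s ∈ roofSimplex m,
      ∃ C : ℝ → ℝ → ℝ, (∀ a b, 0 < C a b) ∧
      -- the invariant probability measure of `(X_ζ, T_ζ)`
      ∀ (μ : Measure ζ.Space) [IsProbabilityMeasure μ], MeasurePreserving (ζ.shift 1) μ μ →
      -- the mean-zero Lipschitz cylindrical function `f`
      ∀ ψ : Fin m → ℝ → ℂ,
        (∀ a, ∃ K, LipschitzOnWith K (ψ a) (Set.Icc 0 (s a))) →
        ∫ p, ζ.cylindrical s ψ p ∂(ζ.suspensionMeasure s μ) = 0 →
      -- the ergodic flow `(Y, H_t, ν)` and the function `g ∈ L²₀(Y, ν)`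
      ∀ (Y : Type*) [MeasurableSpace Y] [AddAction ℝ Y] [MeasurableVAdd₂ ℝ Y]
        (ν : Measure Y) [IsProbabilityMeasure ν] [ErgodicVAdd ℝ Y ν]
        (g : Y → ℂ), MemLp g 2 ν → ∫ y, g y ∂ν = 0 →
      ∀ R : ℝ, 0 < R →
        ‖∫ t in (0 : ℝ)..R, ∫ p : ζ.Suspension s × Y,
            tensorFun (ζ.cylindrical s ψ) g (ζ.flow s hs.1 t p.1, t +ᵥ p.2) *
              (starRingEnd ℂ) (tensorFun (ζ.cylindrical s ψ) g p)
            ∂((ζ.suspensionMeasure s μ).prod ν)‖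
          ≤ C (cylLipNorm s ψ) (eLpNorm g 2 ν).toReal * R ^ (1 - α) := by
  obtain ⟨α, hα, hae⟩ := Substitution.exists_norm_twisted_integral_le_rpow hprim hirr hθ
  refine ⟨α, hα, ?_⟩
  filter_upwards [hae] with s hbound hs
  obtain ⟨C₀, hC₀, hC⟩ := hbound hs
  refine ⟨fun a b => 2 * C₀ * (|a| + 1) ^ 2 * (b ^ 2 + 1), fun a b => by positivity, ?_⟩
  intro μ _ hμ ψ hψ hmean Y _ _ _ ν _ _ g hg2 _ R hR
  have hs1 : ∀ a, s a ≤ 1 := fun a => by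
    rw [← hs.2]
    exact Finset.single_le_sum (f := s) (fun i _ => (hs.1 i).le) (Finset.mem_univ a)
  -- The added 1 makes the bound M of the transference lemma strictly positive, also when f = 0.
  set Λ : ℝ := |cylLipNorm s ψ| + 1 with hΛ
  have hΛ0 : 0 < Λ := by positivity
  have hle : ∀ a, lipNorm (s a) (ψ a) ≤ Λ := fun a =>
    (lipNorm_le_cylLipNorm s ψ a).trans ((le_abs_self _).trans (by linarith))
  -- Nothing is known about ψ a outside [0, s a]. The clamped profile is Lipschitz on all of ℝ with
  -- the same bounds and defines the same function on the suspension.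
  set ψ' : Fin m → ℝ → ℂ := fun a => clampExtend (s a) (ψ a) with hψ'
  have hb : ∀ a r, ‖ψ' a r‖ ≤ Λ := fun a r =>
    (norm_le_lipNorm (hs.1 a).le (hψ a).choose_spec (clamp_mem (hs.1 a).le r)).trans (hle a)
  have hlip : ∀ a r r', ‖ψ' a r - ψ' a r'‖ ≤ Λ * |r - r'| := fun a r r' =>
    (norm_sub_le_lipNorm_mul (hψ a).choose_spec (clamp_mem (hs.1 a).le r)
      (clamp_mem (hs.1 a).le r')).trans ((mul_le_mul_of_nonneg_right (hle a) (abs_nonneg _)).trans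
        (mul_le_mul_of_nonneg_left (abs_clamp_sub_le _ _ _) hΛ0.le))
  have hcont : ∀ a, Continuous (ψ' a) := fun a =>
    (LipschitzWith.of_dist_le_mul (K := ⟨Λ, hΛ0.le⟩) fun r r' => by
      rw [dist_eq_norm, Real.dist_eq]; exact hlip a r r').continuous
  have hcyl : ζ.cylindrical s ψ = ζ.cylindrical s ψ' := by
    funext p
    exact (clampExtend_of_mem _ p.2.1 p.2.2.le).symm
  rw [hcyl] at hmean ⊢
  set ρ := ζ.suspensionMeasure s μ with hρ
  have hρ1 : ρ Set.univ ≤ 1 := Substitution.suspensionMeasure_univ_le_one ζ s μ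
  have : IsFiniteMeasure ρ := ⟨hρ1.trans_lt ENNReal.one_lt_top⟩
  have hmean0 := Substitution.integral_tileTransform_eq_zero ζ hs.1 hs1 μ hcont hb hmean
  have hcylm : Measurable (ζ.cylindrical s ψ') := by
    have h : Measurable fun w : Fin m × ℝ => ψ' w.1 w.2 :=
      measurable_from_prod_countable_right fun a => (hcont a).measurable
    exact h.comp (((Substitution.measurable_letter 0).comp
      (measurable_fst.comp measurable_subtype_coe)).prodMk
        (measurable_snd.comp measurable_subtype_coe))
  have hflow : Measurable fun z : ℝ × ζ.Suspension s =>
      ζ.cylindrical s ψ' (ζ.flow s hs.1 z.1 z.2) := by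
    simp only [Substitution.cylindrical_flow]
    have h2 : Measurable fun z : ℝ × ζ.Suspension s => z.2.1 :=
      measurable_subtype_coe.comp measurable_snd
    exact (Substitution.measurable_orbitFun hs.1 fun a => (hcont a).measurable).comp
      ((measurable_subtype_coe.comp (measurable_fst.comp h2)).prodMk
        ((measurable_snd.comp h2).add measurable_fst))
  have hmain := norm_integral_tensor_autocorrelation_le (ρ := ρ) (ν := ν) hρ1 hR
    (F := fun t p => ζ.cylindrical s ψ' (ζ.flow s hs.1 t p)) hflow hcylm
    (fun t p => hb _ _) (fun p => hb _ _) hΛ0.le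
    (M := C₀ * Λ * R ^ (1 - α)) (by positivity)
    (fun p ω => hC μ hμ ψ' Λ hcont hb hlip hmean0 p ω R hR) hg2
  refine hmain.trans ?_
  rw [integral_norm_sq_eq_eLpNorm_sq hg2]
  set e := (eLpNorm g 2 ν).toReal
  have h0 : 0 ≤ 2 * C₀ * Λ ^ 2 * R ^ (1 - α) := by positivity
  calc 2 * Λ * (C₀ * Λ * R ^ (1 - α)) * e ^ 2
      = 2 * C₀ * Λ ^ 2 * R ^ (1 - α) * e ^ 2 := by ring
    _ ≤ 2 * C₀ * Λ ^ 2 * R ^ (1 - α) * (e ^ 2 + 1) := by gcongr; linarith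
    _ = _ := by ring
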